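/- Let $n\ge 1$, let $\sigma:\mathbb{C}^{n+1}\setminus\{0\}\to\mathbb{P}^n$ be the projection onto complex projective space, and let $H\subset\mathbb{P}^n$ be an algebraic Levi-flat hypervariety, that is: (a) $H=\sigma(V\setminus\{0\})$ for some set $V\subset\mathbb{C}^{n+1}$ that is the common zero set of real polynomials in the real and imaginary parts of the coordinates and is a complex cone ($z\in V$, $\lambda\in\mathbb{C}$ imply $\lambda z\in V$); (b) $H$ has real codimension one: $\dim H=2n-1$; (c) near every point near which $H$ is a smooth real hypersurface (a smooth submanifold of real dimension $2n-1$), $H$ is Levi-flat, i.e. pseudoconvex from both sides. Let $H_{sing}$ be the set of points of $H$ near which $H$ is not a smooth real submanifold (of any dimension). Then $$2n-4\le \dim H_{sing}\le 2n-2 .$$ Here $\dim$ is real dimension: the largest dimension of a nonempty smooth real submanifold of $\mathbb{P}^n$ contained in the set, with $\dim\emptyset=-1$. (Thus $H_{sing}\neq\emptyset$ if $n\ge 2$; if $n=1$ the lower bound is no condition.) -/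

import Mathlib

open scoped ContDiff

noncomputable section

namespace LeviFlat

/-- Complex affine space `ℂⁿ`; it is also used as the real vector space `ℝ²ⁿ`. -/
abbrev CSpace (n : ℕ) : Type := Fin n → ℂ

/-- Complex projective space `ℙⁿ`. -/
abbrev CProj (n : ℕ) : Type := Projectivization ℂ (CSpace (n + 1))

theorem insertNth_one_ne_zero {n : ℕ} (j : Fin (n + 1)) (w : CSpace n) :
    (Fin.insertNth j (1 : ℂ) w : CSpace (n + 1)) ≠ 0 := by
  intro h
  have h1 := congrFun h j
  simp at h1

/-- The standard affine parametrization
`(w₀, …, wₙ₋₁) ↦ [w₀ : … : 1 : … : wₙ₋₁]` of `{z_j ≠ 0} ⊆ ℙⁿ`, with the `1` at place `j`. -/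
def affineChart {n : ℕ} (j : Fin (n + 1)) (w : CSpace n) : CProj n :=
  Projectivization.mk ℂ (Fin.insertNth j (1 : ℂ) w) (insertNth_one_ne_zero j w)

/-! ### Smooth points and real dimension -/

/-- `S ⊆ ℂⁿ` is, near its point `w`, a smooth (i.e. `C^∞`) real submanifold of real dimension `d`:
on an open neighbourhood `U` of `w`, the set `S` is the zero set of a smooth map
`U → ℝᵏ`, `d + k = 2n`, whose derivative is surjective at every point of `S ∩ U`. -/
def IsSubmanifoldNear {n : ℕ} (d : ℕ) (S : Set (CSpace n)) (w : CSpace n) : Prop :=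
  w ∈ S ∧ ∃ (k : ℕ) (U : Set (CSpace n)) (f : CSpace n → (Fin k → ℝ)),
    d + k = 2 * n ∧ IsOpen U ∧ w ∈ U ∧ ContDiffOn ℝ ∞ f U ∧
    (∀ x ∈ U ∩ S, Function.Surjective (fderiv ℝ f x)) ∧
    ∀ x ∈ U, x ∈ S ↔ f x = 0

/-- `X ⊆ ℙⁿ` is, near its point `p`, a smooth real submanifold of real dimension `d`. Since the
changes of affine charts are diffeomorphisms, it does not matter which chart is used. -/
def IsProjSubmanifoldNear {n : ℕ} (d : ℕ) (X : Set (CProj n)) (p : CProj n) : Prop :=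
  ∃ (j : Fin (n + 1)) (w : CSpace n),
    affineChart j w = p ∧ IsSubmanifoldNear d (affineChart j ⁻¹' X) w

/-- `X ⊆ ℙⁿ` contains a nonempty smooth real submanifold of `ℙⁿ` of real dimension `d`. -/
def ContainsSubmanifold {n : ℕ} (d : ℕ) (X : Set (CProj n)) : Prop :=
  ∃ M : Set (CProj n), M ⊆ X ∧ M.Nonempty ∧ ∀ p ∈ M, IsProjSubmanifoldNear d M p

/-- The real dimension of a (semianalytic, semialgebraic, …) subset of `ℙⁿ`: the largest dimension
of a nonempty smooth submanifold contained in it, and `-1` for the empty set. -/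
def realDim {n : ℕ} (X : Set (CProj n)) : ℤ :=
  sSup (insert (-1) {d : ℤ | ∃ k : ℕ, d = (k : ℤ) ∧ ContainsSubmanifold k X})

/-- The set whose supremum is `realDim X` is bounded, so that the supremum is a maximum. -/
theorem realDim_bddAbove {n : ℕ} (X : Set (CProj n)) :
    BddAbove (insert (-1) {d : ℤ | ∃ k : ℕ, d = (k : ℤ) ∧ ContainsSubmanifold k X}) := by
  refine ⟨2 * (n : ℤ), ?_⟩
  rintro d (rfl | ⟨k, rfl, M, -, ⟨p, hp⟩, hM⟩)
  · lia
  · obtain ⟨j, w, -, -, l, U, f, hk, -⟩ := hM p hp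
    lia

/-- The singular set `X_sing`: the points of `X` near which `X` is not a smooth submanifold
(of any dimension). -/
def singularSet {n : ℕ} (X : Set (CProj n)) : Set (CProj n) :=
  {p | p ∈ X ∧ ¬ ∃ d : ℕ, IsProjSubmanifoldNear d X p}

/-! ### Real-algebraic subvarieties of projective space -/

/-- `V ⊆ ℂᵐ` is real-algebraic: it is the common zero set of a set of real polynomials in the real
and imaginary parts of the coordinates. -/
def IsRealAlgebraic {m : ℕ} (V : Set (CSpace m)) : Prop :=
  ∃ I : Set (MvPolynomial (Fin m ⊕ Fin m) ℝ),
    V = {z | ∀ P ∈ I,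
      MvPolynomial.eval (Sum.elim (fun i => (z i).re) (fun i => (z i).im)) P = 0}

/-- `V ⊆ ℂᵐ` is a complex cone. -/
def IsComplexCone {m : ℕ} (V : Set (CSpace m)) : Prop :=
  ∀ z ∈ V, ∀ c : ℂ, c • z ∈ V

/-- The image `σ(V)` of (the nonzero points of) `V ⊆ ℂⁿ⁺¹` in `ℙⁿ`. -/
def projImage {n : ℕ} (V : Set (CSpace (n + 1))) : Set (CProj n) :=
  {p | ∃ (z : CSpace (n + 1)) (hz : z ≠ 0), z ∈ V ∧ Projectivization.mk ℂ z hz = p}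

/-- `X ⊆ ℙⁿ` is an algebraic subvariety: `X = σ(V)` for a real-algebraic complex cone `V`.
(Such a set is a closed real-analytic subset of `ℙⁿ`: in each affine chart it is the zero set of
real polynomials.) -/
def IsAlgebraicSubvariety {n : ℕ} (X : Set (CProj n)) : Prop :=
  ∃ V : Set (CSpace (n + 1)), IsRealAlgebraic V ∧ IsComplexCone V ∧ X = projImage V

/-- An algebraic hypervariety of `ℙⁿ`: an algebraic subvariety of real codimension one. -/
def IsAlgebraicHypervariety {n : ℕ} (X : Set (CProj n)) : Prop :=
  IsAlgebraicSubvariety X ∧ realDim X = 2 * (n : ℤ) - 1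

/-! ### Levi-flatness -/

/-- The Levi form `∑ⱼₖ (∂²r / ∂zⱼ ∂z̄ₖ)(w) vⱼ v̄ₖ` of a real function `r`, written as
`(D²r(w)(v, v) + D²r(w)(iv, iv)) / 4`. -/
def leviForm {n : ℕ} (r : CSpace n → ℝ) (w v : CSpace n) : ℝ :=
  (fderiv ℝ (fderiv ℝ r) w v v
    + fderiv ℝ (fderiv ℝ r) w (Complex.I • v) (Complex.I • v)) / 4

/-- `v` is a complex tangent vector at `w` of the hypersurface `{r = 0}`, i.e.
`∑ⱼ (∂r / ∂zⱼ)(w) vⱼ = 0`: both `v` and `iv` are tangent. -/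
def IsComplexTangent {n : ℕ} (r : CSpace n → ℝ) (w v : CSpace n) : Prop :=
  fderiv ℝ r w v = 0 ∧ fderiv ℝ r w (Complex.I • v) = 0

/-- The hypersurface `{r = 0}` is (Levi) pseudoconvex at `w` from the side `{r < 0}`. -/
def IsPseudoconvexAt {n : ℕ} (r : CSpace n → ℝ) (w : CSpace n) : Prop :=
  ∀ v : CSpace n, IsComplexTangent r w v → 0 ≤ leviForm r w v

/-- `r` is a smooth local defining function of a smooth real hypersurface `S ⊆ ℂⁿ` near the
point `w` of `S`. -/
def IsDefiningFunctionNear {n : ℕ} (S : Set (CSpace n)) (w : CSpace n) (r : CSpace n → ℝ) : Prop :=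
  w ∈ S ∧ ∃ U : Set (CSpace n), IsOpen U ∧ w ∈ U ∧ ContDiffOn ℝ ∞ r U ∧
    (∀ x ∈ U ∩ S, fderiv ℝ r x ≠ 0) ∧ ∀ x ∈ U, x ∈ S ↔ r x = 0

/-- `X ⊆ ℙⁿ` is Levi-flat: at every point near which `X` is a smooth real hypersurface, it is
pseudoconvex from both sides. (The condition depends neither on the affine chart nor on the local
defining function `r`.) -/
def IsLeviFlat {n : ℕ} (X : Set (CProj n)) : Prop :=
  ∀ (j : Fin (n + 1)) (w : CSpace n) (r : CSpace n → ℝ),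
    IsDefiningFunctionNear (affineChart j ⁻¹' X) w r →
      IsPseudoconvexAt r w ∧ IsPseudoconvexAt (fun x => -r x) w

end LeviFlat

end

/-!
Why the dimension of the singular set of an algebraic Levi-flat hypervariety `H = σ(V)` of `ℙⁿ`
lies between `2n - 4` and `2n - 2`. Polynomials in `z` and `z̄` are treated as polynomials
`g(z, ζ)` in independent variables (`CPoly`), evaluated by `ev g z ζ`; a real polynomial equation
is `ev g z z̄ = 0`.

*Upper bound.* If `M ⊆ H` is a submanifold of dimension `2n - 1`, then at some point of `M`, in an
affine chart, `H` is the zero set of one irreducible real polynomial `g` with nonvanishing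
differential (`exists_irreducible_defining_polynomial`). The reason is elimination: an irreducible
polynomial that vanishes on a real hypersurface divides all others that do
(`dvd_of_vanish_on_hypersurface`). Hence `M` contains smooth points of `H` and is not contained in
the singular set (`realDim_singularSet_le`).

*Lower bound: leaves.* Levi-flatness says that the bordered `3 × 3` minors of the complex Hessian
of `g` vanish on `{g = 0}`, so `g` divides them (`IsLeviFlat.dvd_leviMinor`). Consequently, for
paths `z(s)` in the Segre variety `{g(·, q̄) = 0}` and `ζ(t)` in `{g(q, ·) = 0}`, the function
`g(z(s), ζ(t))` solves a homogeneous linear hyperbolic equation with zero data on the axes, and it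
vanishes (`eq_zero_of_goursat`, `eventually_ev_eq_zero_of_segre`). Taking `ζ = z̄`, one sees that
`H` contains the germ at `q` of the Segre variety of `q`, which is algebraic. Moving `z` and `ζ`
separately, this propagates to the irreducible component `{F = 0}` of the homogenized Segre
variety: the whole complex cone `{F = 0}` is contained in `V` (`exists_leaf`). Different points
`q` give components `{F₀ = 0}` and `{F₁ = 0}` with `F₁ ∤ F₀` (`exists_two_leaves`).

*Lower bound: intersections.* For `n ≥ 2` two such cones have a common nonzero point, by Krull's
height theorem (`exists_ne_zero_common_zero`), and the common zeros contain a complex submanifold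
of codimension at most two, by Noether normalization and the Jacobian criterion
(`exists_containsSubmanifold_of_common_zero`). All these points are singular
(`mem_singularSet_of_common_zero`). Otherwise both cones would lie, near such a point `p`, in a
smooth real hypersurface `{r = 0}`. On complex lines parallel to a suitable axis, `r` is close to
the real part of a linear function `κw + const`, so that any two zeros `α, β` of `r` on one line
satisfy `Re (κ(α - β))² ≤ 0`, with equality only for `α = β`. The sum of `(κ(α - β))²` over the
zeros `α` of `F₀` and `β` of `F₁` near `p` is a holomorphic function of the line, its real part is
at most `0`, and it vanishes for the line through `p`. By the maximum principle the real part is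
identically `0`, so the zeros of `F₀` and `F₁` coincide (`exists_axis_common_zeros`), and `F₁`
divides `F₀`, a contradiction.
-/

open scoped ContDiff

noncomputable section

namespace LeviFlat

/-! ### Elimination -/

open Polynomial in
/-- If the polynomial `F` over a factorial domain is irreducible and does not divide `G`, then some
nonzero constant is a combination of `F` and `G`, unless `F` is itself a constant. -/
theorem exists_combination_eq_C_of_irreducible {A : Type*} [CommRing A] [IsDomain A]
    [UniqueFactorizationMonoid A] {F G : A[X]} (hF : Irreducible F) (hG : ¬ F ∣ G) :
    ∃ (p q : A[X]) (c : A), c ≠ 0 ∧ F * p + G * q = C c := by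
  by_cases hdeg : F.natDegree = 0
  · obtain ⟨a, ha⟩ := natDegree_eq_zero.1 hdeg
    refine ⟨1, 0, a, ?_, by simp [ha]⟩
    rintro rfl
    exact hF.ne_zero (by simpa using ha.symm)
  have hprim : F.IsPrimitive := hF.isPrimitive hdeg
  let K := FractionRing A
  let _ : NormalizedGCDMonoid A := Classical.choice inferInstance
  have hK : Irreducible (F.map (algebraMap A K)) :=
    (hprim.irreducible_iff_irreducible_map_fraction_map (K := K)).1 hF
  have hcop : IsCoprime (F.map (algebraMap A K)) (G.map (algebraMap A K)) := by
    rcases hK.isCoprime_or_dvd (G.map (algebraMap A K)) with h | h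
    · exact h
    · exact absurd (hprim.dvd_of_fraction_map_dvd_fraction_map h) hG
  obtain ⟨p, q, -, -, hpq⟩ := exists_mul_add_mul_eq_C_resultant F G le_rfl le_rfl (Or.inl hdeg)
  refine ⟨p, q, _, ?_, hpq⟩
  intro h0
  have h1 : resultant (F.map (algebraMap A K)) (G.map (algebraMap A K)) = 0 := by
    have hinj := IsFractionRing.injective A K
    rw [natDegree_map_eq_of_injective hinj, natDegree_map_eq_of_injective hinj,
      resultant_map_map, h0, map_zero]
  exact (resultant_eq_zero_iff.1 h1).2 hcop

open MvPolynomial in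
theorem dvd_of_common_zeros_option {S K : Type*} [Field K]
    {F G : MvPolynomial (Option S) K} (hF : Irreducible F) (s : S → Set K)
    (hs : ∀ j, (s j).Infinite)
    (h : ∀ x ∈ Set.pi Set.univ s, ∃ c, eval (fun o => Option.elim o c x) F = 0 ∧
      eval (fun o => Option.elim o c x) G = 0) : F ∣ G := by
  by_contra hG
  let e := optionEquivLeft K S
  obtain ⟨p, q, c, hc, hpq⟩ := exists_combination_eq_C_of_irreducible
    ((MulEquiv.irreducible_iff e.toMulEquiv).2 hF)
    (G := e G) (fun hd => hG ((map_dvd_iff e).1 hd))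
  apply hc
  refine funext_set s hs fun x hx => ?_
  obtain ⟨t, hF0, hG0⟩ := h x hx
  rw [optionEquivLeft_elim_eval] at hF0 hG0
  have h1 := congrArg (fun P => Polynomial.eval t (Polynomial.map (eval x) P)) hpq
  have h2 : Polynomial.eval t (Polynomial.map (eval x) (e.toMulEquiv F)) = 0 := hF0
  have h3 : Polynomial.eval t (Polynomial.map (eval x) (e G)) = 0 := hG0
  simp only [Polynomial.map_add, Polynomial.map_mul, Polynomial.eval_add, Polynomial.eval_mul, h2,
    h3, Polynomial.map_C, Polynomial.eval_C, zero_mul, add_zero] at h1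
  rw [map_zero, ← h1]

open MvPolynomial in
/-- An irreducible polynomial `F` divides `G` as soon as the common zeros of `F` and `G` project
onto a box with infinite sides when one coordinate is forgotten. -/
theorem dvd_of_common_zeros {σ K : Type*} [DecidableEq σ] [Field K]
    {F G : MvPolynomial σ K} (hF : Irreducible F) (i : σ) (s : σ → Set K)
    (hs : ∀ j, (s j).Infinite)
    (h : ∀ x ∈ Set.pi Set.univ s, ∃ c, eval (Function.update x i c) F = 0 ∧
      eval (Function.update x i c) G = 0) : F ∣ G := by
  let e := renameEquiv K (Equiv.optionSubtypeNe i).symm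
  rw [← map_dvd_iff e]
  have key : ∀ (x : {j // j ≠ i} → K) (y : σ → K) (c : K) (P : MvPolynomial σ K),
      (∀ j : {j // j ≠ i}, y j = x j) →
      eval (fun o => Option.elim o c x) (e P) = eval (Function.update y i c) P := by
    intro x y c P hy
    simp only [e, renameEquiv_apply, eval_rename]
    congr 2
    funext j
    by_cases hj : j = i
    · subst hj; simp
    · simp [hj, hy ⟨j, hj⟩]
  refine dvd_of_common_zeros_option ((MulEquiv.irreducible_iff e.toMulEquiv).2 hF)
    (fun j => s j) (fun j => hs j) fun x hx => ?_
  obtain ⟨a, ha⟩ := (hs i).nonempty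
  let y : σ → K := fun j => if hj : j = i then a else x ⟨j, hj⟩
  have hy : ∀ j : {j // j ≠ i}, y j = x j := fun j => by simp [y, j.2]
  obtain ⟨c, h1, h2⟩ := h y (fun j _ => by
    by_cases hj : j = i
    · subst hj; simpa [y] using ha
    · simpa [y, hj] using hx ⟨j, hj⟩ trivial)
  exact ⟨c, by rw [← h1]; exact key x y c F hy, by rw [key x y c G hy, h2]⟩

/-! ### Common zeros near a point -/

open Filter Topology in
/-- Near a point where the `i`-th partial derivative of `f` does not vanish, the zero set of `f`
projects onto an open set when the `i`-th coordinate is forgotten. -/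
theorem eventually_exists_update_mem_zero {σ 𝕜 : Type*} [Fintype σ] [DecidableEq σ] [RCLike 𝕜]
    {f : (σ → 𝕜) → 𝕜} {f' : (σ → 𝕜) →L[𝕜] 𝕜} {q : σ → 𝕜} (hf : HasStrictFDerivAt f f' q)
    (h0 : f q = 0) {i : σ} (hi : f' (Pi.single i 1) ≠ 0) {U : Set (σ → 𝕜)} (hU : U ∈ 𝓝 q) :
    ∀ᶠ x in 𝓝 q, ∃ c, Function.update x i c ∈ U ∧ f (Function.update x i c) = 0 := by
  let Φ : (σ → 𝕜) → (σ → 𝕜) := fun x => x + (f x - x i) • (Pi.single i 1 : σ → 𝕜)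
  let Φ' : (σ → 𝕜) →L[𝕜] (σ → 𝕜) := ContinuousLinearMap.id 𝕜 _ +
    (f' - ContinuousLinearMap.proj i).smulRight (Pi.single i 1 : σ → 𝕜)
  have hΦ : HasStrictFDerivAt Φ Φ' q := by
    refine (hasStrictFDerivAt_id q).add (HasStrictFDerivAt.smul_const ?_ _)
    exact hf.sub (ContinuousLinearMap.proj (R := 𝕜) (φ := fun _ : σ => 𝕜) i).hasStrictFDerivAt
  have hsurj : Φ'.range = ⊤ := by
    rw [LinearMap.range_eq_top]
    intro u
    refine ⟨u + ((u i - f' u) / f' (Pi.single i 1)) • (Pi.single i 1 : σ → 𝕜), ?_⟩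
    ext j
    by_cases hj : j = i
    · subst hj
      simp [Φ', map_add, map_smul]
      field_simp
      ring
    · simp [Φ', hj]
  have hmap := hΦ.map_nhds_eq_of_surj hsurj
  have hval : ∀ x, Φ x = Function.update x i (f x) := by
    intro x
    ext j
    by_cases hj : j = i
    · subst hj; simp [Φ]
    · simp [Φ, hj]
  have himg : Φ '' U ∈ 𝓝 (Function.update q i (0 : 𝕜)) := by
    rw [← h0, ← hval, ← hmap]
    exact image_mem_map hU
  have hcont : Continuous fun x : σ → 𝕜 => Function.update x i (0 : 𝕜) :=
    continuous_id.update i continuous_const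
  filter_upwards [hcont.continuousAt.preimage_mem_nhds himg] with x hx
  obtain ⟨y, hyU, hy⟩ := hx
  rw [hval] at hy
  have hfy : f y = 0 := by simpa using congrFun hy i
  have hyx : Function.update x i (y i) = y := by
    ext j
    by_cases hj : j = i
    · subst hj; simp
    · simpa [hj] using (congrFun hy j).symm
  exact ⟨y i, by rwa [hyx], by rwa [hyx]⟩

open Filter Topology MvPolynomial in
theorem dvd_of_eventually_common_zeros {σ : Type*} [Fintype σ] [DecidableEq σ]
    {F G : MvPolynomial σ ℂ} (hF : Irreducible F) (i : σ) (q : σ → ℂ)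
    (h : ∀ᶠ x in 𝓝 q, ∃ c, eval (Function.update x i c) F = 0 ∧
      eval (Function.update x i c) G = 0) : F ∣ G := by
  obtain ⟨ε, hε, hb⟩ := Metric.eventually_nhds_iff_ball.1 h
  refine dvd_of_common_zeros hF i (fun j => Metric.ball (q j) ε)
    (fun j => infinite_of_mem_nhds (q j) (Metric.ball_mem_nhds _ hε)) fun x hx => hb x ?_
  rw [ball_pi _ hε]
  exact hx

open Filter Topology MvPolynomial in
theorem dvd_of_eventually_common_real_zeros {σ : Type*} [Fintype σ] [DecidableEq σ]
    {F G : MvPolynomial σ ℂ} (hF : Irreducible F) (i : σ) (q : σ → ℝ)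
    (h : ∀ᶠ x : σ → ℝ in 𝓝 q, ∃ c : ℝ,
      eval (fun j => ((Function.update x i c : σ → ℝ) j : ℂ)) F = 0 ∧
      eval (fun j => ((Function.update x i c : σ → ℝ) j : ℂ)) G = 0) : F ∣ G := by
  obtain ⟨ε, hε, hb⟩ := Metric.eventually_nhds_iff_ball.1 h
  refine dvd_of_common_zeros hF i (fun j => (fun t : ℝ => (t : ℂ)) '' Metric.ball (q j) ε)
    (fun j => (infinite_of_mem_nhds (q j) (Metric.ball_mem_nhds _ hε)).image
      Complex.ofReal_injective.injOn) fun x hx => ?_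
  choose y hy hyx using fun j => hx j trivial
  obtain ⟨c, hc⟩ := hb y (by rw [ball_pi _ hε]; exact fun j _ => hy j)
  have hup : Function.update x i (c : ℂ) = fun j => ((Function.update y i c : σ → ℝ) j : ℂ) := by
    funext j
    by_cases hj : j = i
    · subst hj; simp
    · simp [hj, ← hyx j]
  exact ⟨c, by rw [hup]; exact hc⟩

/-! ### Polynomials in `z` and `z̄` -/

/-- Polynomials in `2n` variables `(z, ζ)`. A polynomial function of `z` and `z̄` on `ℂⁿ` is the
restriction of such a polynomial to the totally real subspace `ζ = z̄`. -/
abbrev CPoly (n : ℕ) : Type := MvPolynomial (Fin n ⊕ Fin n) ℂ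

/-- The value of a polynomial at `(z, ζ)`. -/
def ev {n : ℕ} (Q : CPoly n) (z ζ : CSpace n) : ℂ := MvPolynomial.eval (Sum.elim z ζ) Q

section ev
variable {n : ℕ}

@[simp] theorem ev_zero (z ζ : CSpace n) : ev 0 z ζ = 0 := map_zero _
@[simp] theorem ev_one (z ζ : CSpace n) : ev 1 z ζ = 1 := map_one _
@[simp] theorem ev_add (P Q : CPoly n) (z ζ : CSpace n) : ev (P + Q) z ζ = ev P z ζ + ev Q z ζ :=
  map_add _ _ _
@[simp] theorem ev_sub (P Q : CPoly n) (z ζ : CSpace n) : ev (P - Q) z ζ = ev P z ζ - ev Q z ζ :=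
  map_sub _ _ _
@[simp] theorem ev_mul (P Q : CPoly n) (z ζ : CSpace n) : ev (P * Q) z ζ = ev P z ζ * ev Q z ζ :=
  map_mul _ _ _
@[simp] theorem ev_pow (P : CPoly n) (k : ℕ) (z ζ : CSpace n) : ev (P ^ k) z ζ = ev P z ζ ^ k :=
  map_pow _ _ _
@[simp] theorem ev_C (c : ℂ) (z ζ : CSpace n) : ev (MvPolynomial.C c) z ζ = c := by simp [ev]
@[simp] theorem ev_sum {ι : Type*} (s : Finset ι) (P : ι → CPoly n) (z ζ : CSpace n) :
    ev (∑ i ∈ s, P i) z ζ = ∑ i ∈ s, ev (P i) z ζ := map_sum _ _ _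

end ev

open MvPolynomial in
/-- The linear change of variables `z = x + iy`, `ζ = x - iy`. -/
def realCoords (n : ℕ) : CPoly n ≃ₐ[ℂ] MvPolynomial (Fin n ⊕ Fin n) ℂ :=
  AlgEquiv.ofAlgHom
    (aeval (Sum.elim (fun a => X (Sum.inl a) + C Complex.I * X (Sum.inr a))
      (fun a => X (Sum.inl a) - C Complex.I * X (Sum.inr a))))
    (aeval (Sum.elim (fun a => C (1 / 2) * (X (Sum.inl a) + X (Sum.inr a)))
      (fun a => C (1 / (2 * Complex.I)) * (X (Sum.inl a) - X (Sum.inr a)))))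
    (by
      have h2 : (C (1 / 2) : MvPolynomial (Fin n ⊕ Fin n) ℂ) * 2 = 1 := by
        rw [← map_ofNat C 2, ← C_mul]; simp
      have hI : (C (1 / (2 * Complex.I)) : MvPolynomial (Fin n ⊕ Fin n) ℂ) * C Complex.I * 2 = 1 := by
        rw [← map_ofNat C 2, ← C_mul, ← C_mul]
        rw [show (1 / (2 * Complex.I) * Complex.I * 2 : ℂ) = 1 by field_simp, C_1]
      ext (a | a)
      · simp only [AlgHom.comp_apply, aeval_X, Sum.elim_inl, Sum.elim_inr, map_mul, map_add,
          AlgHom.commutes, ← algebraMap_eq, AlgHom.id_apply]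
        simp only [algebraMap_eq]
        congr 1
        linear_combination (X (Sum.inl a)) * h2
      · simp only [AlgHom.comp_apply, aeval_X, Sum.elim_inl, Sum.elim_inr, map_mul, map_sub,
          AlgHom.commutes, ← algebraMap_eq, AlgHom.id_apply]
        simp only [algebraMap_eq]
        congr 1
        linear_combination (X (Sum.inr a)) * hI)
    (by
      have h2 : (C (1 / 2) : MvPolynomial (Fin n ⊕ Fin n) ℂ) * 2 = 1 := by
        rw [← map_ofNat C 2, ← C_mul]; simp
      have hI : C Complex.I * (C (1 / (2 * Complex.I)) : MvPolynomial (Fin n ⊕ Fin n) ℂ)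
          = C (1 / 2) := by
        rw [← C_mul]
        rw [show (Complex.I * (1 / (2 * Complex.I)) : ℂ) = 1 / 2 by field_simp]
      ext (a | a)
      · simp only [AlgHom.comp_apply, aeval_X, Sum.elim_inl, Sum.elim_inr, map_mul, map_add,
          AlgHom.commutes, ← algebraMap_eq, AlgHom.id_apply]
        simp only [algebraMap_eq]
        congr 1
        linear_combination (X (Sum.inl a)) * h2 + (X (Sum.inl a) - X (Sum.inr a)) * hI
      · simp only [AlgHom.comp_apply, aeval_X, Sum.elim_inl, Sum.elim_inr, map_mul, map_sub,
          AlgHom.commutes, ← algebraMap_eq, AlgHom.id_apply]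
        simp only [algebraMap_eq]
        congr 1
        linear_combination (X (Sum.inr a)) * h2 - (X (Sum.inl a) - X (Sum.inr a)) * hI)

open MvPolynomial in
theorem eval_aeval_mvPolynomial {σ τ : Type*} (f : σ → MvPolynomial τ ℂ) (x : τ → ℂ)
    (Q : MvPolynomial σ ℂ) : eval x (aeval f Q) = eval (fun j => eval x (f j)) Q := by
  induction Q using MvPolynomial.induction_on with
  | C a => simp
  | add p q hp hq => simp only [map_add, hp, hq]
  | mul_X p i hp => simp only [map_mul, hp, aeval_X, eval_X]

open MvPolynomial in
theorem eval_realCoords {n : ℕ} (Q : CPoly n) (x : Fin n ⊕ Fin n → ℂ) :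
    eval x (realCoords n Q) = ev Q (fun a => x (Sum.inl a) + Complex.I * x (Sum.inr a))
      (fun a => x (Sum.inl a) - Complex.I * x (Sum.inr a)) := by
  rw [ev]
  refine (eval_aeval_mvPolynomial _ x Q).trans ?_
  congr 2
  funext j
  rcases j with a | a <;> simp

/-- The point of `ℂⁿ` with real parts `x ∘ inl` and imaginary parts `x ∘ inr`, as an `ℝ`-linear
map. -/
def ofRealCoords (n : ℕ) : (Fin n ⊕ Fin n → ℝ) →L[ℝ] CSpace n :=
  LinearMap.toContinuousLinearMap
    { toFun := fun x a => (x (Sum.inl a) : ℂ) + Complex.I * x (Sum.inr a)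
      map_add' := fun x y => by ext a; simp; ring
      map_smul' := fun c x => by ext a; simp; ring }

theorem ofRealCoords_apply {n : ℕ} (x : Fin n ⊕ Fin n → ℝ) (a : Fin n) :
    ofRealCoords n x a = (x (Sum.inl a) : ℂ) + Complex.I * x (Sum.inr a) := rfl

theorem ofRealCoords_re_im {n : ℕ} (w : CSpace n) :
    ofRealCoords n (Sum.elim (fun a => (w a).re) (fun a => (w a).im)) = w := by
  ext a
  rw [ofRealCoords_apply, mul_comm]
  exact Complex.re_add_im (w a)

open MvPolynomial in
theorem eval_realCoords_ofReal {n : ℕ} (Q : CPoly n) (x : Fin n ⊕ Fin n → ℝ) :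
    eval (fun j => (x j : ℂ)) (realCoords n Q) =
      ev Q (ofRealCoords n x) (star (ofRealCoords n x)) := by
  rw [eval_realCoords]
  congr 1
  ext a
  simp [ofRealCoords_apply, sub_eq_add_neg]

theorem exists_realCoords_ne_zero {n : ℕ} {f' : CSpace n →L[ℝ] ℝ} (hf' : f' ≠ 0) :
    ∃ i, f' (ofRealCoords n (Pi.single i 1)) ≠ 0 := by
  by_contra! h
  apply hf'
  have h1 : (f'.comp (ofRealCoords n) : (Fin n ⊕ Fin n → ℝ) →L[ℝ] ℝ).toLinearMap = 0 := by
    refine LinearMap.pi_ext' fun i => LinearMap.ext_ring ?_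
    simpa using h i
  ext w
  have := congrArg (fun φ => φ (Sum.elim (fun a => (w a).re) (fun a => (w a).im))) h1
  simpa [ofRealCoords_re_im] using this

open Filter Topology in
/-- Let `R` be irreducible. If `R` and `G` vanish at the points `(w, w̄)` for all `w` near `q` in the
smooth real hypersurface `{f = 0}`, then `R` divides `G`. -/
theorem dvd_of_vanish_on_hypersurface {n : ℕ} {R G : CPoly n} (hR : Irreducible R)
    {f : CSpace n → ℝ} {f' : CSpace n →L[ℝ] ℝ} {q : CSpace n} (hf : HasStrictFDerivAt f f' q)
    (hf' : f' ≠ 0) (hfq : f q = 0)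
    (h : ∀ᶠ w in 𝓝 q, f w = 0 → ev R w (star w) = 0 ∧ ev G w (star w) = 0) : R ∣ G := by
  obtain ⟨i, hi⟩ := exists_realCoords_ne_zero hf'
  set x₀ : Fin n ⊕ Fin n → ℝ := Sum.elim (fun a => (q a).re) (fun a => (q a).im) with hx₀
  have hq : ofRealCoords n x₀ = q := ofRealCoords_re_im q
  have hcomp : HasStrictFDerivAt (fun x => f (ofRealCoords n x)) (f'.comp (ofRealCoords n)) x₀ := by
    rw [← hq] at hf
    exact hf.comp x₀ (ofRealCoords n).hasStrictFDerivAt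
  rw [← hq] at h
  have h2 := eventually_exists_update_mem_zero hcomp (by rw [hq, hfq]) (i := i) hi
    ((ofRealCoords n).continuous.continuousAt.preimage_mem_nhds h)
  rw [← map_dvd_iff (realCoords n)]
  refine dvd_of_eventually_common_real_zeros
    ((MulEquiv.irreducible_iff (realCoords n).toMulEquiv).2 hR) i x₀ ?_
  filter_upwards [h2] with x hx
  obtain ⟨c, hc, hc0⟩ := hx
  refine ⟨c, ?_⟩
  have := hc hc0
  rw [← eval_realCoords_ofReal, ← eval_realCoords_ofReal] at this
  exact this

/-- A polynomial in `(z, ζ)` that vanishes whenever `ζ = z̄` is zero. -/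
theorem eq_zero_of_ev_star_eq_zero {n : ℕ} {Q : CPoly n} (h : ∀ w, ev Q w (star w) = 0) : Q = 0 := by
  rw [← map_eq_zero_iff (realCoords n) (realCoords n).injective]
  refine MvPolynomial.funext_set (fun _ => Set.range fun t : ℝ => (t : ℂ))
    (fun _ => Set.infinite_range_of_injective Complex.ofReal_injective) fun x hx => ?_
  choose y hy using fun j => hx j trivial
  have hxy : x = fun j => (y j : ℂ) := funext fun j => (hy j).symm
  rw [hxy, eval_realCoords_ofReal, h, map_zero]

/-! ### Derivatives of polynomials -/

open MvPolynomial in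
theorem exists_pderiv_ne_zero_not_dvd {σ : Type*} {g : MvPolynomial σ ℂ} (hg : Irreducible g) :
    ∃ i, pderiv i g ≠ 0 ∧ ¬ g ∣ pderiv i g := by
  have hdeg : g.totalDegree ≠ 0 := by
    intro h
    rw [totalDegree_eq_zero_iff_eq_C] at h
    have hc : coeff 0 g ≠ 0 := fun h0 => hg.ne_zero (by rw [h, h0, C_0])
    exact hg.not_isUnit (by rw [h]; exact (isUnit_iff_ne_zero.2 hc).map C)
  obtain ⟨m, hm, i, hi⟩ : ∃ m ∈ g.support, ∃ i, m i ≠ 0 := by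
    by_contra! h
    apply hdeg
    rw [totalDegree_eq_zero_iff]
    exact fun m hm x => h m hm x
  have hne : pderiv i g ≠ 0 := by
    intro h0
    have h1 := coeff_pderiv (i := i) g (m - Finsupp.single i 1)
    rw [h0, coeff_zero] at h1
    have h2 : m - Finsupp.single i 1 + Finsupp.single i 1 = m :=
      tsub_add_cancel_of_le (Finsupp.single_le_iff.2 (Nat.one_le_iff_ne_zero.2 hi))
    rw [h2] at h1
    rcases mul_eq_zero.1 h1.symm with h3 | h3
    · exact mem_support_iff.1 hm h3
    · exact Nat.cast_add_one_ne_zero _ h3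
  refine ⟨i, hne, fun hd => ?_⟩
  have h1 := totalDegree_le_of_dvd_of_isDomain hd hne
  have h2 : (pderiv i g).totalDegree < g.totalDegree := by
    rw [totalDegree, Finset.sup_lt_iff (Nat.pos_of_ne_zero hdeg)]
    intro k hk
    have hk' : k + Finsupp.single i 1 ∈ g.support := by
      rw [mem_support_iff] at hk ⊢
      intro h0
      exact hk (by rw [coeff_pderiv, h0, zero_mul])
    have := le_totalDegree hk'
    rw [Finsupp.sum_add_index' (by simp) (by simp)] at this
    simp at this
    omega
  omega

open MvPolynomial in
/-- The differential of a polynomial function. -/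
def dPoly {σ : Type*} [Fintype σ] (Q : MvPolynomial σ ℂ) (x : σ → ℂ) : (σ → ℂ) →L[ℂ] ℂ :=
  ∑ i, eval x (pderiv i Q) • ContinuousLinearMap.proj (R := ℂ) (φ := fun _ : σ => ℂ) i

open MvPolynomial in
theorem dPoly_apply {σ : Type*} [Fintype σ] (Q : MvPolynomial σ ℂ) (x v : σ → ℂ) :
    dPoly Q x v = ∑ i, eval x (pderiv i Q) * v i := by
  simp [dPoly]

open MvPolynomial in
theorem hasStrictFDerivAt_eval {σ : Type*} [Fintype σ] (Q : MvPolynomial σ ℂ) (x : σ → ℂ) :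
    HasStrictFDerivAt (fun y => eval y Q) (dPoly Q x) x := by
  classical
  induction Q using MvPolynomial.induction_on with
  | C a =>
    have : dPoly (C a) x = 0 := by ext v; simp [dPoly_apply]
    rw [this]
    simpa using hasStrictFDerivAt_const a x
  | add p q hp hq =>
    have : dPoly (p + q) x = dPoly p x + dPoly q x := by
      ext v; simp [dPoly_apply, add_mul, Finset.sum_add_distrib]
    rw [this]
    simp only [map_add]
    exact hp.add hq
  | mul_X p i hp =>
    have : dPoly (p * X i) x = eval x p • ContinuousLinearMap.proj (R := ℂ) (φ := fun _ : σ => ℂ) i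
        + x i • dPoly p x := by
      ext v
      simp [dPoly_apply, pderiv_X, Pi.single_apply, add_mul, Finset.sum_add_distrib,
        Finset.mul_sum, apply_ite, mul_assoc, add_comm]
    rw [this]
    simp only [map_mul, eval_X]
    exact hp.mul
      (ContinuousLinearMap.proj (R := ℂ) (φ := fun _ : σ => ℂ) i).hasStrictFDerivAt

open MvPolynomial in
theorem contDiff_eval {σ : Type*} [Fintype σ] (Q : MvPolynomial σ ℂ) {m : WithTop ℕ∞} :
    ContDiff ℂ m (fun y : σ → ℂ => eval y Q) := by
  induction Q using MvPolynomial.induction_on with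
  | C a => simpa using contDiff_const
  | add p q hp hq => simpa using hp.add hq
  | mul_X p i hp => simpa using hp.mul (contDiff_apply ℂ ℂ i)

/-! ### Real polynomials -/

open MvPolynomial in
/-- The polynomial whose value at `(w, w̄)` is the complex conjugate of that of the given one:
the coefficients are conjugated, and `z` and `ζ` change places. -/
def conjPoly {n : ℕ} : CPoly n →+* CPoly n :=
  (rename Sum.swap).toRingHom.comp (map (starRingEnd ℂ))

open MvPolynomial in
theorem ev_conjPoly {n : ℕ} (Q : CPoly n) (z ζ : CSpace n) :
    ev (conjPoly Q) z ζ = star (ev Q (star ζ) (star z)) := by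
  have h : conjPoly Q = rename Sum.swap (map (starRingEnd ℂ) Q) := rfl
  have h2 : (Sum.elim z ζ ∘ Sum.swap : Fin n ⊕ Fin n → ℂ) =
      fun j => (starRingEnd ℂ) (Sum.elim (star ζ) (star z) j) := by
    funext j
    rcases j with a | a <;> simp
  rw [h, ev, eval_rename, h2, eval_map, ev]
  clear h
  generalize Sum.elim (star ζ) (star z) = x
  induction Q using MvPolynomial.induction_on with
  | C a => simp
  | add p q hp hq => simp only [eval₂_add, hp, hq, map_add, star_add]
  | mul_X p i hp => simp only [eval₂_mul, hp, eval₂_X, map_mul, eval_X, star_mul']; rfl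

theorem conjPoly_conjPoly {n : ℕ} (Q : CPoly n) : conjPoly (conjPoly Q) = Q := by
  rw [← sub_eq_zero]
  exact eq_zero_of_ev_star_eq_zero fun w => by simp [ev_conjPoly]

open MvPolynomial in
theorem pderiv_conjPoly {n : ℕ} (Q : CPoly n) (i : Fin n ⊕ Fin n) :
    pderiv i.swap (conjPoly Q) = conjPoly (pderiv i Q) := by
  have h (P : CPoly n) : conjPoly P = rename Sum.swap (map (starRingEnd ℂ) P) := rfl
  rw [h, h, pderiv_rename Sum.swap_leftInverse.injective, pderiv_map]

/-- A polynomial in `z` and `z̄` is real if it equals its conjugate, that is, if its values are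
real. -/
def IsRealPoly {n : ℕ} (Q : CPoly n) : Prop := conjPoly Q = Q

theorem IsRealPoly.star_ev {n : ℕ} {Q : CPoly n} (hQ : IsRealPoly Q) (z ζ : CSpace n) :
    star (ev Q z ζ) = ev Q (star ζ) (star z) := by
  conv_rhs => rw [← hQ, ev_conjPoly, star_star, star_star]

open MvPolynomial in
theorem IsRealPoly.star_ev_pderiv {n : ℕ} {Q : CPoly n} (hQ : IsRealPoly Q) (z ζ : CSpace n)
    (i : Fin n ⊕ Fin n) :
    star (ev (pderiv i Q) z ζ) = ev (pderiv i.swap Q) (star ζ) (star z) := by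
  conv_rhs => rw [← hQ, pderiv_conjPoly, ev_conjPoly, star_star, star_star]

/-! ### Real-algebraic sets containing a hypersurface -/

/-- The zero set of `f` in `U` is a (possibly empty) smooth hypersurface. -/
def IsRegularOn {n : ℕ} (f : CSpace n → ℝ) (U : Set (CSpace n)) : Prop :=
  ∀ w ∈ U, f w = 0 → HasStrictFDerivAt f (fderiv ℝ f w) w ∧ fderiv ℝ f w ≠ 0

theorem continuous_ev_star {n : ℕ} (Q : CPoly n) : Continuous fun w => ev Q w (star w) := by
  refine (contDiff_eval Q (m := 0)).continuous.comp ?_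
  refine continuous_pi fun j => ?_
  rcases j with a | a
  · exact continuous_apply a
  · exact (continuous_apply a).star

/-- After shrinking `U`, a polynomial that vanishes on the zero set of `f` in `U` can be replaced by
one of its irreducible factors. -/
theorem exists_irreducible_factor_vanishing {n : ℕ} {f : CSpace n → ℝ} (P : CPoly n) (hP : P ≠ 0)
    {U : Set (CSpace n)} (hU : IsOpen U) (hne : ∃ q ∈ U, f q = 0)
    (hv : ∀ w ∈ U, f w = 0 → ev P w (star w) = 0) :
    ∃ g, Irreducible g ∧ g ∣ P ∧ ∃ U' ⊆ U, IsOpen U' ∧ (∃ q ∈ U', f q = 0) ∧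
      ∀ w ∈ U', f w = 0 → ev g w (star w) = 0 := by
  induction P using WfDvdMonoid.induction_on_irreducible generalizing U with
  | zero => exact absurd rfl hP
  | unit u hu =>
    obtain ⟨q, hq, hfq⟩ := hne
    have h := hv q hq hfq
    have h2 : IsUnit (ev u q (star q)) := hu.map (MvPolynomial.eval (Sum.elim q (star q)))
    rw [h] at h2
    exact absurd h2 not_isUnit_zero
  | mul a i ha hi ih =>
    by_cases hall : ∀ w ∈ U, f w = 0 → ev i w (star w) = 0
    · exact ⟨i, hi, dvd_mul_right _ _, U, subset_rfl, hU, hne, hall⟩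
    · push Not at hall
      obtain ⟨q, hqU, hfq, hq⟩ := hall
      obtain ⟨g, hg, hga, U', hU', ho, hne', hv'⟩ := ih ha
        (U := U ∩ {w | ev i w (star w) ≠ 0})
        (hU.inter (isOpen_ne_fun (continuous_ev_star i) continuous_const)) ⟨q, ⟨hqU, hq⟩, hfq⟩
        (fun w hw hfw => by
          have := hv w hw.1 hfw
          rw [ev_mul] at this
          exact (mul_eq_zero.1 this).resolve_left hw.2)
      exact ⟨g, hg, hga.trans (dvd_mul_left _ _), U', hU'.trans Set.inter_subset_left, ho, hne', hv'⟩

/-- An irreducible polynomial vanishing on a smooth real hypersurface generates the ideal of all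
polynomials that vanish on it. -/
theorem IsRegularOn.dvd {n : ℕ} {f : CSpace n → ℝ} {U : Set (CSpace n)} (hf : IsRegularOn f U)
    (hU : IsOpen U) (hne : ∃ q ∈ U, f q = 0) {g G : CPoly n} (hg : Irreducible g)
    (hgv : ∀ w ∈ U, f w = 0 → ev g w (star w) = 0)
    (hGv : ∀ w ∈ U, f w = 0 → ev G w (star w) = 0) : g ∣ G := by
  obtain ⟨q, hq, hfq⟩ := hne
  refine dvd_of_vanish_on_hypersurface hg (hf q hq hfq).1 (hf q hq hfq).2 hfq ?_
  filter_upwards [hU.mem_nhds hq] with w hw hfw using ⟨hgv w hw hfw, hGv w hw hfw⟩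

open MvPolynomial in
/-- An irreducible polynomial vanishing on a real hypersurface is, up to a constant, real. -/
theorem IsRegularOn.exists_real_associated {n : ℕ} {f : CSpace n → ℝ} {U : Set (CSpace n)}
    (hf : IsRegularOn f U) (hU : IsOpen U) (hne : ∃ q ∈ U, f q = 0) {g : CPoly n}
    (hg : Irreducible g) (hgv : ∀ w ∈ U, f w = 0 → ev g w (star w) = 0) :
    ∃ g', Associated g g' ∧ IsRealPoly g' := by
  have hI : (C Complex.I : CPoly n) * C Complex.I = -1 := by rw [← C_mul, Complex.I_mul_I]; simp
  have hIu : IsUnit (C Complex.I : CPoly n) := (isUnit_iff_ne_zero.2 Complex.I_ne_zero).map C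
  have hd : ∀ w ∈ U, f w = 0 → ev (g + conjPoly g) w (star w) = 0 := fun w hw hfw => by
    simp [ev_conjPoly, hgv w hw hfw]
  obtain ⟨k, hk⟩ := hf.dvd hU hne hg hgv hd
  have hr : IsRealPoly (g + conjPoly g) := by
    rw [IsRealPoly, map_add, conjPoly_conjPoly, add_comm]
  by_cases h0 : g + conjPoly g = 0
  · refine ⟨g * C Complex.I, ⟨hIu.unit, rfl⟩, ?_⟩
    have h1 : conjPoly (C Complex.I : CPoly n) = - C Complex.I := by
      simp [conjPoly]
    rw [IsRealPoly, map_mul, h1, eq_neg_of_add_eq_zero_right h0]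
    ring
  · refine ⟨g + conjPoly g, ?_, hr⟩
    have hdeg : (g + conjPoly g).totalDegree ≤ g.totalDegree := by
      refine (totalDegree_add _ _).trans (max_le le_rfl ?_)
      refine (totalDegree_rename_le _ _).trans ?_
      exact Finset.sup_mono (support_map_subset _ _)
    have hk0 : k ≠ 0 := fun h => h0 (by rw [hk, h, mul_zero])
    have hkdeg : k.totalDegree = 0 := by
      rw [hk, totalDegree_mul_of_isDomain hg.ne_zero hk0] at hdeg
      omega
    rw [totalDegree_eq_zero_iff_eq_C] at hkdeg
    have hku : IsUnit k := by
      rw [hkdeg]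
      refine (isUnit_iff_ne_zero.2 fun h => hk0 ?_).map C
      rw [hkdeg, h, C_0]
    exact ⟨hku.unit, hk.symm⟩

open MvPolynomial Filter Topology in
/-- A real-algebraic set, not the whole space, that contains a smooth real hypersurface is at some
point of the latter itself a smooth real hypersurface, and has there an irreducible real polynomial
`g` with nonvanishing differential as a defining function. -/
theorem IsRegularOn.exists_good_point {n : ℕ} {f : CSpace n → ℝ} {U : Set (CSpace n)}
    (hf : IsRegularOn f U) (hU : IsOpen U) (hne : ∃ q ∈ U, f q = 0) (S : Set (CPoly n))
    {P₀ : CPoly n} (hP₀ : P₀ ∈ S) (hP₀' : P₀ ≠ 0)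
    (hv : ∀ P ∈ S, ∀ w ∈ U, f w = 0 → ev P w (star w) = 0) :
    ∃ g, Irreducible g ∧ IsRealPoly g ∧ (∀ P ∈ S, g ∣ P) ∧
      ∃ q ∈ U, f q = 0 ∧ ev g q (star q) = 0 ∧ (∃ a, ev (pderiv (Sum.inl a) g) q (star q) ≠ 0) ∧
        ∀ᶠ w in 𝓝 q, (∀ P ∈ S, ev P w (star w) = 0) ↔ ev g w (star w) = 0 := by
  obtain ⟨g₁, hg₁, hgP₁, U', hUU', hU', hne', hgv₁⟩ :=
    exists_irreducible_factor_vanishing P₀ hP₀' hU hne (hv P₀ hP₀)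
  have hf' : IsRegularOn f U' := fun w hw => hf w (hUU' hw)
  obtain ⟨g, hass, hreal⟩ := hf'.exists_real_associated hU' hne' hg₁ hgv₁
  have hg : Irreducible g := hass.irreducible hg₁
  have hgP : g ∣ P₀ := hass.symm.dvd.trans hgP₁
  have hgv : ∀ w ∈ U', f w = 0 → ev g w (star w) = 0 := by
    obtain ⟨u, hu⟩ := hass
    intro w hw hfw
    rw [← hu, ev_mul, hgv₁ w hw hfw, zero_mul]
  obtain ⟨k, h, hh, hP₀h⟩ := WfDvdMonoid.max_power_factor hP₀' hg
  obtain ⟨i, hi, hgi⟩ := exists_pderiv_ne_zero_not_dvd hg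
  have hprod : ¬ g ∣ h * pderiv i g := fun hd => (hg.prime.dvd_or_dvd hd).elim hh hgi
  obtain ⟨q, hqU, hfq, hq⟩ : ∃ q ∈ U', f q = 0 ∧ ev (h * pderiv i g) q (star q) ≠ 0 := by
    by_contra! hcon
    exact hprod (hf'.dvd hU' hne' hg hgv hcon)
  rw [ev_mul] at hq
  have hdvd : ∀ P ∈ S, g ∣ P := fun P hP =>
    hf'.dvd hU' hne' hg hgv fun w hw => hv P hP w (hUU' hw)
  refine ⟨g, hg, hreal, hdvd, q, hUU' hqU, hfq, hgv q hqU hfq, ?_, ?_⟩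
  · rcases i with a | a
    · exact ⟨a, right_ne_zero_of_mul hq⟩
    · refine ⟨a, fun h0 => right_ne_zero_of_mul hq ?_⟩
      have := hreal.star_ev_pderiv q (star q) (Sum.inl a)
      rw [h0, star_star] at this
      simpa using this.symm
  · filter_upwards [(continuous_ev_star h).continuousAt.eventually_ne (left_ne_zero_of_mul hq)]
      with w hw
    constructor
    · intro hall
      have := hall P₀ hP₀
      rw [hP₀h, ev_mul, ev_pow] at this
      by_contra hg0
      exact pow_ne_zero k hg0 ((mul_eq_zero.1 this).resolve_right hw)
    · intro h0 P hP
      obtain ⟨c, hc⟩ := hdvd P hP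
      rw [hc, ev_mul, h0, zero_mul]

/-! ### The Levi form of a real polynomial -/

/-- The embedding `w ↦ (w, w̄)` as an `ℝ`-linear map. -/
def pairConj (n : ℕ) : CSpace n →L[ℝ] (Fin n ⊕ Fin n → ℂ) :=
  LinearMap.toContinuousLinearMap
    { toFun := fun w => Sum.elim w (star w)
      map_add' := fun x y => by ext (a | a) <;> simp
      map_smul' := fun c x => by ext (a | a) <;> simp }

theorem pairConj_apply {n : ℕ} (w : CSpace n) : pairConj n w = Sum.elim w (star w) := rfl

theorem hasStrictFDerivAt_ev_re {n : ℕ} (Q : CPoly n) (w : CSpace n) :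
    HasStrictFDerivAt (fun x => (ev Q x (star x)).re)
      (Complex.reCLM.comp (((dPoly Q (pairConj n w)).restrictScalars ℝ).comp (pairConj n))) w := by
  have h1 := ((hasStrictFDerivAt_eval Q (pairConj n w)).restrictScalars ℝ).comp w
    (pairConj n).hasStrictFDerivAt
  exact Complex.reCLM.hasStrictFDerivAt.comp w h1

open MvPolynomial in
theorem fderiv_ev_re {n : ℕ} (Q : CPoly n) (w v : CSpace n) :
    fderiv ℝ (fun x => (ev Q x (star x)).re) w v =
      (∑ i, ev (pderiv i Q) w (star w) * pairConj n v i).re := by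
  rw [(hasStrictFDerivAt_ev_re Q w).hasFDerivAt.fderiv]
  simp only [ContinuousLinearMap.comp_apply, ContinuousLinearMap.coe_restrictScalars', dPoly_apply,
    Complex.reCLM_apply]
  rfl

theorem contDiff_ev_re {n : ℕ} (Q : CPoly n) {m : WithTop ℕ∞} :
    ContDiff ℝ m (fun x => (ev Q x (star x)).re) :=
  Complex.reCLM.contDiff.comp
    (((contDiff_eval Q (m := m)).restrict_scalars ℝ).comp (pairConj n).contDiff)

open MvPolynomial in
theorem fderiv_fderiv_ev_re {n : ℕ} (Q : CPoly n) (w v u : CSpace n) :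
    fderiv ℝ (fderiv ℝ (fun x => (ev Q x (star x)).re)) w v u =
      (∑ j, ∑ i, ev (pderiv j (pderiv i Q)) w (star w) * pairConj n v j * pairConj n u i).re := by
  set r : CSpace n → ℝ := fun x => (ev Q x (star x)).re with hr
  have hd : DifferentiableAt ℝ (fderiv ℝ r) w :=
    ((contDiff_ev_re Q (m := 2)).fderiv_right (m := 1) (by norm_num)).differentiable
      (by norm_num) w
  have h1 : HasFDerivAt (fun x => fderiv ℝ r x u)
      ((ContinuousLinearMap.apply ℝ ℝ u).comp (fderiv ℝ (fderiv ℝ r) w)) w :=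
    (ContinuousLinearMap.apply ℝ ℝ u).hasFDerivAt.comp w hd.hasFDerivAt
  let Qu : CPoly n := ∑ i, pderiv i Q * C (pairConj n u i)
  have h2 : (fun x => fderiv ℝ r x u) = fun x => (ev Qu x (star x)).re := by
    funext x
    rw [hr, fderiv_ev_re, ev_sum]
    simp only [ev_mul, ev_C]
  have h3 : fderiv ℝ (fun x => fderiv ℝ r x u) w v = fderiv ℝ (fderiv ℝ r) w v u := by
    rw [h1.fderiv]; rfl
  rw [← h3, h2, fderiv_ev_re]
  congr 1
  refine Finset.sum_congr rfl fun j _ => ?_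
  rw [map_sum, ev_sum, Finset.sum_mul]
  refine Finset.sum_congr rfl fun i _ => ?_
  rw [pderiv_mul, pderiv_C, mul_zero, add_zero, ev_mul, ev_C]
  ring

open MvPolynomial in
theorem pderiv_pderiv_comm {σ : Type*} (i j : σ) (Q : MvPolynomial σ ℂ) :
    pderiv i (pderiv j Q) = pderiv j (pderiv i Q) := by
  classical
  induction Q using MvPolynomial.induction_on with
  | C a => simp
  | add p q hp hq => simp only [map_add, hp, hq]
  | mul_X p k hp =>
    have h (a b : σ) : pderiv a (pderiv b (X k : MvPolynomial σ ℂ)) = 0 := by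
      by_cases h : k = b
      · subst h; simp
      · simp [pderiv_X_of_ne h]
    simp only [pderiv_mul, map_add, hp, h]
    ring

/-- The sesquilinear form `∑ (∂²Q / ∂z_a ∂z̄_b)(w) v_a ū_b`. -/
def mixedForm {n : ℕ} (Q : CPoly n) (w v u : CSpace n) : ℂ :=
  ∑ a, ∑ b, ev (MvPolynomial.pderiv (Sum.inl a) (MvPolynomial.pderiv (Sum.inr b) Q)) w (star w) *
    v a * star (u b)

open MvPolynomial in
theorem leviForm_ev_re {n : ℕ} (Q : CPoly n) (w v : CSpace n) :
    leviForm (fun x => (ev Q x (star x)).re) w v = (mixedForm Q w v v).re := by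
  rw [leviForm, fderiv_fderiv_ev_re, fderiv_fderiv_ev_re, ← Complex.add_re]
  have hmix : ∑ x, ∑ y, ev (pderiv (Sum.inr x) (pderiv (Sum.inl y) Q)) w (star w) *
      star (v x) * v y = mixedForm Q w v v := by
    rw [mixedForm, Finset.sum_comm]
    refine Finset.sum_congr rfl fun x _ => Finset.sum_congr rfl fun y _ => ?_
    rw [pderiv_pderiv_comm]
    ring
  have key : (∑ j, ∑ i, ev (pderiv j (pderiv i Q)) w (star w) * pairConj n v j * pairConj n v i) +
      (∑ j, ∑ i, ev (pderiv j (pderiv i Q)) w (star w) * pairConj n (Complex.I • v) j *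
        pairConj n (Complex.I • v) i) = 2 * mixedForm Q w v v +
        2 * ∑ x, ∑ y, ev (pderiv (Sum.inr x) (pderiv (Sum.inl y) Q)) w (star w) *
          star (v x) * v y := by
    simp only [Fintype.sum_sum_type, pairConj_apply, Sum.elim_inl, Sum.elim_inr, mixedForm,
      Finset.mul_sum, ← Finset.sum_add_distrib, Pi.star_apply, Pi.smul_apply, smul_eq_mul, star_mul']
    refine Finset.sum_congr rfl fun x _ => Finset.sum_congr rfl fun y _ => ?_
    have hI : star Complex.I = -Complex.I := Complex.conj_I
    rw [hI]
    linear_combination (ev (pderiv (Sum.inl x) (pderiv (Sum.inl y) Q)) w (star w) * v x * v y -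
      ev (pderiv (Sum.inl x) (pderiv (Sum.inr y) Q)) w (star w) * v x * star (v y) -
      ev (pderiv (Sum.inr x) (pderiv (Sum.inl y) Q)) w (star w) * star (v x) * v y +
      ev (pderiv (Sum.inr x) (pderiv (Sum.inr y) Q)) w (star w) * star (v x) * star (v y)) *
      Complex.I_mul_I
  rw [key, hmix, ← two_mul, ← mul_assoc]
  norm_num

open MvPolynomial in
/-- The differential of a real polynomial is twice the real part of its holomorphic part `∂g`. -/
theorem IsRealPoly.fderiv_ev_re {n : ℕ} {g : CPoly n} (hg : IsRealPoly g) (w v : CSpace n) :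
    fderiv ℝ (fun x => (ev g x (star x)).re) w v =
      2 * (∑ a, ev (pderiv (Sum.inl a) g) w (star w) * v a).re := by
  have hconj : ∑ a, ev (pderiv (Sum.inr a) g) w (star w) * pairConj n v (Sum.inr a) =
      star (∑ a, ev (pderiv (Sum.inl a) g) w (star w) * v a) := by
    rw [star_sum]
    refine Finset.sum_congr rfl fun a _ => ?_
    have := hg.star_ev_pderiv w (star w) (Sum.inl a)
    rw [star_star] at this
    rw [star_mul', this]
    rfl
  rw [LeviFlat.fderiv_ev_re, Fintype.sum_sum_type, Complex.add_re, hconj, Complex.star_def,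
    Complex.conj_re, two_mul]
  rfl

open MvPolynomial in
theorem IsRealPoly.star_mixedForm {n : ℕ} {g : CPoly n} (hg : IsRealPoly g) (w v u : CSpace n) :
    star (mixedForm g w v u) = mixedForm g w u v := by
  rw [mixedForm, mixedForm, star_sum]
  simp only [star_sum, star_mul', star_star]
  rw [Finset.sum_comm]
  refine Finset.sum_congr rfl fun a _ => Finset.sum_congr rfl fun b _ => ?_
  have h : star (ev (pderiv (Sum.inl b) (pderiv (Sum.inr a) g)) w (star w)) =
      ev (pderiv (Sum.inl a) (pderiv (Sum.inr b) g)) w (star w) := by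
    have h1 : conjPoly (pderiv (Sum.inl b) (pderiv (Sum.inr a) g)) =
        pderiv (Sum.inl a) (pderiv (Sum.inr b) g) := by
      rw [← pderiv_conjPoly, ← pderiv_conjPoly, hg, pderiv_pderiv_comm]
      rfl
    rw [← h1, ev_conjPoly, star_star]
  rw [h]
  ring

theorem mixedForm_add_self {n : ℕ} (g : CPoly n) (w v u : CSpace n) :
    mixedForm g w (v + u) (v + u) =
      mixedForm g w v v + mixedForm g w v u + mixedForm g w u v + mixedForm g w u u := by
  simp only [mixedForm, ← Finset.sum_add_distrib]
  refine Finset.sum_congr rfl fun a _ => Finset.sum_congr rfl fun b _ => ?_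
  simp only [Pi.add_apply, star_add]
  ring

theorem mixedForm_smul_left {n : ℕ} (g : CPoly n) (w v u : CSpace n) (c : ℂ) :
    mixedForm g w (c • v) u = c * mixedForm g w v u := by
  simp only [mixedForm, Finset.mul_sum]
  refine Finset.sum_congr rfl fun a _ => Finset.sum_congr rfl fun b _ => ?_
  simp only [Pi.smul_apply, smul_eq_mul]
  ring

open MvPolynomial in
/-- If `{g = 0}` is pseudoconvex from both sides at `w`, its Levi form vanishes on complex tangent
vectors, as a sesquilinear form. -/
theorem IsRealPoly.mixedForm_eq_zero {n : ℕ} {g : CPoly n} (hg : IsRealPoly g) {w : CSpace n}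
    (h1 : IsPseudoconvexAt (fun x => (ev g x (star x)).re) w)
    (h2 : IsPseudoconvexAt (fun x => -(ev g x (star x)).re) w) {v u : CSpace n}
    (hv : ∑ a, ev (pderiv (Sum.inl a) g) w (star w) * v a = 0)
    (hu : ∑ a, ev (pderiv (Sum.inl a) g) w (star w) * u a = 0) : mixedForm g w v u = 0 := by
  have hlin (c : ℂ) (v : CSpace n) : ∑ a, ev (pderiv (Sum.inl a) g) w (star w) * (c • v) a =
      c * ∑ a, ev (pderiv (Sum.inl a) g) w (star w) * v a := by
    rw [Finset.mul_sum]
    exact Finset.sum_congr rfl fun a _ => by simp only [Pi.smul_apply, smul_eq_mul]; ring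
  have htan : ∀ v : CSpace n, ∑ a, ev (pderiv (Sum.inl a) g) w (star w) * v a = 0 →
      IsComplexTangent (fun x => (ev g x (star x)).re) w v := by
    intro v hv
    refine ⟨?_, ?_⟩
    · rw [hg.fderiv_ev_re, hv]; simp
    · rw [hg.fderiv_ev_re, hlin, hv]; simp
  have hre : ∀ v : CSpace n, ∑ a, ev (pderiv (Sum.inl a) g) w (star w) * v a = 0 →
      (mixedForm g w v v).re = 0 := by
    intro v hv
    have hneg : (fun x => -(ev g x (star x)).re) = -(fun x => (ev g x (star x)).re) := rfl
    have hfn : fderiv ℝ (-(fun x => (ev g x (star x)).re)) =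
        -fderiv ℝ (fun x => (ev g x (star x)).re) := by
      funext x; exact fderiv_neg
    have ha := h1 v (htan v hv)
    have hb := h2 v (by
      rw [hneg, IsComplexTangent, hfn]
      have := htan v hv
      simpa [IsComplexTangent] using this)
    rw [hneg, leviForm, hfn, fderiv_neg] at hb
    rw [leviForm_ev_re] at ha
    have hc := leviForm_ev_re g w v
    rw [leviForm] at hc
    simp only [neg_apply] at hb
    linarith
  have hpol : ∀ v u : CSpace n, ∑ a, ev (pderiv (Sum.inl a) g) w (star w) * v a = 0 →
      ∑ a, ev (pderiv (Sum.inl a) g) w (star w) * u a = 0 → (mixedForm g w v u).re = 0 := by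
    intro v u hv hu
    have h := hre (v + u) (by simp only [Pi.add_apply, mul_add, Finset.sum_add_distrib, hv, hu,
      add_zero])
    rw [mixedForm_add_self, ← hg.star_mixedForm w v u] at h
    simp only [Complex.add_re, hre v hv, hre u hu, Complex.star_def, Complex.conj_re] at h
    linarith
  have hi := hpol (Complex.I • v) u (by rw [hlin, hv, mul_zero]) hu
  rw [mixedForm_smul_left] at hi
  refine Complex.ext (hpol v u hv hu) ?_
  simpa using hi

open MvPolynomial in
/-- The bordered minor of the complex Hessian of `g` formed with the indices `a, b` and `a, d`.
It vanishes on a Levi-flat hypersurface `{g = 0}`. -/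
def leviMinor {n : ℕ} (g : CPoly n) (a b d : Fin n) : CPoly n :=
  pderiv (Sum.inl a) g * pderiv (Sum.inr a) g * pderiv (Sum.inl b) (pderiv (Sum.inr d) g)
  - pderiv (Sum.inl b) g * pderiv (Sum.inr a) g * pderiv (Sum.inl a) (pderiv (Sum.inr d) g)
  - pderiv (Sum.inl a) g * pderiv (Sum.inr d) g * pderiv (Sum.inl b) (pderiv (Sum.inr a) g)
  + pderiv (Sum.inl b) g * pderiv (Sum.inr d) g * pderiv (Sum.inl a) (pderiv (Sum.inr a) g)

open MvPolynomial in
/-- The Levi minor is the value of the complex Hessian of `g` at two complex tangent vectors. -/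
theorem IsRealPoly.ev_leviMinor_eq_zero {n : ℕ} {g : CPoly n} (hg : IsRealPoly g) {w : CSpace n}
    (h1 : IsPseudoconvexAt (fun x => (ev g x (star x)).re) w)
    (h2 : IsPseudoconvexAt (fun x => -(ev g x (star x)).re) w) (a b d : Fin n) :
    ev (leviMinor g a b d) w (star w) = 0 := by
  let p : Fin n → ℂ := fun c => ev (pderiv (Sum.inl c) g) w (star w)
  let V : Fin n → CSpace n := fun c => p a • Pi.single c 1 - p c • Pi.single a 1
  have hV : ∀ c, ∑ e, ev (pderiv (Sum.inl e) g) w (star w) * V c e = 0 := by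
    intro c
    have : ∀ e, ev (pderiv (Sum.inl e) g) w (star w) * V c e =
        p e * p a * (Pi.single c 1 : CSpace n) e - p e * p c * (Pi.single a 1 : CSpace n) e := by
      intro e
      simp only [V, Pi.sub_apply, Pi.smul_apply, smul_eq_mul, p]
      ring
    simp only [this, Finset.sum_sub_distrib, Pi.single_apply, mul_ite, mul_one, mul_zero,
      Finset.sum_ite_eq', Finset.mem_univ, if_true]
    ring
  have hstar : ∀ c, star (p c) = ev (pderiv (Sum.inr c) g) w (star w) := by
    intro c
    have := hg.star_ev_pderiv w (star w) (Sum.inl c)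
    rw [star_star] at this
    exact this
  have key := hg.mixedForm_eq_zero h1 h2 (hV b) (hV d)
  have hexp : mixedForm g w (V b) (V d) = ev (leviMinor g a b d) w (star w) := by
    have hsingle (c e : Fin n) : star ((Pi.single c 1 : CSpace n) e) = if e = c then 1 else 0 := by
      rw [Pi.single_apply]; split_ifs <;> simp
    simp only [mixedForm, V, Pi.sub_apply, Pi.smul_apply, smul_eq_mul, star_sub, star_mul', hsingle,
      hstar, leviMinor, ev_add, ev_sub, ev_mul]
    simp only [mul_sub, sub_mul, Finset.sum_sub_distrib, Pi.single_apply, mul_ite, mul_one,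
      mul_zero, ite_mul, zero_mul, Finset.sum_ite_eq', Finset.mem_univ, if_true, p]
    ring
  rw [← hexp, key]

/-! ### Paths in level sets -/

open Filter Topology Set in
/-- Near a regular point `x₀` of a `C¹` map, every point of the level set of `x₀` is joined to `x₀`
by a `C¹` path that stays in the level set and near `x₀`. -/
theorem exists_path_in_level_set {E F : Type*} [NormedAddCommGroup E] [NormedSpace ℝ E]
    [FiniteDimensional ℝ E] [NormedAddCommGroup F] [NormedSpace ℝ F] [FiniteDimensional ℝ F]
    {f : E → F} (hf : ContDiff ℝ 1 f) {x₀ : E}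
    (hsurj : Function.Surjective (fderiv ℝ f x₀)) {U : Set E} (hU : U ∈ 𝓝 x₀) :
    ∀ᶠ y in 𝓝 x₀, f y = f x₀ → ∃ γ γ' : ℝ → E, (∀ s ∈ Icc (0 : ℝ) 1, HasDerivAt γ (γ' s) s) ∧
      ContinuousOn γ' (Icc 0 1) ∧ (∀ s ∈ Icc (0 : ℝ) 1, γ s ∈ U) ∧
      (∀ s ∈ Icc (0 : ℝ) 1, f (γ s) = f x₀) ∧ γ 0 = x₀ ∧ γ 1 = y := by
  have : CompleteSpace E := FiniteDimensional.complete ℝ E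
  set f' := fderiv ℝ f x₀ with hf'
  let K := LinearMap.ker (f' : E →ₗ[ℝ] F)
  obtain ⟨π, hπ⟩ := K.subtype.exists_leftInverse_of_injective K.ker_subtype
  let Φ : E → F × K := fun x => (f x, π x)
  let L : E →ₗ[ℝ] F × K := (f' : E →ₗ[ℝ] F).prod π
  have hbij : Function.Bijective L := by
    constructor
    · rw [injective_iff_map_eq_zero]
      intro v hv
      have h1 : f' v = 0 := congrArg Prod.fst hv
      have h2 : π v = 0 := congrArg Prod.snd hv
      have h3 : π v = ⟨v, h1⟩ := LinearMap.congr_fun hπ ⟨v, h1⟩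
      rw [h2] at h3
      exact (congrArg Subtype.val h3).symm
    · rintro ⟨a, b⟩
      obtain ⟨v, hv⟩ := hsurj a
      have hk : ∀ k : K, f' k = 0 := fun k => k.2
      have hk2 : ∀ k : K, π k = k := fun k => LinearMap.congr_fun hπ k
      refine ⟨v + ((b - π v : K) : E), ?_⟩
      refine Prod.ext ?_ ?_
      · change f' (v + ((b - π v : K) : E)) = a
        rw [map_add, hk, hv, add_zero]
      · change π (v + ((b - π v : K) : E)) = b
        rw [map_add, hk2]; abel
  let e : E ≃L[ℝ] F × K := (LinearEquiv.ofBijective L hbij).toContinuousLinearEquiv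
  have hΦ : ContDiff ℝ 1 Φ := hf.prodMk (LinearMap.toContinuousLinearMap π).contDiff
  have hΦ' : HasFDerivAt Φ (e : E →L[ℝ] F × K) x₀ := by
    have h1 := (hf.differentiable (by norm_num) x₀).hasFDerivAt.prodMk
      (LinearMap.toContinuousLinearMap π).hasFDerivAt (x := x₀)
    exact h1
  have hone : (1 : WithTop ℕ∞) ≠ 0 := one_ne_zero
  let H := hΦ.contDiffAt.toOpenPartialHomeomorph Φ hΦ' hone
  let g := hΦ.contDiffAt.localInverse hΦ' hone
  have hg : ContDiffAt ℝ 1 g (Φ x₀) := hΦ.contDiffAt.to_localInverse hΦ' hone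
  have hmem : x₀ ∈ H.source := hΦ.contDiffAt.mem_toOpenPartialHomeomorph_source hΦ' hone
  have hgx₀ : g (Φ x₀) = x₀ := hΦ.contDiffAt.localInverse_apply_image hΦ' hone
  have hleft : ∀ᶠ y in 𝓝 x₀, g (Φ y) = y := by
    filter_upwards [H.open_source.mem_nhds hmem] with y hy using H.left_inv hy
  have hright : ∀ᶠ c in 𝓝 (Φ x₀), Φ (g c) = c := by
    filter_upwards [H.open_target.mem_nhds (H.map_source hmem)] with c hc using H.right_inv hc
  have hgU : ∀ᶠ c in 𝓝 (Φ x₀), g c ∈ U := by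
    refine hg.continuousAt.preimage_mem_nhds ?_
    rwa [hgx₀]
  obtain ⟨ε, hε, hball⟩ := Metric.eventually_nhds_iff_ball.1
    ((hg.eventually (by simp)).and (hright.and hgU))
  filter_upwards [hleft, hΦ.continuous.continuousAt.preimage_mem_nhds (Metric.ball_mem_nhds _ hε)]
    with y hy hyε hfy
  let c : ℝ → F × K := fun s => Φ x₀ + s • (Φ y - Φ x₀)
  have hc : ∀ s ∈ Icc (0 : ℝ) 1, c s ∈ Metric.ball (Φ x₀) ε := fun s hs =>
    (convex_ball _ _).add_smul_sub_mem (Metric.mem_ball_self hε) hyε hs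
  have hc' : ∀ s, HasDerivAt c (Φ y - Φ x₀) s := fun s => by
    have h1 := ((hasDerivAt_id s).smul_const (Φ y - Φ x₀)).const_add (Φ x₀)
    rw [one_smul] at h1
    exact h1
  refine ⟨fun s => g (c s), fun s => fderiv ℝ g (c s) (Φ y - Φ x₀), ?_, ?_, ?_, ?_, ?_, ?_⟩
  · intro s hs
    exact (((hball _ (hc s hs)).1.differentiableAt hone).hasFDerivAt).comp_hasDerivAt s (hc' s)
  · intro s hs
    have h1 : ContinuousAt (fderiv ℝ g) (c s) :=
      ((hball _ (hc s hs)).1.fderiv_right (m := 0) (by norm_num)).continuousAt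
    have h2 : ContinuousAt (fun s => fderiv ℝ g (c s)) s :=
      ContinuousAt.comp (f := c) (x := s) h1 (hc' s).continuousAt
    exact (h2.clm_apply continuousAt_const).continuousWithinAt
  · exact fun s hs => (hball _ (hc s hs)).2.2
  · intro s hs
    have h1 : f (g (c s)) = (c s).1 := congrArg Prod.fst (hball _ (hc s hs)).2.1
    rw [h1]
    simp [c, Φ, hfy]
  · simp [c, hgx₀]
  · simp [c, hy]

/-! ### A uniqueness theorem for a hyperbolic equation -/

open Set in
/-- The linear hyperbolic equation `K_st = αK + βK_s + γK_t` on the unit square has no nonzero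
solution that vanishes on the two axes. -/
theorem eq_zero_of_goursat {K Ks Kt Kst α β γ : ℝ × ℝ → ℂ}
    (hK : ContinuousOn K (Icc 0 1 ×ˢ Icc 0 1)) (hKs : ContinuousOn Ks (Icc 0 1 ×ˢ Icc 0 1))
    (hKt : ContinuousOn Kt (Icc 0 1 ×ˢ Icc 0 1)) (hα : ContinuousOn α (Icc 0 1 ×ˢ Icc 0 1))
    (hβ : ContinuousOn β (Icc 0 1 ×ˢ Icc 0 1)) (hγ : ContinuousOn γ (Icc 0 1 ×ˢ Icc 0 1))
    (dK : ∀ s ∈ Icc (0 : ℝ) 1, ∀ t ∈ Icc (0 : ℝ) 1, HasDerivAt (fun s => K (s, t)) (Ks (s, t)) s)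
    (dKs : ∀ s ∈ Icc (0 : ℝ) 1, ∀ t ∈ Icc (0 : ℝ) 1,
      HasDerivAt (fun t => Ks (s, t)) (Kst (s, t)) t)
    (dKt : ∀ s ∈ Icc (0 : ℝ) 1, ∀ t ∈ Icc (0 : ℝ) 1,
      HasDerivAt (fun s => Kt (s, t)) (Kst (s, t)) s)
    (h0K : ∀ t ∈ Icc (0 : ℝ) 1, K (0, t) = 0) (h0s : ∀ s ∈ Icc (0 : ℝ) 1, Ks (s, 0) = 0)
    (h0t : ∀ t ∈ Icc (0 : ℝ) 1, Kt (0, t) = 0)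
    (heq : ∀ x ∈ Icc (0 : ℝ) 1 ×ˢ Icc (0 : ℝ) 1, Kst x = α x * K x + β x * Ks x + γ x * Kt x) :
    ∀ x ∈ Icc (0 : ℝ) 1 ×ˢ Icc (0 : ℝ) 1, K x = 0 := by
  have hcpt : IsCompact (Icc (0 : ℝ) 1 ×ˢ Icc (0 : ℝ) 1) := isCompact_Icc.prod isCompact_Icc
  obtain ⟨A, hA⟩ := hcpt.exists_bound_of_continuousOn hα
  obtain ⟨B, hB⟩ := hcpt.exists_bound_of_continuousOn hβ
  obtain ⟨D, hD⟩ := hcpt.exists_bound_of_continuousOn hγ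
  let c := max A (max B D)
  have h00 : ((0 : ℝ), (0 : ℝ)) ∈ Icc (0 : ℝ) 1 ×ˢ Icc (0 : ℝ) 1 := by simp
  have hc0 : 0 ≤ c := (norm_nonneg _).trans ((hA _ h00).trans (le_max_left _ _))
  have hbound : ∀ x ∈ Icc (0 : ℝ) 1 ×ˢ Icc (0 : ℝ) 1, ‖Kst x‖ ≤ c * (‖K x‖ + ‖Ks x‖ + ‖Kt x‖) := by
    intro x hx
    have h1 : ‖α x‖ ≤ c := (hA x hx).trans (le_max_left _ _)
    have h2 : ‖β x‖ ≤ c := (hB x hx).trans ((le_max_left _ _).trans (le_max_right _ _))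
    have h3 : ‖γ x‖ ≤ c := (hD x hx).trans ((le_max_right _ _).trans (le_max_right _ _))
    rw [heq x hx, mul_add, mul_add]
    refine (norm_add₃_le).trans ?_
    rw [norm_mul, norm_mul, norm_mul]
    gcongr
  -- The weight `exp (-l (s + t))` makes the integral operator behind the equation a contraction.
  let l := 2 * (2 * c + 1)
  have hl : 0 < l := by positivity
  let W : ℝ × ℝ → ℝ := fun x => Real.exp (-(l * (x.1 + x.2))) * (‖K x‖ + ‖Ks x‖ + ‖Kt x‖)
  have hW : ContinuousOn W (Icc 0 1 ×ˢ Icc 0 1) := by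
    refine ContinuousOn.mul (by fun_prop) ((hK.norm.add hKs.norm).add hKt.norm)
  obtain ⟨x₁, hx₁, hmax⟩ := hcpt.exists_isMaxOn ⟨_, h00⟩ hW
  set N := W x₁ with hN
  have hN0 : 0 ≤ N := by positivity
  have hle : ∀ x ∈ Icc (0 : ℝ) 1 ×ˢ Icc (0 : ℝ) 1,
      ‖K x‖ + ‖Ks x‖ + ‖Kt x‖ ≤ N * Real.exp (l * (x.1 + x.2)) := by
    intro x hx
    have h1 : W x ≤ N := hmax hx
    have h2 : ‖K x‖ + ‖Ks x‖ + ‖Kt x‖ = W x * Real.exp (l * (x.1 + x.2)) := by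
      simp only [W]
      rw [mul_right_comm, ← Real.exp_add]
      simp
    rw [h2]
    gcongr
  have hint : ∀ (u u' : ℝ → ℂ) (M b : ℝ), 0 ≤ M → u 0 = 0 →
      (∀ x ∈ Icc (0 : ℝ) 1, HasDerivAt u (u' x) x) →
      (∀ x ∈ Icc (0 : ℝ) 1, ‖u' x‖ ≤ M * Real.exp (l * (b + x))) →
      ∀ x ∈ Icc (0 : ℝ) 1, ‖u x‖ ≤ M / l * Real.exp (l * (b + x)) := by
    intro u u' M b hM hu0 hu hu'
    refine image_norm_le_of_norm_deriv_right_le_deriv_boundary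
      (B' := fun x => M * Real.exp (l * (b + x)))
      (fun x hx => (hu x hx).continuousAt.continuousWithinAt)
      (fun x hx => (hu x (Ico_subset_Icc_self hx)).hasDerivWithinAt) ?_ ?_
      (fun x hx => hu' x (Ico_subset_Icc_self hx))
    · rw [hu0, norm_zero]; positivity
    · intro x
      have h1 : HasDerivAt (fun x => l * (b + x)) l x := by
        simpa using ((hasDerivAt_id x).const_add b).const_mul l
      have h2 : M / l * (Real.exp (l * (b + x)) * l) = M * Real.exp (l * (b + x)) := by
        rw [div_mul_eq_mul_div, div_eq_iff hl.ne']
        ring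
      exact h2 ▸ h1.exp.const_mul (M / l)
  have hhalf : ∀ x ∈ Icc (0 : ℝ) 1 ×ˢ Icc (0 : ℝ) 1,
      ‖K x‖ + ‖Ks x‖ + ‖Kt x‖ ≤ N / 2 * Real.exp (l * (x.1 + x.2)) := by
    rintro ⟨s, t⟩ ⟨hs, ht⟩
    have hst : ∀ s ∈ Icc (0 : ℝ) 1, ∀ t ∈ Icc (0 : ℝ) 1,
        ‖Kst (s, t)‖ ≤ c * N * Real.exp (l * (s + t)) := fun s hs t ht =>
      (hbound _ ⟨hs, ht⟩).trans (by
        rw [mul_assoc]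
        exact mul_le_mul_of_nonneg_left (hle _ ⟨hs, ht⟩) hc0)
    have h1 := hint (fun t => Ks (s, t)) (fun t => Kst (s, t)) (c * N) s (by positivity) (h0s s hs)
      (dKs s hs) (hst s hs) t ht
    have h2 := hint (fun s => Kt (s, t)) (fun s => Kst (s, t)) (c * N) t (by positivity) (h0t t ht)
      (fun s hs => dKt s hs t ht) (fun s hs => by rw [add_comm t]; exact hst s hs t ht) s hs
    have h3 := hint (fun s => K (s, t)) (fun s => Ks (s, t)) N t hN0 (h0K t ht)
      (fun s hs => dK s hs t ht) (fun s hs => by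
        rw [add_comm t]
        refine le_trans ?_ (hle (s, t) ⟨hs, ht⟩)
        linarith [norm_nonneg (K (s, t)), norm_nonneg (Kt (s, t))]) s hs
    rw [add_comm t s] at h2 h3
    have h4 : N / 2 = N / l + c * N / l + c * N / l := by
      simp only [l]
      field_simp
      ring
    simp only at h1 h2 h3 ⊢
    rw [h4, add_mul, add_mul]
    linarith
  have hN00 : N = 0 := by
    have h1 := hhalf x₁ hx₁
    have h2 : N ≤ N / 2 := by
      have h3 : N = Real.exp (-(l * (x₁.1 + x₁.2))) * (‖K x₁‖ + ‖Ks x₁‖ + ‖Kt x₁‖) := rfl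
      have h4 : Real.exp (-(l * (x₁.1 + x₁.2))) * (‖K x₁‖ + ‖Ks x₁‖ + ‖Kt x₁‖) ≤
          Real.exp (-(l * (x₁.1 + x₁.2))) * (N / 2 * Real.exp (l * (x₁.1 + x₁.2))) := by gcongr
      rw [← h3, mul_comm, mul_assoc, ← Real.exp_add] at h4
      simpa using h4
    linarith
  intro x hx
  have h1 := hle x hx
  rw [hN00, zero_mul] at h1
  exact norm_le_zero_iff.1 (by linarith [norm_nonneg (K x), norm_nonneg (Ks x), norm_nonneg (Kt x)])

/-! ### Segre varieties of a Levi-flat hypersurface -/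

section
variable {n : ℕ}

theorem continuous_ev (Q : CPoly n) : Continuous fun x : CSpace n × CSpace n => ev Q x.1 x.2 := by
  refine (contDiff_eval Q (m := 0)).continuous.comp ?_
  refine continuous_pi fun j => ?_
  rcases j with a | a
  · exact (continuous_apply a).comp continuous_fst
  · exact (continuous_apply a).comp continuous_snd

open MvPolynomial in
theorem hasStrictFDerivAt_ev_left (Q : CPoly n) (z ζ : CSpace n) :
    HasStrictFDerivAt (fun x => ev Q x ζ)
      (∑ b, ev (pderiv (Sum.inl b) Q) z ζ • ContinuousLinearMap.proj (R := ℂ) (φ := fun _ => ℂ) b)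
      z := by
  have h1 : HasStrictFDerivAt (fun x : CSpace n => (Sum.elim x ζ : Fin n ⊕ Fin n → ℂ))
      (ContinuousLinearMap.pi (Sum.elim (fun b => ContinuousLinearMap.proj (R := ℂ) (φ := fun _ : Fin n => ℂ) b)
        (fun _ => 0))) z := by
    rw [hasStrictFDerivAt_pi']
    rintro (b | b)
    · exact (ContinuousLinearMap.proj (R := ℂ) (φ := fun _ : Fin n => ℂ) b).hasStrictFDerivAt
    · exact hasStrictFDerivAt_const _ _
  refine ((hasStrictFDerivAt_eval Q (Sum.elim z ζ)).comp z h1).congr_fderiv ?_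
  ext v
  simp [dPoly_apply, ev]

open MvPolynomial in
theorem hasStrictFDerivAt_ev_right (Q : CPoly n) (z ζ : CSpace n) :
    HasStrictFDerivAt (fun x => ev Q z x)
      (∑ b, ev (pderiv (Sum.inr b) Q) z ζ • ContinuousLinearMap.proj (R := ℂ) (φ := fun _ => ℂ) b)
      ζ := by
  have h1 : HasStrictFDerivAt (fun x : CSpace n => (Sum.elim z x : Fin n ⊕ Fin n → ℂ))
      (ContinuousLinearMap.pi (Sum.elim (fun _ => 0)
        (fun b => ContinuousLinearMap.proj (R := ℂ) (φ := fun _ : Fin n => ℂ) b))) ζ := by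
    rw [hasStrictFDerivAt_pi']
    rintro (b | b)
    · exact hasStrictFDerivAt_const _ _
    · exact (ContinuousLinearMap.proj (R := ℂ) (φ := fun _ : Fin n => ℂ) b).hasStrictFDerivAt
  refine ((hasStrictFDerivAt_eval Q (Sum.elim z ζ)).comp ζ h1).congr_fderiv ?_
  ext v
  simp [dPoly_apply, ev]

open MvPolynomial in
theorem hasDerivAt_ev_left (Q : CPoly n) {γ : ℝ → CSpace n} {γ' : CSpace n} {s : ℝ}
    (hγ : HasDerivAt γ γ' s) (ζ : CSpace n) :
    HasDerivAt (fun s => ev Q (γ s) ζ) (∑ b, ev (pderiv (Sum.inl b) Q) (γ s) ζ * γ' b) s := by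
  have h := ((hasStrictFDerivAt_ev_left Q (γ s) ζ).restrictScalars ℝ).hasFDerivAt.comp_hasDerivAt
    s hγ
  exact h.congr_deriv (by simp)

open MvPolynomial in
theorem hasDerivAt_ev_right (Q : CPoly n) {γ : ℝ → CSpace n} {γ' : CSpace n} {s : ℝ}
    (hγ : HasDerivAt γ γ' s) (z : CSpace n) :
    HasDerivAt (fun s => ev Q z (γ s)) (∑ b, ev (pderiv (Sum.inr b) Q) z (γ s) * γ' b) s := by
  have h := ((hasStrictFDerivAt_ev_right Q z (γ s)).restrictScalars ℝ).hasFDerivAt.comp_hasDerivAt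
    s hγ
  exact h.congr_deriv (by simp)

theorem eq_zero_of_hasDerivAt_of_eq_zero {u : ℝ → ℂ} {u' : ℂ} {s : ℝ} (hs : s ∈ Set.Icc (0 : ℝ) 1)
    (hu : HasDerivAt u u' s) (h0 : ∀ s ∈ Set.Icc (0 : ℝ) 1, u s = 0) : u' = 0 := by
  have h1 : HasDerivWithinAt u 0 (Set.Icc 0 1) s :=
    (hasDerivWithinAt_const s (Set.Icc (0 : ℝ) 1) (0 : ℂ)).congr h0 (h0 s hs)
  exact (uniqueDiffOn_Icc (zero_lt_one (α := ℝ)) s hs).eq_deriv _ hu.hasDerivWithinAt h1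

open MvPolynomial in
theorem surjective_fderiv_ev_left {Q : CPoly n} {z ζ : CSpace n} {a : Fin n}
    (ha : ev (pderiv (Sum.inl a) Q) z ζ ≠ 0) :
    Function.Surjective (fderiv ℝ (fun x => ev Q x ζ) z) := by
  rw [((hasStrictFDerivAt_ev_left Q z ζ).restrictScalars ℝ).hasFDerivAt.fderiv]
  intro c
  refine ⟨Pi.single a (c / ev (pderiv (Sum.inl a) Q) z ζ), ?_⟩
  simp [Pi.single_apply]
  field_simp

open MvPolynomial in
theorem surjective_fderiv_ev_right {Q : CPoly n} {z ζ : CSpace n} {a : Fin n}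
    (ha : ev (pderiv (Sum.inr a) Q) z ζ ≠ 0) :
    Function.Surjective (fderiv ℝ (fun x => ev Q z x) ζ) := by
  rw [((hasStrictFDerivAt_ev_right Q z ζ).restrictScalars ℝ).hasFDerivAt.fderiv]
  intro c
  refine ⟨Pi.single a (c / ev (pderiv (Sum.inr a) Q) z ζ), ?_⟩
  simp [Pi.single_apply]
  field_simp

theorem contDiff_ev_left (Q : CPoly n) (ζ : CSpace n) {m : WithTop ℕ∞} :
    ContDiff ℝ m fun z => ev Q z ζ := by
  refine ((contDiff_eval Q (m := m)).restrict_scalars ℝ).comp (contDiff_pi.2 ?_)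
  rintro (b | b)
  · exact contDiff_apply ℝ ℂ b
  · exact contDiff_const

theorem contDiff_ev_right (Q : CPoly n) (z : CSpace n) {m : WithTop ℕ∞} :
    ContDiff ℝ m fun ζ => ev Q z ζ := by
  refine ((contDiff_eval Q (m := m)).restrict_scalars ℝ).comp (contDiff_pi.2 ?_)
  rintro (b | b)
  · exact contDiff_const
  · exact contDiff_apply ℝ ℂ b

attribute [local irreducible] ev

/-- The Hessian `m`, bordered by `p` and `q`, applied to the vectors `u` and `v`. -/
theorem bordered_hessian_sum {p q : Fin n → ℂ} {m h : Fin n → Fin n → ℂ} {k : ℂ} {a : Fin n}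
    (hyp : ∀ b d, p a * q a * m b d - p b * q a * m a d - p a * q d * m b a + p b * q d * m a a =
      k * h b d) (u v : Fin n → ℂ) :
    p a * q a * ∑ b, ∑ d, m b d * u b * v d = (∑ b, ∑ d, h b d * u b * v d) * k +
      (q a * (∑ d, m a d * v d) - m a a * ∑ d, q d * v d) * ∑ b, p b * u b +
      p a * (∑ b, m b a * u b) * ∑ d, q d * v d := by
  have e2 : q a * (∑ d, m a d * v d) * ∑ b, p b * u b =
      ∑ b, ∑ d, q a * (m a d * v d) * (p b * u b) := by
    simp only [Finset.mul_sum, Finset.sum_mul]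
  have e3 : p a * (∑ b, m b a * u b) * ∑ d, q d * v d =
      ∑ b, ∑ d, p a * (m b a * u b) * (q d * v d) := by
    simp only [Finset.mul_sum, Finset.sum_mul]
    rw [Finset.sum_comm]
  have e4 : m a a * (∑ d, q d * v d) * ∑ b, p b * u b =
      ∑ b, ∑ d, m a a * (q d * v d) * (p b * u b) := by
    simp only [Finset.mul_sum, Finset.sum_mul]
  rw [sub_mul, e2, e3, e4]
  simp only [Finset.mul_sum, Finset.sum_mul, ← Finset.sum_sub_distrib, ← Finset.sum_add_distrib]
  refine Finset.sum_congr rfl fun b _ => Finset.sum_congr rfl fun d _ => ?_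
  linear_combination u b * v d * hyp b d

open MvPolynomial Set in
/-- Along a pair of paths `z(s)`, `ζ(t)`, the function `K(s, t) = g(z(s), ζ(t))` satisfies a
homogeneous linear hyperbolic equation, as soon as `g` divides its Levi minors. Hence it vanishes if
it does so on the two axes. -/
theorem ev_eq_zero_of_paths {g : CPoly n} {a : Fin n} (hdvd : ∀ b d, g ∣ leviMinor g a b d)
    {z z' ζ ζ' : ℝ → CSpace n} (hz : ∀ s ∈ Icc (0 : ℝ) 1, HasDerivAt z (z' s) s)
    (hζ : ∀ t ∈ Icc (0 : ℝ) 1, HasDerivAt ζ (ζ' t) t) (hz' : ContinuousOn z' (Icc 0 1))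
    (hζ' : ContinuousOn ζ' (Icc 0 1))
    (hne : ∀ s ∈ Icc (0 : ℝ) 1, ∀ t ∈ Icc (0 : ℝ) 1, ev (pderiv (Sum.inl a) g) (z s) (ζ t) ≠ 0)
    (hne' : ∀ s ∈ Icc (0 : ℝ) 1, ∀ t ∈ Icc (0 : ℝ) 1, ev (pderiv (Sum.inr a) g) (z s) (ζ t) ≠ 0)
    (h0z : ∀ s ∈ Icc (0 : ℝ) 1, ev g (z s) (ζ 0) = 0)
    (h0ζ : ∀ t ∈ Icc (0 : ℝ) 1, ev g (z 0) (ζ t) = 0) :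
    ev g (z 1) (ζ 1) = 0 := by
  choose h hh using hdvd
  have hzc : ContinuousOn z (Icc 0 1) := fun s hs => (hz s hs).continuousAt.continuousWithinAt
  have hζc : ContinuousOn ζ (Icc 0 1) := fun s hs => (hζ s hs).continuousAt.continuousWithinAt
  have m1 : MapsTo Prod.fst (Icc (0 : ℝ) 1 ×ˢ Icc (0 : ℝ) 1) (Icc (0 : ℝ) 1) := fun x hx => hx.1
  have m2 : MapsTo Prod.snd (Icc (0 : ℝ) 1 ×ˢ Icc (0 : ℝ) 1) (Icc (0 : ℝ) 1) := fun x hx => hx.2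
  have hev : ∀ Q : CPoly n, ContinuousOn (fun x : ℝ × ℝ => ev Q (z x.1) (ζ x.2))
      (Icc 0 1 ×ˢ Icc 0 1) := fun Q =>
    (continuous_ev Q).comp_continuousOn
      ((hzc.comp continuousOn_fst m1).prodMk (hζc.comp continuousOn_snd m2))
  have hzb : ∀ b, ContinuousOn (fun x : ℝ × ℝ => z' x.1 b) (Icc 0 1 ×ˢ Icc 0 1) := fun b =>
    (continuous_apply b).comp_continuousOn (hz'.comp continuousOn_fst m1)
  have hζb : ∀ b, ContinuousOn (fun x : ℝ × ℝ => ζ' x.2 b) (Icc 0 1 ×ˢ Icc 0 1) := fun b =>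
    (continuous_apply b).comp_continuousOn (hζ'.comp continuousOn_snd m2)
  let E (Q : CPoly n) (x : ℝ × ℝ) : ℂ := ev Q (z x.1) (ζ x.2)
  let Ks : ℝ × ℝ → ℂ := fun x => ∑ b, E (pderiv (Sum.inl b) g) x * z' x.1 b
  let Kt : ℝ × ℝ → ℂ := fun x => ∑ d, E (pderiv (Sum.inr d) g) x * ζ' x.2 d
  let Kst : ℝ × ℝ → ℂ := fun x =>
    ∑ b, ∑ d, E (pderiv (Sum.inl b) (pderiv (Sum.inr d) g)) x * z' x.1 b * ζ' x.2 d
  let D : ℝ × ℝ → ℂ := fun x => E (pderiv (Sum.inl a) g) x * E (pderiv (Sum.inr a) g) x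
  let B : ℝ × ℝ → ℂ := fun x => E (pderiv (Sum.inr a) g) x *
    ∑ d, E (pderiv (Sum.inl a) (pderiv (Sum.inr d) g)) x * ζ' x.2 d
  let G : ℝ × ℝ → ℂ := fun x => E (pderiv (Sum.inl a) g) x *
    ∑ b, E (pderiv (Sum.inl b) (pderiv (Sum.inr a) g)) x * z' x.1 b
  have hKs : ContinuousOn Ks (Icc 0 1 ×ˢ Icc 0 1) :=
    continuousOn_finsetSum _ fun b _ => (hev _).mul (hzb b)
  have hKt : ContinuousOn Kt (Icc 0 1 ×ˢ Icc 0 1) :=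
    continuousOn_finsetSum _ fun b _ => (hev _).mul (hζb b)
  have hD : ContinuousOn D (Icc 0 1 ×ˢ Icc 0 1) := (hev _).mul (hev _)
  have hD0 : ∀ x ∈ Icc (0 : ℝ) 1 ×ˢ Icc (0 : ℝ) 1, D x ≠ 0 := fun x hx =>
    mul_ne_zero (hne _ hx.1 _ hx.2) (hne' _ hx.1 _ hx.2)
  have dKs : ∀ s ∈ Icc (0 : ℝ) 1, ∀ t ∈ Icc (0 : ℝ) 1,
      HasDerivAt (fun t => Ks (s, t)) (Kst (s, t)) t := by
    intro s hs t ht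
    refine HasDerivAt.fun_sum fun b _ => ?_
    have h1 := (hasDerivAt_ev_right (pderiv (Sum.inl b) g) (hζ t ht) (z s)).mul_const (z' s b)
    rw [Finset.sum_mul] at h1
    refine h1.congr_deriv (Finset.sum_congr rfl fun d _ => ?_)
    simp only [E]
    rw [pderiv_pderiv_comm]
    ring
  have dKt : ∀ s ∈ Icc (0 : ℝ) 1, ∀ t ∈ Icc (0 : ℝ) 1,
      HasDerivAt (fun s => Kt (s, t)) (Kst (s, t)) s := by
    intro s hs t ht
    simp only [Kst]
    rw [Finset.sum_comm]
    refine HasDerivAt.fun_sum fun d _ => ?_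
    have h1 := (hasDerivAt_ev_left (pderiv (Sum.inr d) g) (hz s hs) (ζ t)).mul_const (ζ' t d)
    rwa [Finset.sum_mul] at h1
  have dK : ∀ s ∈ Icc (0 : ℝ) 1, ∀ t ∈ Icc (0 : ℝ) 1,
      HasDerivAt (fun s => E g (s, t)) (Ks (s, t)) s := fun s hs t _ =>
    hasDerivAt_ev_left g (hz s hs) (ζ t)
  have h0 : (0 : ℝ) ∈ Icc (0 : ℝ) 1 := by simp
  have h1 : (1 : ℝ) ∈ Icc (0 : ℝ) 1 := by simp
  have heq : ∀ x ∈ Icc (0 : ℝ) 1 ×ˢ Icc (0 : ℝ) 1,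
      Kst x = (∑ b, ∑ d, E (h b d) x * z' x.1 b * ζ' x.2 d) / D x * E g x +
        (B x - E (pderiv (Sum.inl a) (pderiv (Sum.inr a) g)) x * Kt x) / D x * Ks x +
        G x / D x * Kt x := by
    intro x hx
    have key := bordered_hessian_sum (p := fun b => E (pderiv (Sum.inl b) g) x)
      (q := fun d => E (pderiv (Sum.inr d) g) x)
      (m := fun b d => E (pderiv (Sum.inl b) (pderiv (Sum.inr d) g)) x)
      (h := fun b d => E (h b d) x) (k := E g x) (a := a) (fun b d => by
        have := congrArg (fun Q => E Q x) (hh b d)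
        simpa only [E, leviMinor, ev_add, ev_sub, ev_mul] using this) (z' x.1) (ζ' x.2)
    have h1 : D x * Kst x = _ := key
    rw [div_mul_eq_mul_div, div_mul_eq_mul_div, div_mul_eq_mul_div, ← add_div, ← add_div,
      eq_div_iff (hD0 x hx), mul_comm, h1]
  refine eq_zero_of_goursat (K := E g) (Ks := Ks) (Kt := Kt) (Kst := Kst) (hev g) hKs hKt ?_ ?_ ?_
    dK dKs dKt h0ζ ?_ ?_ heq (1, 1) ⟨h1, h1⟩
  · exact (continuousOn_finsetSum _ fun b _ => continuousOn_finsetSum _ fun d _ =>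
      ((hev _).mul (hzb b)).mul (hζb d)).div hD hD0
  · exact (((hev _).mul (continuousOn_finsetSum _ fun d _ => (hev _).mul (hζb d))).sub
      ((hev _).mul hKt)).div hD hD0
  · exact ((hev _).mul (continuousOn_finsetSum _ fun b _ => (hev _).mul (hzb b))).div hD hD0
  · exact fun s hs => eq_zero_of_hasDerivAt_of_eq_zero hs (dK s hs 0 h0) h0z
  · exact fun t ht => eq_zero_of_hasDerivAt_of_eq_zero ht
      (hasDerivAt_ev_right g (hζ t ht) (z 0)) h0ζ

open MvPolynomial Filter Topology in
/-- If `g` divides its Levi minors, then near `(p, π)` it vanishes on the product of the Segre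
varieties `{g(·, π) = 0}` and `{g(p, ·) = 0}`. -/
theorem eventually_ev_eq_zero_of_segre {g : CPoly n} {a : Fin n}
    (hdvd : ∀ b d, g ∣ leviMinor g a b d) {p π : CSpace n} (h0 : ev g p π = 0)
    (ha : ev (pderiv (Sum.inl a) g) p π ≠ 0) (ha' : ev (pderiv (Sum.inr a) g) p π ≠ 0) :
    ∀ᶠ x : CSpace n × CSpace n in 𝓝 (p, π), ev g x.1 π = 0 → ev g p x.2 = 0 →
      ev g x.1 x.2 = 0 := by
  have hev : ∀ᶠ x : CSpace n × CSpace n in 𝓝 (p, π), ev (pderiv (Sum.inl a) g) x.1 x.2 ≠ 0 ∧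
      ev (pderiv (Sum.inr a) g) x.1 x.2 ≠ 0 :=
    ((continuous_ev _).continuousAt.eventually_ne ha).and
      ((continuous_ev _).continuousAt.eventually_ne ha')
  rw [nhds_prod_eq] at hev ⊢
  obtain ⟨U, hU, W, hW, hUW⟩ := eventually_prod_iff.1 hev
  have h1 := exists_path_in_level_set (f := fun z => ev g z π) (contDiff_ev_left g π) (surjective_fderiv_ev_left ha) hU
  have h2 := exists_path_in_level_set (f := fun ζ => ev g p ζ) (contDiff_ev_right g p) (surjective_fderiv_ev_right ha') hW
  filter_upwards [h1.prod_mk h2] with x hx hxz hxζ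
  obtain ⟨z, z', hz, hz', hzU, hz0, hzp, hzx⟩ := hx.1 (by rw [hxz, h0])
  obtain ⟨ζ, ζ', hζ, hζ', hζW, hζ0, hζp, hζx⟩ := hx.2 (by rw [hxζ, h0])
  rw [← hzx, ← hζx]
  refine ev_eq_zero_of_paths (z := z) (ζ := ζ) hdvd hz hζ hz' hζ' (fun s hs t ht => (hUW (hzU s hs) (hζW t ht)).1)
    (fun s hs t ht => (hUW (hzU s hs) (hζW t ht)).2) (fun s hs => ?_) (fun t ht => ?_)
  · rw [hζp]; exact (hz0 s hs).trans h0
  · rw [hzp]; exact (hζ0 t ht).trans h0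

end

/-! ### Sums over the zeros in a disc -/

open Complex Metric Set in
theorem circleIntegral_div_sub_of_notMem_closedBall {h : ℂ → ℂ} (hh : Differentiable ℂ h) {c w : ℂ}
    {R : ℝ} (hR : 0 < R) (hw : w ∉ closedBall c R) : (∮ z in C(c, R), h z * (1 / (z - w))) = 0 := by
  refine DiffContOnCl.circleIntegral_eq_zero hR.le (DifferentiableOn.diffContOnCl fun z hz => ?_)
  have hz' : z ∈ closedBall c R := closure_ball_subset_closedBall hz
  have : z - w ≠ 0 := fun h0 => hw (by rwa [← sub_eq_zero.1 h0])
  exact ((hh z).mul ((differentiableAt_const _).div (differentiableAt_id.sub_const w)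
    this)).differentiableWithinAt

open Complex Metric Set Classical in
theorem circleIntegral_multiset_sum {h : ℂ → ℂ} (hh : Differentiable ℂ h) {c : ℂ} {R : ℝ}
    (hR : 0 < R) (s : Multiset ℂ) (hs : ∀ α ∈ s, α ∉ sphere c R) :
    CircleIntegrable (fun z => h z * (s.map fun α => 1 / (z - α)).sum) c R ∧
    (∮ z in C(c, R), h z * (s.map fun α => 1 / (z - α)).sum) =
      2 * Real.pi * I * ((s.filter (· ∈ ball c R)).map h).sum := by
  induction s using Multiset.induction_on with
  | empty => simp [circleIntegral]
  | cons α s ih =>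
    obtain ⟨hi, he⟩ := ih fun β hβ => hs β (Multiset.mem_cons_of_mem hβ)
    have hα : α ∉ sphere c R := hs α (Multiset.mem_cons_self α s)
    have hi' : CircleIntegrable (fun z => h z * (1 / (z - α))) c R := by
      refine ContinuousOn.circleIntegrable hR.le (hh.continuous.continuousOn.mul
        (continuousOn_const.div (continuousOn_id.sub continuousOn_const) fun z hz h0 => hα ?_))
      rwa [← sub_eq_zero.1 h0]
    have hfun : (fun z => h z * (((α ::ₘ s).map fun α => 1 / (z - α)).sum)) =
        fun z => h z * (1 / (z - α)) + h z * (s.map fun α => 1 / (z - α)).sum := by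
      funext z
      rw [Multiset.map_cons, Multiset.sum_cons, mul_add]
    rw [hfun]
    refine ⟨hi'.add hi, ?_⟩
    rw [circleIntegral.integral_add hi' hi, he]
    by_cases hb : α ∈ ball c R
    · have h1 := circleIntegral_div_sub_of_differentiable_on_off_countable (s := ∅) (f := h)
        countable_empty hb hh.continuous.continuousOn (fun z _ => hh z)
      simp only [mul_one_div]
      rw [h1, Multiset.filter_cons_of_pos _ hb, Multiset.map_cons, Multiset.sum_cons]
      ring
    · have hc : α ∉ closedBall c R := by
        rw [← ball_union_sphere]
        exact fun h => h.elim hb hα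
      rw [circleIntegral_div_sub_of_notMem_closedBall hh hR hc,
        Multiset.filter_cons_of_neg (p := (· ∈ ball c R)) _ hb, zero_add]

open Complex Metric Set Classical Polynomial in
/-- A sum of values of `h` over the roots of a polynomial in a disc is a contour integral. -/
theorem circleIntegral_derivative_div {h : ℂ → ℂ} (hh : Differentiable ℂ h) {c : ℂ} {R : ℝ}
    (hR : 0 < R) {f : ℂ[X]} (hf : ∀ z ∈ sphere c R, f.eval z ≠ 0) :
    (∮ z in C(c, R), h z * (f.derivative.eval z / f.eval z)) =
      2 * Real.pi * I * ((f.roots.filter (· ∈ ball c R)).map h).sum := by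
  rw [← (circleIntegral_multiset_sum hh hR f.roots fun α hα hs =>
    hf α hs (isRoot_of_mem_roots hα)).2]
  refine circleIntegral.integral_congr hR.le fun z hz => ?_
  rw [(IsAlgClosed.splits f).eval_derivative_div_eval_of_ne_zero (hf z hz)]

open Complex Metric Set in
/-- A contour integral depending holomorphically on a parameter. -/
theorem differentiableOn_circleIntegral {Ψ Ψ' : ℂ → ℂ → ℂ} {O : Set ℂ} (hO : IsOpen O) {c : ℂ}
    {R : ℝ} (hR : 0 < R)
    (hd : ∀ τ ∈ O, ∀ z ∈ sphere c R, HasDerivAt (fun τ => Ψ τ z) (Ψ' τ z) τ)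
    (hΨ : ContinuousOn (fun x : ℂ × ℂ => Ψ x.1 x.2) (O ×ˢ sphere c R))
    (hΨ' : ContinuousOn (fun x : ℂ × ℂ => Ψ' x.1 x.2) (O ×ˢ sphere c R)) :
    DifferentiableOn ℂ (fun τ => ∮ z in C(c, R), Ψ τ z) O := by
  intro τ₀ hτ₀
  obtain ⟨ε, hε, hεO⟩ := nhds_basis_closedBall.mem_iff.1 (hO.mem_nhds hτ₀)
  have hm : ∀ θ, circleMap c R θ ∈ sphere c R := fun θ => circleMap_mem_sphere c hR.le θ
  have hcθ : Continuous fun θ => deriv (circleMap c R) θ := by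
    simp only [deriv_circleMap]
    fun_prop
  have hslice : ∀ (Φ : ℂ → ℂ → ℂ), ContinuousOn (fun x : ℂ × ℂ => Φ x.1 x.2) (O ×ˢ sphere c R) →
      ∀ τ ∈ O, Continuous fun θ => deriv (circleMap c R) θ • Φ τ (circleMap c R θ) := by
    intro Φ hΦ τ hτ
    refine hcθ.smul ?_
    exact hΦ.comp_continuous (f := fun θ => (τ, circleMap c R θ))
      (continuous_const.prodMk (continuous_circleMap c R)) fun θ => ⟨hτ, hm θ⟩
  obtain ⟨C, hC⟩ := ((isCompact_closedBall τ₀ ε).prod (isCompact_sphere c R)).exists_bound_of_continuousOn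
    (hΨ'.mono (prod_mono_left hεO))
  have key := intervalIntegral.hasDerivAt_integral_of_dominated_loc_of_deriv_le
    (μ := MeasureTheory.volume) (a := 0) (b := 2 * Real.pi)
    (F := fun τ θ => deriv (circleMap c R) θ • Ψ τ (circleMap c R θ))
    (F' := fun τ θ => deriv (circleMap c R) θ • Ψ' τ (circleMap c R θ))
    (x₀ := τ₀) (s := closedBall τ₀ ε) (bound := fun _ => R * C)
    (closedBall_mem_nhds τ₀ hε)
    (by
      filter_upwards [hO.mem_nhds hτ₀] with τ hτ using (hslice Ψ hΨ τ hτ).aestronglyMeasurable)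
    ((hslice Ψ hΨ τ₀ hτ₀).intervalIntegrable _ _)
    (hslice Ψ' hΨ' τ₀ hτ₀).aestronglyMeasurable
    (by
      refine Filter.Eventually.of_forall fun θ _ τ hτ => ?_
      rw [norm_smul]
      have h1 : ‖deriv (circleMap c R) θ‖ = R := by
        simp [deriv_circleMap, abs_of_pos hR]
      rw [h1]
      exact mul_le_mul_of_nonneg_left (hC (τ, circleMap c R θ) ⟨hτ, hm θ⟩) hR.le)
    intervalIntegrable_const
    (by
      refine Filter.Eventually.of_forall fun θ _ τ hτ => ?_
      exact HasDerivAt.const_smul (deriv (circleMap c R) θ) (hd τ (hεO hτ) _ (hm θ)))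
  exact key.2.differentiableAt.differentiableWithinAt

/-! ### Zeros on a line parallel to a coordinate axis -/

open MvPolynomial in
/-- The restriction of the polynomial `F` to the line through `z` parallel to the `i`-th axis. -/
def linePoly {σ : Type*} [DecidableEq σ] (F : MvPolynomial σ ℂ) (i : σ) (z : σ → ℂ) :
    Polynomial ℂ :=
  aeval (Function.update (fun k => Polynomial.C (z k)) i Polynomial.X) F

open MvPolynomial in
theorem eval_linePoly {σ : Type*} [DecidableEq σ] (F : MvPolynomial σ ℂ) (i : σ) (z : σ → ℂ)
    (c : ℂ) : (linePoly F i z).eval c = eval (Function.update z i c) F := by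
  rw [linePoly]
  induction F using MvPolynomial.induction_on with
  | C a => simp
  | add p q hp hq => simp only [map_add, Polynomial.eval_add, hp, hq]
  | mul_X p k hp =>
    simp only [map_mul, Polynomial.eval_mul, hp, aeval_X, eval_X]
    congr 1
    by_cases hk : k = i
    · subst hk; simp
    · simp [hk]

open MvPolynomial in
theorem derivative_linePoly {σ : Type*} [DecidableEq σ] (F : MvPolynomial σ ℂ) (i : σ)
    (z : σ → ℂ) : (linePoly F i z).derivative = linePoly (pderiv i F) i z := by
  simp only [linePoly]
  induction F using MvPolynomial.induction_on with
  | C a => simp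
  | add p q hp hq => simp only [map_add, hp, hq]
  | mul_X p k hp =>
    simp only [map_mul, Polynomial.derivative_mul, hp, aeval_X, pderiv_mul, map_add]
    congr 2
    by_cases hk : k = i
    · subst hk; simp
    · simp [hk, pderiv_X_of_ne hk]

open Classical in
/-- The sum of the values of `h` at the zeros of `F` in the disc of centre `c` and radius `R` of
the line through `z` parallel to the `i`-th axis. -/
def rootSum {σ : Type*} [DecidableEq σ] (F : MvPolynomial σ ℂ) (i : σ) (c : ℂ) (R : ℝ) (h : ℂ → ℂ)
    (z : σ → ℂ) : ℂ :=
  (((linePoly F i z).roots.filter (· ∈ Metric.ball c R)).map h).sum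

open Complex Metric Set MvPolynomial in
theorem differentiableOn_rootSum {σ : Type*} [Fintype σ] [DecidableEq σ] (F : MvPolynomial σ ℂ)
    (i : σ) {c : ℂ} {R : ℝ} (hR : 0 < R) {h : ℂ → ℂ} (hh : Differentiable ℂ h) (z v : σ → ℂ)
    {O : Set ℂ} (hO : IsOpen O)
    (hF : ∀ τ ∈ O, ∀ w ∈ sphere c R, eval (Function.update (z + τ • v) i w) F ≠ 0) :
    DifferentiableOn ℂ (fun τ => rootSum F i c R h (z + τ • v)) O := by
  let y : ℂ → ℂ → σ → ℂ := fun τ w => Function.update (z + τ • v) i w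
  have hy : Continuous fun x : ℂ × ℂ => y x.1 x.2 :=
    (continuous_const.add (continuous_fst.smul continuous_const)).update i continuous_snd
  have hy' : ∀ τ w, HasDerivAt (fun τ => y τ w) (Function.update v i 0) τ := by
    intro τ w
    rw [hasDerivAt_pi]
    intro k
    by_cases hk : k = i
    · subst hk
      simpa [y] using hasDerivAt_const τ w
    · have : HasDerivAt (fun τ : ℂ => z k + τ * v k) (v k) τ := by
        simpa using ((hasDerivAt_id τ).mul_const (v k)).const_add (z k)
      simpa [y, hk] using this
  have hQ : ∀ (Q : MvPolynomial σ ℂ) (τ w), HasDerivAt (fun τ => eval (y τ w) Q)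
      (dPoly Q (y τ w) (Function.update v i 0)) τ := fun Q τ w =>
    HasFDerivAt.comp_hasDerivAt (f := fun τ => y τ w) (l := fun x => eval x Q) τ
      (hasStrictFDerivAt_eval Q (y τ w)).hasFDerivAt (hy' τ w)
  have hQc : ∀ Q : MvPolynomial σ ℂ, Continuous fun x : ℂ × ℂ => eval (y x.1 x.2) Q := fun Q =>
    (contDiff_eval Q (m := 0)).continuous.comp hy
  have hQc' : ∀ Q : MvPolynomial σ ℂ,
      Continuous fun x : ℂ × ℂ => dPoly Q (y x.1 x.2) (Function.update v i 0) := by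
    intro Q
    simp only [dPoly_apply]
    exact continuous_finsetSum _ fun k _ => (hQc _).mul continuous_const
  have hne : ∀ x ∈ O ×ˢ sphere c R, eval (y x.1 x.2) F ≠ 0 := fun x hx => hF _ hx.1 _ hx.2
  have hint := differentiableOn_circleIntegral hO hR
    (Ψ := fun τ w => h w * (eval (y τ w) (pderiv i F) / eval (y τ w) F))
    (Ψ' := fun τ w => h w * ((dPoly (pderiv i F) (y τ w) (Function.update v i 0) * eval (y τ w) F -
      eval (y τ w) (pderiv i F) * dPoly F (y τ w) (Function.update v i 0)) / eval (y τ w) F ^ 2))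
    (fun τ hτ w hw => ((hQ (pderiv i F) τ w).div (hQ F τ w) (hF τ hτ w hw)).const_mul (h w))
    ((hh.continuous.comp continuous_snd).continuousOn.mul
      ((hQc _).continuousOn.div (hQc _).continuousOn hne))
    ((hh.continuous.comp continuous_snd).continuousOn.mul
      ((((hQc' _).mul (hQc _)).sub ((hQc _).mul (hQc' _))).continuousOn.div
        ((hQc _).pow 2).continuousOn fun x hx => pow_ne_zero 2 (hne x hx)))
  refine (hint.const_smul (2 * Real.pi * I : ℂ)⁻¹).congr fun τ hτ => ?_
  have h1 := circleIntegral_derivative_div hh (c := c) hR (f := linePoly F i (z + τ • v))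
    fun w hw => by rw [eval_linePoly]; exact hF τ hτ w hw
  simp only [derivative_linePoly, eval_linePoly] at h1
  simp only [Pi.smul_apply, smul_eq_mul, y, h1, rootSum]
  rw [inv_mul_cancel_left₀ Complex.two_pi_I_ne_zero]

/-- For two multisets of numbers, the sum of `(α - β)²` over all pairs in terms of power sums. -/
theorem sum_sum_sub_sq (s t : Multiset ℂ) :
    (s.map fun α => (t.map fun β => (α - β) ^ 2).sum).sum =
      (t.map fun _ => (1 : ℂ)).sum * (s.map fun α => α ^ 2).sum -
        2 * (s.map fun α => α).sum * (t.map fun β => β).sum +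
        (s.map fun _ => (1 : ℂ)).sum * (t.map fun β => β ^ 2).sum := by
  have h : ∀ α : ℂ, (t.map fun β => (α - β) ^ 2).sum = (t.map fun _ => (1 : ℂ)).sum * α ^ 2 -
      2 * α * (t.map fun β => β).sum + (t.map fun β => β ^ 2).sum := by
    intro α
    induction t using Multiset.induction_on with
    | empty => simp
    | cons b t ih =>
      simp only [Multiset.map_cons, Multiset.sum_cons, ih]
      ring
  simp only [h]
  induction s using Multiset.induction_on with
  | empty => simp
  | cons a s ih =>
    simp only [Multiset.map_cons, Multiset.sum_cons] at ih ⊢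
    rw [ih]
    ring

/-- A sum of terms with nonpositive real parts has real part zero only if every term has. -/
theorem eq_of_sum_sum_re_eq_zero {s t : Multiset ℂ} {κ : ℂ}
    (hle : ∀ α ∈ s, ∀ β ∈ t, ((κ * (α - β)) ^ 2).re ≤ 0)
    (heq : ∀ α ∈ s, ∀ β ∈ t, ((κ * (α - β)) ^ 2).re = 0 → α = β) :
    (κ ^ 2 * (s.map fun α => (t.map fun β => (α - β) ^ 2).sum).sum).re ≤ 0 ∧
    ((κ ^ 2 * (s.map fun α => (t.map fun β => (α - β) ^ 2).sum).sum).re = 0 →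
      ∀ α ∈ s, ∀ β ∈ t, α = β) := by
  have hinner : ∀ α : ℂ, ∀ t : Multiset ℂ, (∀ β ∈ t, ((κ * (α - β)) ^ 2).re ≤ 0) →
      (∀ β ∈ t, ((κ * (α - β)) ^ 2).re = 0 → α = β) →
      (κ ^ 2 * (t.map fun β => (α - β) ^ 2).sum).re ≤ 0 ∧
      ((κ ^ 2 * (t.map fun β => (α - β) ^ 2).sum).re = 0 → ∀ β ∈ t, α = β) := by
    intro α t
    induction t using Multiset.induction_on with
    | empty => simp
    | cons b t ih =>
      intro h1 h2
      obtain ⟨h3, h4⟩ := ih (fun β hβ => h1 β (Multiset.mem_cons_of_mem hβ))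
        (fun β hβ => h2 β (Multiset.mem_cons_of_mem hβ))
      have h5 := h1 b (Multiset.mem_cons_self b t)
      have h6 := h2 b (Multiset.mem_cons_self b t)
      rw [mul_pow] at h5 h6
      rw [Multiset.map_cons, Multiset.sum_cons, mul_add, Complex.add_re]
      refine ⟨by linarith, fun h7 β hβ => ?_⟩
      rcases Multiset.mem_cons.1 hβ with rfl | hβ
      · exact h6 (by linarith)
      · exact h4 (by linarith) β hβ
  induction s using Multiset.induction_on with
  | empty => simp
  | cons a s ih =>
    obtain ⟨h3, h4⟩ := ih (fun α hα => hle α (Multiset.mem_cons_of_mem hα))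
      (fun α hα => heq α (Multiset.mem_cons_of_mem hα))
    obtain ⟨h5, h6⟩ := hinner a t (hle a (Multiset.mem_cons_self a s))
      (heq a (Multiset.mem_cons_self a s))
    rw [Multiset.map_cons, Multiset.sum_cons, mul_add, Complex.add_re]
    refine ⟨by linarith, fun h7 α hα => ?_⟩
    rcases Multiset.mem_cons.1 hα with rfl | hα
    · exact h6 (by linarith)
    · exact h4 (by linarith) α hα

/-! ### Complex hypersurfaces in a smooth real hypersurface -/

open Filter Topology in
/-- A real function with nonzero differential at `p` is, on the complex lines parallel to a suitable
axis, close to the real part of a complex linear function: on its zero set the numbers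
`(κ (α - β))²` have negative real part. -/
theorem exists_axis_sq_re_neg {σ : Type*} [Fintype σ] [DecidableEq σ] {r : (σ → ℂ) → ℝ}
    {L : (σ → ℂ) →L[ℝ] ℝ} {p : σ → ℂ} (hr : HasStrictFDerivAt r L p) (hL : L ≠ 0) :
    ∃ (i : σ) (κ : ℂ), κ ≠ 0 ∧ ∃ δ > 0, ∀ (z : σ → ℂ) (α β : ℂ),
      Function.update z i α ∈ Metric.ball p δ → Function.update z i β ∈ Metric.ball p δ →
      r (Function.update z i α) = 0 → r (Function.update z i β) = 0 →
      ((κ * (α - β)) ^ 2).re ≤ 0 ∧ (((κ * (α - β)) ^ 2).re = 0 → α = β) := by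
  obtain ⟨i, c, hc⟩ : ∃ i c, L (Pi.single i c) ≠ 0 := by
    by_contra! h
    refine hL (ContinuousLinearMap.ext fun v => ?_)
    rw [← Finset.univ_sum_single v, map_sum]
    simp [h]
  let κ : ℂ := ⟨L (Pi.single i 1), -L (Pi.single i Complex.I)⟩
  have hκ : ∀ w : ℂ, L (Pi.single i w) = (κ * w).re := by
    intro w
    have h1 : (Pi.single i w : σ → ℂ) =
        w.re • (Pi.single i 1 : σ → ℂ) + w.im • (Pi.single i Complex.I : σ → ℂ) := by
      rw [← Pi.single_smul, ← Pi.single_smul, ← Pi.single_add]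
      congr 1
      apply Complex.ext <;> simp
    rw [h1, map_add, map_smul, map_smul]
    simp [κ]
    ring
  have hκ0 : κ ≠ 0 := by
    intro h0
    apply hc
    rw [hκ, h0, zero_mul, Complex.zero_re]
  refine ⟨i, κ, hκ0, ?_⟩
  have hκn : 0 < ‖κ‖ := norm_pos_iff.2 hκ0
  have hlo := hr.isLittleO.def (half_pos hκn)
  obtain ⟨δ, hδ, hb⟩ := Metric.eventually_nhds_iff_ball.1 hlo
  refine ⟨δ, hδ, fun z α β hα hβ hrα hrβ => ?_⟩
  have h1 := hb (Function.update z i α, Function.update z i β) (by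
    rw [← ball_prod_same]; exact ⟨hα, hβ⟩)
  have h2 : Function.update z i α - Function.update z i β = Pi.single i (α - β) := by
    ext k
    by_cases hk : k = i
    · subst hk; simp
    · simp [hk]
  simp only [hrα, hrβ, h2, hκ, sub_self, zero_sub, norm_neg, Pi.norm_single] at h1
  set d := κ * (α - β) with hd
  have h3 : ‖d‖ = ‖κ‖ * ‖α - β‖ := norm_mul _ _
  have h4 : |d.re| ≤ ‖d‖ / 2 := by
    rw [Real.norm_eq_abs] at h1
    rw [h3]
    linarith
  have h5 : ‖d‖ ^ 2 = d.re ^ 2 + d.im ^ 2 := by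
    rw [Complex.sq_norm, Complex.normSq_apply]; ring
  have h6 : (d ^ 2).re = d.re ^ 2 - d.im ^ 2 := by
    rw [sq, Complex.mul_re]; ring
  have h7 : d.re ^ 2 ≤ ‖d‖ ^ 2 / 4 := by
    have := sq_le_sq' (by linarith [abs_nonneg d.re, norm_nonneg d]) h4
    rw [sq_abs] at this
    linarith
  refine ⟨by rw [h6]; nlinarith [sq_nonneg ‖d‖], fun h8 => ?_⟩
  have h9 : ‖d‖ ^ 2 = 0 := by
    rw [h6] at h8
    nlinarith [sq_nonneg ‖d‖]
  have h10 : d = 0 := norm_eq_zero.1 (pow_eq_zero_iff two_ne_zero |>.1 h9)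
  exact sub_eq_zero.1 ((mul_eq_zero.1 h10).resolve_left hκ0)

open Filter Topology MvPolynomial in
/-- Let `p` be a common zero of the polynomials `F₁` and `F₂` whose zero sets are contained, near
`p`, in a smooth real hypersurface `{r = 0}`. Then the zeros of `F₁` and of `F₂` near `p` on lines
parallel to a suitable axis coincide. -/
theorem exists_axis_common_zeros {σ : Type*} [Fintype σ] [DecidableEq σ] {r : (σ → ℂ) → ℝ}
    {L : (σ → ℂ) →L[ℝ] ℝ} {p : σ → ℂ} (hr : HasStrictFDerivAt r L p) (hL : L ≠ 0)
    (F : Fin 2 → MvPolynomial σ ℂ) (hFp : ∀ k, eval p (F k) = 0)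
    (hF : ∀ k, ∀ᶠ z in 𝓝 p, eval z (F k) = 0 → r z = 0) :
    ∃ i, ∀ᶠ z in 𝓝 p, ∃ c, eval (Function.update z i c) (F 0) = 0 ∧
      eval (Function.update z i c) (F 1) = 0 := by
  obtain ⟨i, κ, hκ, δ₀, hδ₀, hsq⟩ := exists_axis_sq_re_neg hr hL
  obtain ⟨δ₁, hδ₁, hF'⟩ := Metric.eventually_nhds_iff_ball.1 (eventually_all.2 hF)
  obtain ⟨δ, hδ, hδδ₀, hδδ₁⟩ : ∃ δ > 0, δ ≤ δ₀ ∧ δ ≤ δ₁ :=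
    ⟨min δ₀ δ₁, lt_min hδ₀ hδ₁, min_le_left _ _, min_le_right _ _⟩
  have hupd : ∀ z ∈ Metric.ball p δ, ∀ c ∈ Metric.ball (p i) δ,
      Function.update z i c ∈ Metric.ball p δ := by
    intro z hz c hc
    rw [ball_pi _ hδ] at hz ⊢
    intro k _
    by_cases hk : k = i
    · subst hk; simpa using hc
    · simpa [hk] using hz k trivial
  -- differences of zeros on one line near `p`
  have hdiff : ∀ z ∈ Metric.ball p δ, ∀ (k l : Fin 2) (α β : ℂ), α ∈ Metric.ball (p i) δ →
      β ∈ Metric.ball (p i) δ → eval (Function.update z i α) (F k) = 0 →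
      eval (Function.update z i β) (F l) = 0 →
      ((κ * (α - β)) ^ 2).re ≤ 0 ∧ (((κ * (α - β)) ^ 2).re = 0 → α = β) := by
    intro z hz k l α β hα hβ h1 h2
    have hα' := hupd z hz α hα
    have hβ' := hupd z hz β hβ
    exact hsq z α β (Metric.ball_subset_ball hδδ₀ hα') (Metric.ball_subset_ball hδδ₀ hβ')
      (hF' _ (Metric.ball_subset_ball hδδ₁ hα') k h1)
      (hF' _ (Metric.ball_subset_ball hδδ₁ hβ') l h2)
  have hpδ : p ∈ Metric.ball p δ := Metric.mem_ball_self hδ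
  -- `F k` does not vanish identically on the line through `p`
  have hline : ∀ k, linePoly (F k) i p ≠ 0 := by
    intro k h0
    have hz : ∀ c, eval (Function.update p i c) (F k) = 0 := fun c => by
      rw [← eval_linePoly, h0, Polynomial.eval_zero]
    let t : ℂ := ((δ / 2 : ℝ) : ℂ) * (star κ / ‖κ‖)
    have hκn : (‖κ‖ : ℂ) ≠ 0 := by exact_mod_cast norm_ne_zero_iff.2 hκ
    have htn : ‖t‖ = δ / 2 := by
      rw [norm_mul, norm_div, norm_star, Complex.norm_real, Complex.norm_real, norm_norm]
      rw [div_self (norm_ne_zero_iff.2 hκ), mul_one]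
      exact Real.norm_of_nonneg (half_pos hδ).le
    have h1 := (hdiff p hpδ k k (p i + t) (p i) (by
      rw [Metric.mem_ball, dist_eq_norm, add_sub_cancel_left, htn]; linarith)
      (Metric.mem_ball_self hδ) (hz _) (hz _)).1
    have h2 : κ * (p i + t - p i) = ((δ / 2 * ‖κ‖ : ℝ) : ℂ) := by
      have h3 : κ * star κ = (‖κ‖ : ℂ) ^ 2 := Complex.mul_conj' κ
      simp only [t, add_sub_cancel_left]
      push_cast
      field_simp
      linear_combination (δ : ℂ) * h3
    rw [h2, ← Complex.ofReal_pow, Complex.ofReal_re] at h1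
    have h4 : 0 < δ / 2 * ‖κ‖ := mul_pos (half_pos hδ) (norm_pos_iff.2 hκ)
    nlinarith
  -- a circle around `p i` that separates `p i` from the other zeros
  obtain ⟨R, hR, hRδ, hroots⟩ : ∃ R > 0, R < δ ∧
      ∀ k, ∀ c ∈ Metric.closedBall (p i) R, eval (Function.update p i c) (F k) = 0 → c = p i := by
    have h1 : ∀ᶠ c in 𝓝 (p i), ∀ k, (linePoly (F k) i p).eval c = 0 → c = p i := by
      refine eventually_all.2 fun k => ?_
      have hfin : ((linePoly (F k) i p).rootSet ℂ \ {p i}).Finite :=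
        (Polynomial.rootSet_finite _ ℂ).sdiff
      filter_upwards [hfin.isClosed.isOpen_compl.mem_nhds (by simp)] with c hc h0
      by_contra hne
      exact hc ⟨by simpa [Polynomial.mem_rootSet, hline k] using h0, hne⟩
    obtain ⟨R, hR, hb⟩ := Metric.nhds_basis_closedBall.mem_iff.1 h1
    refine ⟨min R (δ / 2), lt_min hR (half_pos hδ), (min_le_right _ _).trans_lt (by linarith),
      fun k c hc h0 => hb (Metric.closedBall_subset_closedBall (min_le_left _ _) hc) k ?_⟩
    rwa [eval_linePoly]
  have hnear : ∀ᶠ z in 𝓝 p, ∀ c ∈ Metric.sphere (p i) R, ∀ k,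
      eval (Function.update z i c) (F k) ≠ 0 := by
    refine (isCompact_sphere (p i) R).eventually_forall_of_forall_eventually fun c hc => ?_
    refine eventually_all.2 fun k => ?_
    have hcont : Continuous fun x : (σ → ℂ) × ℂ => eval (Function.update x.1 i x.2) (F k) :=
      (contDiff_eval (F k) (m := 0)).continuous.comp (continuous_fst.update i continuous_snd)
    refine hcont.continuousAt.eventually_ne fun h0 => ?_
    have h1 := hroots k c (Metric.sphere_subset_closedBall hc) h0
    rw [Metric.mem_sphere, h1, dist_self] at hc
    exact hR.ne hc
  obtain ⟨η₀, hη₀, hcirc⟩ := Metric.eventually_nhds_iff_ball.1 hnear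
  obtain ⟨η, hη, hηη₀, hηδ⟩ : ∃ η > 0, η ≤ η₀ ∧ η ≤ δ :=
    ⟨min η₀ δ, lt_min hη₀ hδ, min_le_left _ _, min_le_right _ _⟩
  refine ⟨i, Metric.eventually_nhds_iff_ball.2 ⟨η / 2, half_pos hη, fun z hz => ?_⟩⟩
  let v : σ → ℂ := z - p
  have hv : ∀ τ ∈ Metric.ball (0 : ℂ) 2, p + τ • v ∈ Metric.ball p η := by
    intro τ hτ
    rw [mem_ball_zero_iff] at hτ
    rw [Metric.mem_ball, dist_eq_norm] at hz
    rw [Metric.mem_ball, dist_eq_norm, add_sub_cancel_left, norm_smul]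
    have : ‖v‖ < η / 2 := hz
    nlinarith [norm_nonneg v, norm_nonneg τ]
  have hhol : ∀ k (h : ℂ → ℂ), Differentiable ℂ h →
      DifferentiableOn ℂ (fun τ : ℂ => rootSum (F k) i (p i) R h (p + τ • v)) (Metric.ball 0 2) :=
    fun k h hh => differentiableOn_rootSum (F k) i hR hh p v Metric.isOpen_ball
      fun τ hτ w hw => hcirc _ (Metric.ball_subset_ball hηη₀ (hv τ hτ)) w hw k
  classical
  let Z : Fin 2 → ℂ → Multiset ℂ := fun k τ =>
    (linePoly (F k) i (p + τ • v)).roots.filter (· ∈ Metric.ball (p i) R)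
  have hZ : ∀ k τ, ∀ α ∈ Z k τ, α ∈ Metric.ball (p i) R ∧
      eval (Function.update (p + τ • v) i α) (F k) = 0 := by
    intro k τ α hα
    obtain ⟨h1, h2⟩ := Multiset.mem_filter.1 hα
    exact ⟨h2, by rw [← eval_linePoly]; exact Polynomial.isRoot_of_mem_roots h1⟩
  let S : ℂ → ℂ := fun τ => κ ^ 2 * ((Z 0 τ).map fun α => ((Z 1 τ).map fun β => (α - β) ^ 2).sum).sum
  have hS : DifferentiableOn ℂ S (Metric.ball 0 2) := by
    have h1 : S = fun τ => κ ^ 2 * (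
        rootSum (F 1) i (p i) R (fun _ => 1) (p + τ • v) *
          rootSum (F 0) i (p i) R (fun α => α ^ 2) (p + τ • v) -
        2 * rootSum (F 0) i (p i) R (fun α => α) (p + τ • v) *
          rootSum (F 1) i (p i) R (fun α => α) (p + τ • v) +
        rootSum (F 0) i (p i) R (fun _ => 1) (p + τ • v) *
          rootSum (F 1) i (p i) R (fun α => α ^ 2) (p + τ • v)) := by
      funext τ
      simp only [S, sum_sum_sub_sq]
      rfl
    rw [h1]
    have d1 := fun k => hhol k (fun _ => 1) (differentiable_const _)
    have d2 := fun k => hhol k (fun α => α) differentiable_id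
    have d3 := fun k => hhol k (fun α => α ^ 2) (differentiable_id.pow 2)
    exact ((((d1 1).mul (d3 0)).sub (((d2 0).const_mul 2).mul (d2 1))).add
      ((d1 0).mul (d3 1))).const_mul _
  have hSre : ∀ τ ∈ Metric.ball (0 : ℂ) 2, (S τ).re ≤ 0 ∧
      ((S τ).re = 0 → ∀ α ∈ Z 0 τ, ∀ β ∈ Z 1 τ, α = β) := by
    intro τ hτ
    have h1 : ∀ α ∈ Z 0 τ, ∀ β ∈ Z 1 τ, _ := fun α hα β hβ =>
      hdiff _ (Metric.ball_subset_ball hηδ (hv τ hτ)) 0 1 α β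
        (Metric.ball_subset_ball hRδ.le (hZ 0 τ α hα).1)
        (Metric.ball_subset_ball hRδ.le (hZ 1 τ β hβ).1) (hZ 0 τ α hα).2 (hZ 1 τ β hβ).2
    exact eq_of_sum_sum_re_eq_zero (fun α hα β hβ => (h1 α hα β hβ).1)
      (fun α hα β hβ => (h1 α hα β hβ).2)
  have hZ0 : ∀ k, ∀ α ∈ Z k 0, α = p i := by
    intro k α hα
    have := hZ k 0 α hα
    rw [zero_smul, add_zero] at this
    exact hroots k α (Metric.ball_subset_closedBall this.1) this.2
  have hS0 : S 0 = 0 := by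
    have h1 : ((Z 0 0).map fun α => ((Z 1 0).map fun β => (α - β) ^ 2).sum).sum = 0 := by
      refine Multiset.sum_eq_zero fun x hx => ?_
      obtain ⟨α, hα, rfl⟩ := Multiset.mem_map.1 hx
      refine Multiset.sum_eq_zero fun y hy => ?_
      obtain ⟨β, hβ, rfl⟩ := Multiset.mem_map.1 hy
      rw [hZ0 0 α hα, hZ0 1 β hβ, sub_self, zero_pow two_ne_zero]
    simp only [S, h1, mul_zero]
  have h0mem : (0 : ℂ) ∈ Metric.ball (0 : ℂ) 2 := Metric.mem_ball_self two_pos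
  have h1mem : (1 : ℂ) ∈ Metric.ball (0 : ℂ) 2 := by simp
  have hpre : IsPreconnected (Metric.ball (0 : ℂ) 2) := (convex_ball _ _).isPreconnected
  -- `exp S` has modulus at most `1`, with equality at `0`
  have hS1 : (S 1).re = 0 := by
    have hmax : IsMaxOn (norm ∘ fun τ => Complex.exp (S τ)) (Metric.ball 0 2) 0 := by
      intro τ hτ
      simp only [Function.comp_apply, Complex.norm_exp, hS0, Complex.zero_re, Set.mem_ofPred_eq]
      exact Real.exp_le_exp.2 (hSre τ hτ).1
    have h1 := Complex.norm_eqOn_of_isPreconnected_of_isMaxOn hpre Metric.isOpen_ball hS.cexp h0mem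
      hmax h1mem
    simp only [Function.comp_apply, Complex.norm_exp, hS0, Complex.zero_re, Function.const_apply]
      at h1
    exact Real.exp_injective h1
  have hcard : ∀ k, Multiset.card (Z k 1) = Multiset.card (Z k 0) := by
    intro k
    have h1 : ∀ τ : ℂ, rootSum (F k) i (p i) R (fun _ => 1) (p + τ • v) = (Multiset.card (Z k τ) : ℂ) := by
      intro τ
      simp [rootSum, Z]
    have h2 : ContinuousOn (fun τ => Multiset.card (Z k τ)) (Metric.ball 0 2) := by
      have h3 := (hhol k (fun _ => 1) (differentiable_const _)).continuousOn
      simp only [h1] at h3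
      rw [Nat.isClosedEmbedding_coe_real.isEmbedding.continuousOn_iff]
      refine (Complex.continuous_re.comp_continuousOn h3).congr fun τ _ => ?_
      simp only [Function.comp_apply, Complex.natCast_re]
    exact hpre.constant h2 h1mem h0mem
  have hne : ∀ k, ∃ α, α ∈ Z k 1 := by
    intro k
    rw [← Multiset.card_pos_iff_exists_mem, hcard, Multiset.card_pos_iff_exists_mem]
    refine ⟨p i, Multiset.mem_filter.2 ⟨?_, Metric.mem_ball_self hR⟩⟩
    rw [zero_smul, add_zero, Polynomial.mem_roots (hline k), Polynomial.IsRoot.def, eval_linePoly,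
      Function.update_eq_self, hFp]
  obtain ⟨α, hα⟩ := hne 0
  obtain ⟨β, hβ⟩ := hne 1
  have hαβ := (hSre 1 h1mem).2 hS1 α hα β hβ
  have hz1 : p + (1 : ℂ) • v = z := by simp [v]
  have e1 := (hZ 0 1 α hα).2
  have e2 := (hZ 1 1 β hβ).2
  rw [hz1] at e1 e2
  exact ⟨α, e1, by rw [hαβ]; exact e2⟩

/-! ### Affine charts of a real-algebraic cone -/

section Charts
variable {n : ℕ}

open MvPolynomial in
/-- A real-algebraic set in terms of polynomials in `z` and `z̄`. -/
theorem IsRealAlgebraic.exists_cpoly {m : ℕ} {V : Set (CSpace m)} (hV : IsRealAlgebraic V) :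
    ∃ J : Set (CPoly m), ∀ z, z ∈ V ↔ ∀ P ∈ J, ev P z (star z) = 0 := by
  obtain ⟨I, rfl⟩ := hV
  refine ⟨(fun P => (realCoords m).symm (map (algebraMap ℝ ℂ) P)) '' I, fun z => ?_⟩
  simp only [Set.mem_ofPred_eq, Set.forall_mem_image]
  refine forall₂_congr fun P _ => ?_
  set x : Fin m ⊕ Fin m → ℝ := Sum.elim (fun i => (z i).re) (fun i => (z i).im) with hx
  have h := eval_realCoords_ofReal ((realCoords m).symm (map (algebraMap ℝ ℂ) P)) x
  rw [ofRealCoords_re_im z, AlgEquiv.apply_symm_apply, eval_map] at h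
  have h2 : eval₂ (algebraMap ℝ ℂ) (fun j => (x j : ℂ)) P = ((eval x P : ℝ) : ℂ) := by
    have := eval₂_comp_left (algebraMap ℝ ℂ) (RingHom.id ℝ) x P
    simp only [RingHom.comp_id] at this
    exact this.symm
  rw [← h, h2, Complex.ofReal_eq_zero]

/-- The point `(w₀, …, 1, …, wₙ₋₁)` of `ℂⁿ⁺¹` with the `1` at place `j`. -/
abbrev ins (j : Fin (n + 1)) (w : CSpace n) : CSpace (n + 1) := Fin.insertNth j (1 : ℂ) w

theorem eq_smul_ins (j : Fin (n + 1)) {Z : CSpace (n + 1)} (hZ : Z j ≠ 0) :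
    Z = Z j • ins j (fun a => Z (j.succAbove a) / Z j) := by
  ext k
  refine Fin.succAboveCases j ?_ (fun a => ?_) k
  · simp
  · simp; field_simp

theorem affineChart_injective (j : Fin (n + 1)) : Function.Injective (affineChart (n := n) j) := by
  intro w w' h
  obtain ⟨a, ha⟩ := (Projectivization.mk_eq_mk_iff' ℂ _ _ _ _).1 h
  have h1 : a = 1 := by simpa using congrFun ha j
  ext b
  have := congrFun ha (j.succAbove b)
  simpa [h1] using this.symm

theorem affineChart_mem_projImage {V : Set (CSpace (n + 1))} (hV : IsComplexCone V)
    (j : Fin (n + 1)) (w : CSpace n) : affineChart j w ∈ projImage V ↔ ins j w ∈ V := by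
  refine ⟨?_, fun h => ⟨_, insertNth_one_ne_zero j w, h, rfl⟩⟩
  rintro ⟨z, hz, hzV, h⟩
  obtain ⟨a, ha⟩ := (Projectivization.mk_eq_mk_iff' ℂ _ _ _ _).1 h.symm
  rw [ins, ← ha]
  exact hV z hzV a

open MvPolynomial in
/-- The polynomial `P(c · (z, 1), d · (ζ, 1))`, where the `1` is inserted at place `j`. -/
def chartPoly (j : Fin (n + 1)) (c d : ℂ) (P : CPoly (n + 1)) : CPoly n :=
  aeval (Sum.elim (fun k => C c * (Fin.insertNth j 1 (fun a => X (Sum.inl a)) : Fin (n + 1) → CPoly n) k)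
    (fun k => C d * (Fin.insertNth j 1 (fun a => X (Sum.inr a)) : Fin (n + 1) → CPoly n) k)) P

open MvPolynomial in
theorem ev_chartPoly (j : Fin (n + 1)) (c d : ℂ) (P : CPoly (n + 1)) (z ζ : CSpace n) :
    ev (chartPoly j c d P) z ζ = ev P (c • ins j z) (d • ins j ζ) := by
  rw [ev, chartPoly, eval_aeval_mvPolynomial, ev]
  congr 2
  funext k
  rcases k with k | k <;> refine Fin.succAboveCases j ?_ (fun a => ?_) k <;> simp

/-! ### Dimension -/

theorem le_realDim {X : Set (CProj n)} {k : ℕ} (h : ContainsSubmanifold k X) :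
    (k : ℤ) ≤ realDim X :=
  le_csSup (realDim_bddAbove X) (Set.mem_insert_of_mem _ ⟨k, rfl, h⟩)

theorem neg_one_le_realDim (X : Set (CProj n)) : -1 ≤ realDim X :=
  le_csSup (realDim_bddAbove X) (Set.mem_insert _ _)

/-- The supremum in the definition of `realDim` is attained. -/
theorem containsSubmanifold_of_realDim {X : Set (CProj n)} {k : ℕ} (h : realDim X = k) :
    ContainsSubmanifold k X := by
  have h1 := Int.csSup_mem (Set.insert_nonempty _ _) (realDim_bddAbove X)
  change realDim X ∈ _ at h1
  rw [h] at h1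
  rcases h1 with h1 | ⟨l, hl, hX⟩
  · lia
  · rwa [show k = l by lia]

theorem ContainsSubmanifold.mono {X Y : Set (CProj n)} {k : ℕ} (h : ContainsSubmanifold k X)
    (hXY : X ⊆ Y) : ContainsSubmanifold k Y := by
  obtain ⟨M, hM, h1⟩ := h
  exact ⟨M, hM.trans hXY, h1⟩

theorem ContainsSubmanifold.le {X : Set (CProj n)} {k : ℕ} (h : ContainsSubmanifold k X) :
    k ≤ 2 * n := by
  obtain ⟨M, -, ⟨p, hp⟩, hM⟩ := h
  obtain ⟨j, w, -, -, l, U, f, hk, -⟩ := hM p hp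
  lia

theorem containsSubmanifold_of_isOpen {X : Set (CProj n)} (j : Fin (n + 1)) {U : Set (CSpace n)}
    (hU : IsOpen U) (hne : U.Nonempty) (h : ∀ w ∈ U, affineChart j w ∈ X) :
    ContainsSubmanifold (2 * n) X := by
  refine ⟨affineChart j '' U, Set.image_subset_iff.2 h, hne.image _, ?_⟩
  rintro _ ⟨w, hw, rfl⟩
  refine ⟨j, w, rfl, ?_⟩
  rw [Set.preimage_image_eq _ (affineChart_injective j)]
  refine ⟨hw, 0, U, fun _ => 0, by lia, hU, hw, contDiffOn_const, fun x _ y => ⟨0, ?_⟩, fun x hx => ?_⟩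
  · exact Subsingleton.elim _ _
  · simp [hx]

theorem isSubmanifoldNear_of_contDiff {d : ℕ} (hd : d + 1 = 2 * n) {S U : Set (CSpace n)}
    {r : CSpace n → ℝ} (hr : ContDiff ℝ ∞ r) (hU : IsOpen U) (hr' : ∀ x ∈ U, fderiv ℝ r x ≠ 0)
    (h : ∀ x ∈ U, x ∈ S ↔ r x = 0) {w : CSpace n} (hw : w ∈ U) (hw0 : r w = 0) :
    IsSubmanifoldNear d S w := by
  refine ⟨(h w hw).2 hw0, 1, U, fun x _ => r x, hd, hU, hw,
    (contDiff_pi.2 fun _ => hr).contDiffOn, fun x hx => ?_, fun x hx => ?_⟩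
  · have h1 : fderiv ℝ (fun x (_ : Fin 1) => r x) x = ContinuousLinearMap.pi fun _ => fderiv ℝ r x :=
      fderiv_pi fun _ => hr.differentiable (by simp) x
    rw [h1]
    obtain ⟨v, hv⟩ : ∃ v, fderiv ℝ r x v ≠ 0 := by
      by_contra! h0
      exact hr' x hx.1 (ContinuousLinearMap.ext h0)
    intro y
    refine ⟨(y 0 / fderiv ℝ r x v) • v, ?_⟩
    ext i
    rw [ContinuousLinearMap.pi_apply, map_smul, smul_eq_mul, div_mul_cancel₀ _ hv,
      Subsingleton.elim i 0]
  · rw [h x hx, funext_iff]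
    simp

open MvPolynomial in
/-- If a set is given by `g(z, z̄) = 0` near a point at which the differential of `g` does not
vanish, the real function `Re g(z, z̄)` is a defining function of it near the point. -/
theorem IsRealPoly.exists_isOpen {g : CPoly n} (hg : IsRealPoly g) {S : Set (CSpace n)} {q : CSpace n}
    {a : Fin n} (ha : ev (pderiv (Sum.inl a) g) q (star q) ≠ 0)
    (hS : ∀ᶠ w in nhds q, w ∈ S ↔ ev g w (star w) = 0) :
    ∃ U, IsOpen U ∧ q ∈ U ∧ (∀ x ∈ U, fderiv ℝ (fun x => (ev g x (star x)).re) x ≠ 0) ∧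
      ∀ x ∈ U, x ∈ S ↔ (ev g x (star x)).re = 0 := by
  have h1 : ∀ᶠ w in nhds q, ev (pderiv (Sum.inl a) g) w (star w) ≠ 0 :=
    (continuous_ev_star _).continuousAt.eventually_ne ha
  obtain ⟨U, hU, hUo, hqU⟩ := eventually_nhds_iff.1 (hS.and h1)
  refine ⟨U, hUo, hqU, fun x hx h0 => (hU x hx).2 ?_, fun x hx => (hU x hx).1.trans ?_⟩
  · have h2 (c : ℂ) : 2 * (ev (pderiv (Sum.inl a) g) x (star x) * c).re = 0 := by
      have := hg.fderiv_ev_re x (Pi.single a c)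
      rw [h0, Finset.sum_eq_single a (fun b _ hb => by simp [hb]) (by simp), Pi.single_eq_same] at this
      exact this.symm
    refine Complex.ext ?_ ?_
    · simpa using h2 1
    · simpa using h2 Complex.I
  · refine ⟨fun h => by rw [h]; rfl, fun h => ?_⟩
    have h3 := hg.star_ev x (star x)
    rw [star_star] at h3
    refine Complex.ext h ?_
    exact Complex.conj_eq_iff_im.1 h3

end Charts

open MvPolynomial in
/-- A real-algebraic cone that contains no open set, but contains a piece `M` of a smooth real
hypersurface, is defined at some point of `M` by one irreducible real polynomial `g` in an affine
chart, and `g` divides all polynomials that vanish on the cone. -/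
theorem exists_irreducible_defining_polynomial {n : ℕ} (hn : 1 ≤ n) {V : Set (CSpace (n + 1))}
    (hV : IsComplexCone V) {J : Set (CPoly (n + 1))}
    (hJ : ∀ z, z ∈ V ↔ ∀ P ∈ J, ev P z (star z) = 0)
    (hdim : ¬ ContainsSubmanifold (2 * n) (projImage V)) {M : Set (CProj n)} (hM : M ⊆ projImage V)
    (hne : M.Nonempty) (hsub : ∀ p ∈ M, IsProjSubmanifoldNear (2 * n - 1) M p) :
    ∃ (j : Fin (n + 1)) (g : CPoly n), Irreducible g ∧ IsRealPoly g ∧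
      (∀ P ∈ J, ∀ c, g ∣ chartPoly j c (star c) P) ∧ ∃ q, affineChart j q ∈ M ∧
      ev g q (star q) = 0 ∧ (∃ a, ev (pderiv (Sum.inl a) g) q (star q) ≠ 0) ∧
      ∀ᶠ w in nhds q, ins j w ∈ V ↔ ev g w (star w) = 0 := by
  obtain ⟨p, hp⟩ := hne
  obtain ⟨j, w, hw, -, k, U, f, hk, hU, hwU, hf, hsurj, hfU⟩ := hsub p hp
  obtain rfl : k = 1 := by lia
  let S : Set (CPoly n) := {Q | ∃ P ∈ J, ∃ c, chartPoly j c (star c) P = Q}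
  have hstar : ∀ w : CSpace n, star (ins j w) = ins j (star w) := by
    intro w
    ext k
    refine Fin.succAboveCases j ?_ (fun a => ?_) k <;> simp
  have hS : ∀ w, (∀ P ∈ S, ev P w (star w) = 0) ↔ ins j w ∈ V := by
    intro w
    refine ⟨fun h => (hJ _).2 fun P hP => ?_, ?_⟩
    · have := h _ ⟨P, hP, 1, rfl⟩
      rwa [ev_chartPoly, star_one, one_smul, one_smul, ← hstar] at this
    · rintro h _ ⟨P, hP, c, rfl⟩
      rw [ev_chartPoly, ← hstar, ← star_smul]
      exact (hJ _).1 (hV _ h c) P hP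
  obtain ⟨P₀, hP₀, hP₀'⟩ : ∃ P₀ ∈ S, P₀ ≠ 0 := by
    by_contra! h0
    refine hdim (containsSubmanifold_of_isOpen j isOpen_univ Set.univ_nonempty fun w _ => ?_)
    rw [affineChart_mem_projImage hV, ← hS]
    intro P hP
    rw [h0 P hP, ev_zero]
  have hfz : ∀ x ∈ U, f x 0 = 0 ↔ affineChart j x ∈ M := by
    intro x hx
    rw [← Set.mem_preimage, hfU x hx, funext_iff]
    simp
  have hreg : IsRegularOn (fun x => f x 0) U := by
    intro x hx hx0
    have h1 : ContDiffAt ℝ ∞ f x := hf.contDiffAt (hU.mem_nhds hx)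
    have h2 : ContDiffAt ℝ ∞ (fun x => f x 0) x := contDiffAt_pi.1 h1 0
    refine ⟨h2.hasStrictFDerivAt (by simp), fun h0 => ?_⟩
    obtain ⟨v, hv⟩ := hsurj x ⟨hx, (hfz x hx).1 hx0⟩ 1
    have h3 : fderiv ℝ (fun x => f x 0) x v = fderiv ℝ f x v 0 := by
      have h4 := hasFDerivAt_pi'.1 (h1.differentiableAt (by simp)).hasFDerivAt 0
      rw [h4.fderiv]
      rfl
    rw [h0, hv] at h3
    simp at h3
  obtain ⟨g, hg, hgr, hgS, q, hqU, hfq, hgq, ha, hev⟩ := hreg.exists_good_point hU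
    ⟨w, hwU, (hfz w hwU).2 (by rw [hw]; exact hp)⟩ S hP₀ hP₀' (by
      intro P hP x hx hx0
      exact (hS x).2 ((affineChart_mem_projImage hV j x).1 (hM ((hfz x hx).1 hx0))) P hP)
  refine ⟨j, g, hg, hgr, fun P hP c => hgS _ ⟨P, hP, c, rfl⟩, q, (hfz q hqU).1 hfq, hgq, ha, ?_⟩
  filter_upwards [hev] with x hx
  rw [← hx, hS]

theorem not_containsSubmanifold_of_realDim {n : ℕ} {H : Set (CProj n)}
    (hH : realDim H = 2 * (n : ℤ) - 1) : ¬ ContainsSubmanifold (2 * n) H := by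
  intro h
  have := le_realDim h
  push_cast at this
  lia

/-- A submanifold of dimension `2n - 1` of the variety contains points near which the variety is a
smooth hypersurface, so it is not contained in the singular set. -/
theorem realDim_singularSet_le {n : ℕ} (hn : 1 ≤ n) {H : Set (CProj n)}
    (hH : IsAlgebraicHypervariety H) : realDim (singularSet H) ≤ 2 * (n : ℤ) - 2 := by
  obtain ⟨⟨V, hVa, hV, rfl⟩, hdim⟩ := hH
  obtain ⟨J, hJ⟩ := hVa.exists_cpoly
  have hd := not_containsSubmanifold_of_realDim hdim
  refine csSup_le (Set.insert_nonempty _ _) ?_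
  rintro d (rfl | ⟨k, rfl, hk⟩)
  · lia
  by_contra! hlt
  have hle := hk.le
  have hsing : singularSet (projImage V) ⊆ projImage V := fun p hp => hp.1
  have hk2 : k ≠ 2 * n := by
    rintro rfl
    exact hd (hk.mono hsing)
  obtain rfl : k = 2 * n - 1 := by lia
  obtain ⟨M, hM, hne, hsub⟩ := hk
  obtain ⟨j, g, -, hg, -, q, hqM, hgq, ⟨a, ha⟩, hev⟩ :=
    exists_irreducible_defining_polynomial hn hV hJ hd (hM.trans hsing) hne hsub
  refine (hM hqM).2 ⟨2 * n - 1, j, q, rfl, ?_⟩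
  obtain ⟨U, hU, hqU, hU1, hU2⟩ := hg.exists_isOpen (S := affineChart j ⁻¹' projImage V) ha (by
    filter_upwards [hev] with x hx
    rw [Set.mem_preimage, affineChart_mem_projImage hV, hx])
  exact isSubmanifoldNear_of_contDiff (by lia) (contDiff_ev_re g) hU hU1 hU2 hqU (by rw [hgq]; rfl)

/-! ### Leaves of the Levi foliation -/

section Leaves
variable {n : ℕ}

open MvPolynomial in
theorem exists_irreducible_factor_eval_eq_zero {σ : Type*} {G : MvPolynomial σ ℂ} (hG : G ≠ 0)
    {p : σ → ℂ} (hp : eval p G = 0) : ∃ F, Irreducible F ∧ F ∣ G ∧ eval p F = 0 := by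
  obtain ⟨f, hf, u, hu⟩ := WfDvdMonoid.exists_factors G hG
  have h1 : eval p f.prod = 0 := by
    rw [← hu, map_mul] at hp
    exact (mul_eq_zero.1 hp).resolve_right ((u.isUnit.map (eval p)).ne_zero)
  rw [map_multiset_prod, Multiset.prod_eq_zero_iff, Multiset.mem_map] at h1
  obtain ⟨F, hF, hFp⟩ := h1
  exact ⟨F, hf F hF, (Multiset.dvd_prod hF).trans ⟨u, hu.symm⟩, hFp⟩

open MvPolynomial in
/-- Homogenization, up to powers of the homogenizing variable `Z_j`. -/
theorem exists_homogenization (j : Fin (n + 1)) (h : MvPolynomial (Fin n) ℂ) :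
    ∃ (D : ℕ) (G : MvPolynomial (Fin (n + 1)) ℂ), ∀ Z : CSpace (n + 1), Z j ≠ 0 →
      eval Z G = Z j ^ D * eval (fun a => Z (j.succAbove a) / Z j) h := by
  induction h using MvPolynomial.induction_on with
  | C a => exact ⟨0, C a, fun Z _ => by simp⟩
  | add p q hp hq =>
    obtain ⟨D, G, hG⟩ := hp
    obtain ⟨E, K, hK⟩ := hq
    refine ⟨D + E, G * X j ^ E + K * X j ^ D, fun Z hZ => ?_⟩
    simp only [map_add, map_mul, map_pow, eval_X, hG Z hZ, hK Z hZ]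
    ring
  | mul_X p a hp =>
    obtain ⟨D, G, hG⟩ := hp
    refine ⟨D + 1, G * X (j.succAbove a), fun Z hZ => ?_⟩
    simp only [map_mul, eval_X, hG Z hZ]
    field_simp
    ring

open MvPolynomial in
/-- The polynomial `P(·, ζ)`. -/
def evalRight (P : CPoly n) (ζ : CSpace n) : MvPolynomial (Fin n) ℂ :=
  aeval (Sum.elim X fun a => C (ζ a)) P

open MvPolynomial in
theorem eval_evalRight (P : CPoly n) (z ζ : CSpace n) : eval z (evalRight P ζ) = ev P z ζ := by
  rw [evalRight, eval_aeval_mvPolynomial, ev]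
  congr 2
  funext k
  rcases k with k | k <;> simp

open MvPolynomial in
/-- If `P(λZ, λ̄ζ) = 0` for all `λ`, then `P(λZ, μζ) = 0` for all `λ` and `μ`. -/
theorem ev_smul_smul_eq_zero {P : CPoly n} {Z ζ : CSpace n}
    (h : ∀ c : ℂ, ev P (c • Z) (star c • ζ) = 0) (c d : ℂ) : ev P (c • Z) (d • ζ) = 0 := by
  let Q : CPoly 1 := aeval (Sum.elim (fun k => X (Sum.inl 0) * C (Z k))
    fun k => X (Sum.inr 0) * C (ζ k)) P
  have hQ : ∀ x y : CSpace 1, ev Q x y = ev P (x 0 • Z) (y 0 • ζ) := by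
    intro x y
    rw [ev, eval_aeval_mvPolynomial, ev]
    congr 2
    funext k
    rcases k with k | k <;> simp
  have h0 : Q = 0 := eq_zero_of_ev_star_eq_zero fun w => by
    rw [hQ]
    exact h (w 0)
  rw [← hQ (fun _ => c) (fun _ => d), h0, ev_zero]

open MvPolynomial in
theorem pderiv_evalRight (P : CPoly n) (ζ : CSpace n) (a : Fin n) :
    pderiv a (evalRight P ζ) = evalRight (pderiv (Sum.inl a) P) ζ := by
  simp only [evalRight]
  induction P using MvPolynomial.induction_on with
  | C a => simp
  | add p q hp hq => simp only [map_add, hp, hq]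
  | mul_X p k hp =>
    simp only [map_mul, aeval_X, pderiv_mul, map_add, hp]
    congr 2
    rcases k with k | k
    · by_cases hk : k = a
      · subst hk; simp
      · simp [pderiv_X_of_ne hk, pderiv_X_of_ne (Sum.inl_injective.ne hk)]
    · simp [pderiv_X_of_ne (Sum.inr_ne_inl : (Sum.inr k : Fin n ⊕ Fin n) ≠ Sum.inl a)]

open MvPolynomial in
/-- The restriction of `F` to the line through `Z` and the origin, as a polynomial in one variable.
-/
theorem eval_radial {σ : Type*} (F : MvPolynomial σ ℂ) (Z : σ → ℂ) (d : ℂ) :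
    (aeval (fun k => Polynomial.C (Z k) * Polynomial.X) F : Polynomial ℂ).eval d =
      eval (d • Z) F := by
  induction F using MvPolynomial.induction_on with
  | C a => simp
  | add p q hp hq => simp only [map_add, Polynomial.eval_add, hp, hq]
  | mul_X p k hp =>
    simp only [map_mul, Polynomial.eval_mul, hp, aeval_X, eval_X]
    simp [mul_comm (Z k)]

open MvPolynomial in
/-- A polynomial `F` with nonzero differential at a zero `p` divides every polynomial that vanishes
on the zero set of `F` near `p`, if it is irreducible. -/
theorem dvd_of_eventually_eval_eq_zero {σ : Type*} [Fintype σ] [DecidableEq σ]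
    {F G : MvPolynomial σ ℂ} (hF : Irreducible F) {p : σ → ℂ} (hp : eval p F = 0) {i : σ}
    (hi : eval p (pderiv i F) ≠ 0) (h : ∀ᶠ z in nhds p, eval z F = 0 → eval z G = 0) : F ∣ G := by
  refine dvd_of_eventually_common_zeros hF i p ?_
  have h1 := eventually_exists_update_mem_zero (hasStrictFDerivAt_eval F p) hp (i := i) (by
    rw [dPoly_apply, Finset.sum_eq_single i (fun b _ hb => by simp [hb]) (by simp)]
    simpa using hi) h
  filter_upwards [h1] with x hx
  obtain ⟨c, hc, hc0⟩ := hx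
  exact ⟨c, hc0, hc hc0⟩

open MvPolynomial Filter Topology in
/-- The leaf through the point `q` of the Levi-flat hypersurface `{g(z, z̄) = 0}` is contained in an
algebraic hypersurface `{F = 0}`, an irreducible factor of the homogenized Segre variety
`{g(·, q̄) = 0}`; and this is a complex cone contained in the real-algebraic cone `V`. -/
theorem exists_leaf {V : Set (CSpace (n + 1))} {J : Set (CPoly (n + 1))}
    (hJ : ∀ z, z ∈ V ↔ ∀ P ∈ J, ev P z (star z) = 0) {j : Fin (n + 1)} {g : CPoly n}
    (hg : IsRealPoly g) (hgJ : ∀ P ∈ J, ∀ c, g ∣ chartPoly j c (star c) P) {a : Fin n}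
    (hdvd : ∀ b d, g ∣ leviMinor g a b d) {q : CSpace n} (hq : ev g q (star q) = 0)
    (ha : ev (pderiv (Sum.inl a) g) q (star q) ≠ 0) :
    ∃ F : MvPolynomial (Fin (n + 1)) ℂ, Irreducible F ∧ eval (ins j q) F = 0 ∧
      (∀ Z, eval Z F = 0 → Z ∈ V) ∧ (∀ Z, eval Z F = 0 → ∀ c : ℂ, eval (c • Z) F = 0) ∧
      ∀ z, eval (ins j z) F = 0 → ev g z (star q) = 0 := by
  obtain ⟨D, G, hG⟩ := exists_homogenization j (evalRight g (star q))
  have hG' : ∀ Z : CSpace (n + 1), Z j ≠ 0 →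
      (eval Z G = 0 ↔ ev g (fun a => Z (j.succAbove a) / Z j) (star q) = 0) := by
    intro Z hZ
    rw [hG Z hZ, mul_eq_zero, or_iff_right (pow_ne_zero _ hZ), eval_evalRight]
  have hGins : ∀ z, eval (ins j z) G = ev g z (star q) := by
    intro z
    rw [hG _ (by simp), eval_evalRight]
    simp
  -- the derivative of `G` at `(q, 1)`
  have hGa : eval (ins j q) (pderiv (j.succAbove a) G) ≠ 0 := by
    have hins : ∀ t : ℝ, ins j (q + t • (Pi.single a 1 : CSpace n)) =
        ins j q + t • (Pi.single (j.succAbove a) 1 : CSpace (n + 1)) := by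
      intro t
      ext k
      refine Fin.succAboveCases j ?_ (fun b => ?_) k
      · simp [Fin.ne_succAbove]
      · simp [Pi.single_apply]
    have hline : ∀ {m : ℕ} (x v : CSpace m), HasDerivAt (fun t : ℝ => x + t • v) v 0 := by
      intro m x v
      have := ((hasDerivAt_id (0 : ℝ)).smul_const v).const_add x
      rwa [one_smul] at this
    have h1 := hasDerivAt_ev_left g (hline q (Pi.single a (1 : ℂ))) (star q)
    have h2 := ((hasStrictFDerivAt_eval G (ins j q)).restrictScalars ℝ).hasFDerivAt.comp_hasDerivAt_of_eq
      (0 : ℝ) (hline (ins j q) (Pi.single (j.succAbove a) (1 : ℂ))) (by simp)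
    have h3 : (fun t : ℝ => ev g (q + t • (Pi.single a 1 : CSpace n)) (star q)) =
        (fun y => eval y G) ∘ fun t : ℝ => ins j q + t • (Pi.single (j.succAbove a) 1 : CSpace (n + 1)) := by
      funext t
      rw [Function.comp_apply, ← hins, hGins]
    rw [h3] at h1
    have h4 := h2.unique h1
    rw [zero_smul, add_zero, ContinuousLinearMap.coe_restrictScalars', dPoly_apply,
      Finset.sum_eq_single (j.succAbove a) (fun b _ hb => by simp [hb]) (by simp),
      Finset.sum_eq_single a (fun b _ hb => by simp [hb]) (by simp)] at h4
    simp only [Pi.single_eq_same, mul_one] at h4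
    rw [h4]
    exact ha
  have hGp : eval (ins j q) G = 0 := by rw [hGins, hq]
  obtain ⟨F, hF, ⟨K, hK⟩, hFp⟩ := exists_irreducible_factor_eval_eq_zero
    (fun h0 => hGa (by rw [h0, map_zero, map_zero])) hGp
  have hKF : eval (ins j q) K ≠ 0 ∧ eval (ins j q) (pderiv (j.succAbove a) F) ≠ 0 := by
    rw [hK, pderiv_mul, map_add, map_mul, map_mul, hFp, zero_mul, add_zero] at hGa
    exact ⟨right_ne_zero_of_mul hGa, left_ne_zero_of_mul hGa⟩
  have hFG : ∀ Z, eval Z F = 0 → eval Z G = 0 := fun Z hZ => by rw [hK, map_mul, hZ, zero_mul]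
  have hjq : (ins j q : CSpace (n + 1)) j ≠ 0 := by simp
  have hjcont : Continuous fun Z : CSpace (n + 1) => Z j := continuous_apply j
  have hjev : ∀ᶠ Z in 𝓝 (ins j q), Z j ≠ 0 := hjcont.continuousAt.eventually_ne hjq
  -- The polarized equations `P(X, Ȳ) = 0` of `V` hold for `X` and `Y` in the component `{F = 0}` of
  -- the Segre variety, by the vanishing of `g` on products of Segre varieties.
  have hpair : ∀ᶠ X in 𝓝 (ins j q) ×ˢ 𝓝 (ins j q), ∀ P ∈ J,
      eval X.1 F = 0 → eval X.2 F = 0 → ev P X.1 (star X.2) = 0 := by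
    have ha' : ev (pderiv (Sum.inr a) g) q (star q) ≠ 0 := by
      have := hg.star_ev_pderiv q (star q) (Sum.inl a)
      rw [star_star] at this
      exact fun h0 => ha (star_eq_zero.1 (this.trans h0))
    have h1 := eventually_ev_eq_zero_of_segre hdvd hq ha ha'
    let φ : CSpace (n + 1) → CSpace n := fun Z a => Z (j.succAbove a) / Z j
    have hφq : φ (ins j q) = q := by
      ext b
      simp [φ]
    have hφ : Tendsto φ (𝓝 (ins j q)) (𝓝 q) := by
      have hc : ContinuousAt φ (ins j q) := continuousAt_pi.2 fun b =>
        (continuous_apply _).continuousAt.div hjcont.continuousAt hjq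
      have h2 := hc.tendsto
      rwa [hφq] at h2
    have h2 : Tendsto (fun X : CSpace (n + 1) × CSpace (n + 1) => (φ X.1, star (φ X.2)))
        (𝓝 (ins j q) ×ˢ 𝓝 (ins j q)) (𝓝 (q, star q)) := by
      rw [nhds_prod_eq]
      exact (hφ.comp tendsto_fst).prodMk ((continuous_star.tendsto q).comp (hφ.comp tendsto_snd))
    filter_upwards [h2.eventually h1, hjev.prod_inl _, hjev.prod_inr _] with X hX h1j h2j P hP hF1 hF2
    have e1 : ev g (φ X.1) (star q) = 0 := (hG' X.1 h1j).1 (hFG _ hF1)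
    have e2 : ev g q (star (φ X.2)) = 0 := by
      have e3 : ev g (φ X.2) (star q) = 0 := (hG' X.2 h2j).1 (hFG _ hF2)
      have := hg.star_ev (φ X.2) (star q)
      rw [star_star, e3, star_zero] at this
      exact this.symm
    have e4 := hX e1 e2
    have e5 := ev_smul_smul_eq_zero (P := P) (Z := ins j (φ X.1)) (ζ := ins j (star (φ X.2)))
      (fun c => by
        rw [← ev_chartPoly]
        obtain ⟨k, hk⟩ := hgJ P hP c
        rw [hk, ev_mul, e4, zero_mul]) (X.1 j) (star (X.2 j))
    rw [eq_smul_ins j h1j, eq_smul_ins j h2j, star_smul]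
    convert e5 using 2
    congr 1
    ext k
    refine Fin.succAboveCases j ?_ (fun b => ?_) k <;> simp [φ]
  obtain ⟨N, hN, hNN⟩ := (eventually_prod_self_iff (r := fun X Y => ∀ P ∈ J, eval X F = 0 → eval Y F = 0 →
    ev P X (star Y) = 0)).1 hpair
  have hinV : ∀ Z, eval Z F = 0 → Z ∈ V := by
    intro Z hZ
    rw [hJ]
    intro P hP
    -- both variables of `P(Z, W̄)` are moved along `{F = 0}`, one after the other
    have h1 : ∀ W ∈ N, eval W F = 0 → ev P Z (star W) = 0 := by
      intro W hW hW0
      have h2 : F ∣ evalRight P (star W) := by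
        refine dvd_of_eventually_eval_eq_zero hF hFp hKF.2 ?_
        filter_upwards [hN] with X hX hX0
        rw [eval_evalRight]
        exact hNN X hX W hW P hP hX0 hW0
      obtain ⟨k, hk⟩ := h2
      rw [← eval_evalRight, hk, map_mul, hZ, zero_mul]
    have h2 : F ∣ evalRight (conjPoly P) (star Z) := by
      refine dvd_of_eventually_eval_eq_zero hF hFp hKF.2 ?_
      filter_upwards [hN] with W hW hW0
      rw [eval_evalRight, ev_conjPoly, star_star, h1 W hW hW0, star_zero]
    obtain ⟨k, hk⟩ := h2
    have h3 : ev (conjPoly P) Z (star Z) = 0 := by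
      rw [← eval_evalRight, hk, map_mul, hZ, zero_mul]
    rw [ev_conjPoly, star_star] at h3
    exact star_eq_zero.1 h3
  refine ⟨F, hF, hFp, hinV, fun Z hZ c => ?_, fun z hz => by rw [← hGins]; exact hFG _ hz⟩
  -- `{F = 0}` is a cone: near `(q, 1)` the zeros of `F` are those of `G`, and these are invariant
  -- under multiplication by `c` near `1`; divisibility by `F` extends this to all zeros of `F`, and
  -- the identity theorem to all `c`.
  have hsmul : ∀ᶠ X : ℂ × CSpace (n + 1) in 𝓝 1 ×ˢ 𝓝 (ins j q),
      eval X.2 F = 0 → eval (X.1 • X.2) F = 0 := by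
    have ht : Tendsto (fun X : ℂ × CSpace (n + 1) => X.1 • X.2) (𝓝 1 ×ˢ 𝓝 (ins j q))
        (𝓝 (ins j q)) := by
      have := (continuous_smul (M := ℂ) (X := CSpace (n + 1))).tendsto (1, ins j q)
      rwa [one_smul, nhds_prod_eq] at this
    have hKev : ∀ᶠ Z in 𝓝 (ins j q), eval Z K ≠ 0 :=
      (contDiff_eval K (m := 0)).continuous.continuousAt.eventually_ne hKF.1
    filter_upwards [ht.eventually hKev, ht.eventually hjev, hjev.prod_inr _] with X h1 h2 h3 h4
    have h5 := (hG' X.2 h3).1 (hFG _ h4)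
    have h6 : eval (X.1 • X.2) G = 0 := by
      rw [hG' _ h2, ← h5]
      congr 1
      ext b
      have hX1 : X.1 ≠ 0 := by
        intro h0
        simp [h0] at h2
      simp only [Pi.smul_apply, smul_eq_mul]
      rw [mul_div_mul_left _ _ hX1]
    rw [hK, map_mul] at h6
    exact (mul_eq_zero.1 h6).resolve_right h1
  obtain ⟨A, hA, B, hB, hAB⟩ := eventually_prod_iff.1 hsmul
  let f : Polynomial ℂ := aeval (fun k => Polynomial.C (Z k) * Polynomial.X) F
  have hf : ∀ d, f.eval d = eval (d • Z) F := eval_radial F Z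
  have hfA : ∀ d, A d → f.eval d = 0 := by
    intro d hd
    have h1 : ∀ Y : CSpace (n + 1), eval Y (aeval (fun k => C d * (X k : MvPolynomial (Fin (n + 1)) ℂ)) F) =
        eval (d • Y) F := by
      intro Y
      rw [eval_aeval_mvPolynomial]
      congr 2
      funext k
      simp
    have h2 : F ∣ aeval (fun k => C d * (X k : MvPolynomial (Fin (n + 1)) ℂ)) F := by
      refine dvd_of_eventually_eval_eq_zero hF hFp hKF.2 ?_
      filter_upwards [hB] with X hX hX0
      rw [h1]
      exact hAB hd hX hX0
    obtain ⟨k, hk⟩ := h2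
    rw [hf, ← h1, hk, map_mul, hZ, zero_mul]
  have hf0 : f = 0 := Polynomial.eq_zero_of_infinite_isRoot f
    ((infinite_of_mem_nhds (1 : ℂ) hA).mono fun d hd => hfA d hd)
  rw [← hf, hf0, Polynomial.eval_zero]

open MvPolynomial in
/-- A polynomial that depends on `ζ` does not divide a nonzero polynomial in `z` alone. -/
theorem not_dvd_of_pderiv_inr_ne_zero {g : CPoly n} {b : Fin n} (hb : pderiv (Sum.inr b) g ≠ 0)
    {h : MvPolynomial (Fin n) ℂ} (hh : h ≠ 0) : ¬ g ∣ rename Sum.inl h := by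
  rintro ⟨k, hk⟩
  have h0 : rename (Sum.inl : Fin n → Fin n ⊕ Fin n) h ≠ 0 :=
    fun h0 => hh (rename_injective _ Sum.inl_injective (by rw [h0, map_zero]))
  have hg0 : g ≠ 0 := fun h1 => hb (by rw [h1, map_zero])
  have hk0 : k ≠ 0 := fun h1 => h0 (by rw [hk, h1, mul_zero])
  classical
  have h1 : degreeOf (Sum.inr b) (rename (Sum.inl : Fin n → Fin n ⊕ Fin n) h) = 0 := by
    by_contra h2
    obtain ⟨c, -, hc⟩ := Finset.mem_image.1 (vars_rename _ h (mem_vars_iff_degreeOf_ne_zero.2 h2))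
    cases hc
  rw [hk, degreeOf_mul_eq hg0 hk0] at h1
  exact hb (pderiv_eq_zero_of_notMem_vars fun h2 => mem_vars_iff_degreeOf_ne_zero.1 h2 (by lia))

open MvPolynomial Filter Topology in
/-- There are two different leaves. Not all points of the hypersurface lie on the Segre variety
`{g(·, q̄) = 0}` of one of them, since `g` would divide the polynomial `g(·, q̄)`, which does not
depend on `ζ`. -/
theorem exists_two_leaves {V : Set (CSpace (n + 1))} {J : Set (CPoly (n + 1))}
    (hJ : ∀ z, z ∈ V ↔ ∀ P ∈ J, ev P z (star z) = 0) {j : Fin (n + 1)} {g : CPoly n}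
    (hgi : Irreducible g)
    (hg : IsRealPoly g) (hgJ : ∀ P ∈ J, ∀ c, g ∣ chartPoly j c (star c) P) {a : Fin n}
    (hdvd : ∀ b d, g ∣ leviMinor g a b d) {q : CSpace n} (hq : ev g q (star q) = 0)
    (ha : ev (pderiv (Sum.inl a) g) q (star q) ≠ 0) :
    ∃ F : Fin 2 → MvPolynomial (Fin (n + 1)) ℂ, (∀ k, Irreducible (F k)) ∧
      (∀ k Z, eval Z (F k) = 0 → Z ∈ V) ∧
      (∀ k Z, eval Z (F k) = 0 → ∀ c : ℂ, eval (c • Z) (F k) = 0) ∧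
      (∀ k, ∃ Z, Z ≠ 0 ∧ eval Z (F k) = 0) ∧ ¬ F 1 ∣ F 0 := by
  obtain ⟨U, hU, hqU, hU1, hU2⟩ := hg.exists_isOpen (S := {w | ev g w (star w) = 0}) ha
    (Eventually.of_forall fun w => Iff.rfl)
  have hb : pderiv (Sum.inr a) g ≠ 0 := by
    intro h0
    have := hg.star_ev_pderiv q (star q) (Sum.inl a)
    rw [Sum.swap_inl, h0, ev_zero] at this
    exact ha (star_eq_zero.1 this)
  have hh0 : evalRight g (star q) ≠ 0 := by
    intro h0
    apply ha
    rw [← eval_evalRight, ← pderiv_evalRight, h0, map_zero, map_zero]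
  have hev : ∃ᶠ w in 𝓝 q, ev g w (star w) = 0 ∧ ev g w (star q) ≠ 0 := by
    intro hnot
    refine not_dvd_of_pderiv_inr_ne_zero hb hh0 ?_
    refine dvd_of_vanish_on_hypersurface hgi (hasStrictFDerivAt_ev_re g q) ?_ (by rw [hq]; rfl) ?_
    · rw [← (hasStrictFDerivAt_ev_re g q).hasFDerivAt.fderiv]
      exact hU1 q hqU
    · filter_upwards [hnot, hU.mem_nhds hqU] with w hw hwU hw0
      have h1 : ev g w (star w) = 0 := (hU2 w hwU).2 hw0
      refine ⟨h1, ?_⟩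
      rw [ev, eval_rename]
      by_contra h2
      exact hw ⟨h1, fun h3 => h2 (by rw [← eval_evalRight] at h3; exact h3)⟩
  obtain ⟨q₂, ⟨hq₂, hne⟩, ha₂⟩ := (hev.and_eventually
    ((continuous_ev_star _).continuousAt.eventually_ne ha)).exists
  obtain ⟨F₁, h1, h2, h3, h4, h5⟩ := exists_leaf hJ hg hgJ hdvd hq ha
  obtain ⟨F₂, k1, k2, k3, k4, -⟩ := exists_leaf hJ hg hgJ hdvd hq₂ ha₂
  refine ⟨![F₁, F₂], ?_, ?_, ?_, ?_, ?_⟩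
  · intro k; fin_cases k <;> assumption
  · intro k; fin_cases k <;> assumption
  · intro k; fin_cases k <;> assumption
  · intro k
    fin_cases k
    · exact ⟨_, insertNth_one_ne_zero j q, h2⟩
    · exact ⟨_, insertNth_one_ne_zero j q₂, k2⟩
  · rintro ⟨K, hK⟩
    refine hne (h5 q₂ ?_)
    change F₁ = F₂ * K at hK
    rw [hK, map_mul, k2, zero_mul]

end Leaves

/-! ### Intersections of leaves are singular points -/

open MvPolynomial Filter Topology in
/-- A point in which two different leaves meet is a singular point: a smooth hypersurface near it
could not contain both of them. -/
theorem mem_singularSet_of_common_zero {n : ℕ} {V : Set (CSpace (n + 1))} (hV : IsComplexCone V)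
    (hdim : ¬ ContainsSubmanifold (2 * n) (projImage V)) {F : Fin 2 → MvPolynomial (Fin (n + 1)) ℂ}
    (hF : Irreducible (F 1)) (hFV : ∀ k Z, eval Z (F k) = 0 → Z ∈ V) (hndvd : ¬ F 1 ∣ F 0)
    {z : CSpace (n + 1)} (hz : z ≠ 0) (hFz : ∀ k, eval z (F k) = 0) :
    Projectivization.mk ℂ z hz ∈ singularSet (projImage V) := by
  refine ⟨⟨z, hz, hFV 0 z (hFz 0), rfl⟩, ?_⟩
  rintro ⟨d, j, w, hw, -, k, U, f, hk, hU, hwU, hf, hsurj, hfU⟩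
  obtain ⟨c, hc⟩ := (Projectivization.mk_eq_mk_iff' ℂ _ _ _ _).1 hw.symm
  have hzj : z j = c := by rw [← congrFun hc j]; simp
  have hc0 : c ≠ 0 := by
    rintro rfl
    exact hz (by rw [← hc, zero_smul])
  let φ : CSpace (n + 1) → CSpace n := fun Z a => Z (j.succAbove a) / Z j
  have hφc : ∀ x, φ (c • ins j x) = x := by
    intro x
    ext a
    simp [φ, hc0]
  have hφz : φ z = w := by rw [← hc]; exact hφc w
  have hφV : ∀ Z, Z j ≠ 0 → Z ∈ V → ins j (φ Z) ∈ V := by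
    intro Z hZ hZV
    have h1 : ins j (φ Z) = (Z j)⁻¹ • Z := (eq_inv_smul_iff₀ hZ).2 (eq_smul_ins j hZ).symm
    rw [h1]
    exact hV Z hZV _
  have hfz : ∀ x ∈ U, ins j x ∈ V ↔ f x = 0 := by
    intro x hx
    rw [← hfU x hx, Set.mem_preimage, affineChart_mem_projImage hV]
  have hwV : ins j w ∈ V := by
    rw [← hφz]
    exact hφV z (by rw [hzj]; exact hc0) (hFV 0 z (hFz 0))
  rcases k with _ | k
  -- In codimension zero, the variety would contain an open set.
  · refine hdim (containsSubmanifold_of_isOpen j hU ⟨w, hwU⟩ fun x hx => ?_)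
    rw [affineChart_mem_projImage hV, hfz x hx]
    exact Subsingleton.elim _ _
  have hfC : ContDiffAt ℝ ∞ (fun x => f x 0) w := contDiffAt_pi.1 (hf.contDiffAt (hU.mem_nhds hwU)) 0
  have hf0 : fderiv ℝ (fun x => f x 0) w ≠ 0 := by
    intro h0
    obtain ⟨v, hv⟩ := hsurj w ⟨hwU, (hfU w hwU).2 ((hfz w hwU).1 hwV)⟩ 1
    have h3 : fderiv ℝ (fun x => f x 0) w v = fderiv ℝ f w v 0 := by
      have h4 := hasFDerivAt_pi'.1 ((hf.contDiffAt (hU.mem_nhds hwU)).differentiableAt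
        (by simp)).hasFDerivAt 0
      rw [h4.fderiv]
      rfl
    rw [h0, hv] at h3
    simp at h3
  have hφC : ContDiffAt ℝ ∞ φ z := by
    have h1 : ContDiffAt ℂ ∞ φ z := contDiffAt_pi.2 fun a =>
      (contDiff_apply ℂ ℂ (j.succAbove a)).contDiffAt.div (contDiff_apply ℂ ℂ j).contDiffAt
        (by rw [hzj]; exact hc0)
    exact h1.restrict_scalars ℝ
  have hrC : ContDiffAt ℝ ∞ (fun Z => f (φ Z) 0) z := by
    rw [← hφz] at hfC
    exact hfC.comp z hφC
  have hL : fderiv ℝ (fun Z => f (φ Z) 0) z ≠ 0 := by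
    intro h0
    apply hf0
    have hψ : Differentiable ℝ fun x : CSpace n => c • ins j x := by
      refine differentiable_pi.2 fun i => ?_
      refine Fin.succAboveCases j ?_ (fun a => ?_) i
      · simp
      · simp only [Pi.smul_apply, Fin.insertNth_apply_succAbove, smul_eq_mul]
        exact (differentiable_apply a).const_mul c
    have h1 : HasFDerivAt (fun Z => f (φ Z) 0) (0 : CSpace (n + 1) →L[ℝ] ℝ) (c • ins j w) := by
      rw [hc, ← h0]
      exact (hrC.differentiableAt (by simp)).hasFDerivAt
    have h2 := HasFDerivAt.comp w h1 (hψ w).hasFDerivAt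
    have h3 : ((fun Z => f (φ Z) 0) ∘ fun x : CSpace n => c • ins j x) = fun x => f x 0 := by
      funext x
      rw [Function.comp_apply, hφc]
    rw [h3, ContinuousLinearMap.zero_comp] at h2
    exact h2.fderiv
  obtain ⟨i, hi⟩ := exists_axis_common_zeros (hrC.hasStrictFDerivAt (by simp)) hL F hFz (by
    intro k
    have h1 : ∀ᶠ Z in 𝓝 z, φ Z ∈ U := hφC.continuousAt.preimage_mem_nhds (by
      rw [hφz]; exact hU.mem_nhds hwU)
    have h2 : ∀ᶠ Z in 𝓝 z, Z j ≠ 0 := (continuous_apply j).continuousAt.eventually_ne (by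
      rw [hzj]; exact hc0)
    filter_upwards [h1, h2] with Z hZU hZj hZ0
    exact congrFun ((hfz _ hZU).1 (hφV Z hZj (hFV k Z hZ0))) 0)
  refine hndvd (dvd_of_eventually_common_zeros hF i z ?_)
  filter_upwards [hi] with x ⟨b, hb0, hb1⟩ using ⟨b, hb1, hb0⟩

/-! ### Dimension of prime ideals of polynomial rings -/

open MvPolynomial in
/-- Maximal ideals of the polynomial ring in `n` variables have height at least `n`: one of them
has, and translations permute them transitively. -/
theorem le_height_vanishingIdeal_singleton {n : ℕ} (x : Fin n → ℂ) :
    (n : ℕ∞) ≤ (vanishingIdeal ℂ {x} : Ideal (MvPolynomial (Fin n) ℂ)).height := by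
  have hdim : ringKrullDim (MvPolynomial (Fin n) ℂ) = n := by
    rw [MvPolynomial.ringKrullDim_of_isNoetherianRing, ringKrullDim_eq_zero_of_field]
    simp
  have hfin : FiniteRingKrullDim (MvPolynomial (Fin n) ℂ) := by
    rw [finiteRingKrullDim_iff_ne_bot_and_top, hdim]
    exact ⟨WithBot.natCast_ne_bot n, fun h => by simpa using WithBot.coe_injective h⟩
  obtain ⟨m, hm, hmh⟩ := Ideal.exists_isMaximal_height (R := MvPolynomial (Fin n) ℂ)
  obtain ⟨y, rfl⟩ := isMaximal_iff_eq_vanishingIdeal_singleton.1 hm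
  -- translations act transitively on the points
  have hcomp : ∀ a : Fin n → ℂ, (aeval fun i => (X i + C (a i) : MvPolynomial (Fin n) ℂ)).comp
      (aeval fun i => (X i - C (a i) : MvPolynomial (Fin n) ℂ)) = AlgHom.id ℂ _ := by
    intro a
    ext i
    simp [← algebraMap_eq]
  have hcomp' : ∀ a : Fin n → ℂ, (aeval fun i => (X i - C (a i) : MvPolynomial (Fin n) ℂ)).comp
      (aeval fun i => (X i + C (a i) : MvPolynomial (Fin n) ℂ)) = AlgHom.id ℂ _ := by
    intro a
    ext i
    simp [← algebraMap_eq]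
  let e : MvPolynomial (Fin n) ℂ ≃ₐ[ℂ] MvPolynomial (Fin n) ℂ :=
    AlgEquiv.ofAlgHom _ _ (hcomp (x - y)) (hcomp' (x - y))
  have he : (vanishingIdeal ℂ {y} : Ideal (MvPolynomial (Fin n) ℂ)) =
      (vanishingIdeal ℂ {x}).comap e.symm.toRingEquiv := by
    ext P
    rw [Ideal.mem_comap, mem_vanishingIdeal_singleton_iff, mem_vanishingIdeal_singleton_iff]
    have h1 : aeval x (e.symm P) = aeval y P := by
      simp only [aeval_eq_eval]
      refine (eval_aeval_mvPolynomial _ x P).trans ?_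
      congr 2
      funext i
      simp
    rw [← h1]
    rfl
  rw [he, RingEquiv.height_comap, hdim] at hmh
  exact (WithBot.coe_injective hmh).ge

theorem ringKrullDim_le_of_isIntegral {R S : Type*} [CommRing R] [CommRing S] [Algebra R S]
    [Algebra.IsIntegral R S] : ringKrullDim S ≤ ringKrullDim R :=
  Order.krullDim_le_of_strictMono (PrimeSpectrum.comap (algebraMap R S)) fun _ _ h =>
    Ideal.IsIntegral.comap_lt_comap h

open MvPolynomial in
/-- Two polynomials with a common zero are contained in a prime ideal whose coordinate ring is an
integral extension of a polynomial ring in at least `n - 2` variables. -/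
theorem exists_prime_integral_over_polynomials {n : ℕ} (f : Fin 2 → MvPolynomial (Fin n) ℂ)
    {x : Fin n → ℂ} (hx : ∀ k, eval x (f k) = 0) :
    ∃ (P : Ideal (MvPolynomial (Fin n) ℂ)) (s : ℕ)
      (b : MvPolynomial (Fin s) ℂ →ₐ[ℂ] MvPolynomial (Fin n) ℂ), P.IsPrime ∧ (∀ k, f k ∈ P) ∧
      n ≤ s + 2 ∧ Function.Injective ((Ideal.Quotient.mkₐ ℂ P).comp b) ∧
      ((Ideal.Quotient.mkₐ ℂ P).comp b).IsIntegral := by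
  let I : Ideal (MvPolynomial (Fin n) ℂ) := Ideal.span (Set.range f)
  have hIx : I ≤ vanishingIdeal ℂ {x} := by
    rw [Ideal.span_le]
    rintro _ ⟨k, rfl⟩
    rw [SetLike.mem_coe, mem_vanishingIdeal_singleton_iff]
    simpa using hx k
  have hItop : I ≠ ⊤ := fun h => (inferInstance : (vanishingIdeal ℂ {x} :
    Ideal (MvPolynomial (Fin n) ℂ)).IsPrime).ne_top (top_le_iff.1 (h ▸ hIx))
  have : Nontrivial (MvPolynomial (Fin n) ℂ ⧸ I) := Ideal.Quotient.nontrivial_iff.2 hItop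
  obtain ⟨s, g, hg, hgf⟩ := exists_finite_inj_algHom_of_fg ℂ (MvPolynomial (Fin n) ℂ ⧸ I)
  have hgi : g.toRingHom.IsIntegral := hgf.to_isIntegral
  let _ : Algebra (MvPolynomial (Fin s) ℂ) (MvPolynomial (Fin n) ℂ ⧸ I) := g.toRingHom.toAlgebra
  have hint : Algebra.IsIntegral (MvPolynomial (Fin s) ℂ) (MvPolynomial (Fin n) ℂ ⧸ I) := ⟨hgi⟩
  have hs : n ≤ s + 2 := by
    have h1 := height_le_ringKrullDim_quotient_add_spanFinrank hIx
    have h2 : ringKrullDim (MvPolynomial (Fin n) ℂ ⧸ I) ≤ s := by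
      refine (ringKrullDim_le_of_isIntegral (R := MvPolynomial (Fin s) ℂ)).trans ?_
      rw [MvPolynomial.ringKrullDim_of_isNoetherianRing, ringKrullDim_eq_zero_of_field]
      simp
    have h3 : I.spanFinrank ≤ 2 :=
      (Submodule.spanFinrank_span_le_ncard_of_finite (Set.finite_range f)).trans (by
        rw [← Nat.card_coe_set_eq]
        exact (Finite.card_range_le f).trans (by simp))
    have h4 : ((n : ℕ∞) : WithBot ℕ∞) ≤ (s : WithBot ℕ∞) + ((2 : ℕ) : WithBot ℕ∞) := by
      refine (WithBot.coe_le_coe.2 (le_height_vanishingIdeal_singleton x)).trans (h1.trans ?_)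
      exact add_le_add h2 (by exact_mod_cast h3)
    have h5 : (n : ℕ∞) ≤ ((s + 2 : ℕ) : ℕ∞) := WithBot.coe_le_coe.1 h4
    exact_mod_cast h5
  choose a ha using fun i => Ideal.Quotient.mk_surjective (I := I) (g (X i))
  have hb : (Ideal.Quotient.mkₐ ℂ I).comp (aeval a) = g := by
    ext i
    simp [ha]
  obtain ⟨Q, -, hQ, hQg⟩ := Ideal.exists_ideal_over_prime_of_isIntegral
    (⊥ : Ideal (MvPolynomial (Fin s) ℂ)) (⊥ : Ideal (MvPolynomial (Fin n) ℂ ⧸ I)) (by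
      rw [← RingHom.ker_eq_comap_bot]
      exact ((RingHom.injective_iff_ker_eq_bot _).1 hg).le)
  let P : Ideal (MvPolynomial (Fin n) ℂ) := Q.comap (Ideal.Quotient.mkₐ ℂ I)
  have hIP : I ≤ P := fun y hy => by
    rw [Ideal.mem_comap, show Ideal.Quotient.mkₐ ℂ I y = 0 from Ideal.Quotient.eq_zero_iff_mem.2 hy]
    exact Q.zero_mem
  refine ⟨P, s, aeval a, Ideal.comap_isPrime _ _, fun k => hIP (Ideal.subset_span ⟨k, rfl⟩), hs, ?_, ?_⟩
  · rw [injective_iff_map_eq_zero]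
    intro y hy
    have h1 : aeval a y ∈ P := Ideal.Quotient.eq_zero_iff_mem.1 hy
    have h2 : g y ∈ Q := by rw [← hb]; exact h1
    have h3 : y ∈ Q.comap (algebraMap (MvPolynomial (Fin s) ℂ) (MvPolynomial (Fin n) ℂ ⧸ I)) := h2
    rwa [hQg] at h3
  · have h1 : (Ideal.Quotient.mkₐ ℂ P).comp (aeval a) = (Ideal.Quotient.factorₐ ℂ hIP).comp g := by
      rw [← hb]
      ext i
      simp
    rw [h1]
    exact RingHom.IsIntegral.trans g.toRingHom _ hgi
      (RingHom.isIntegral_of_surjective _ (Ideal.Quotient.factor_surjective hIP))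

open MvPolynomial KaehlerDifferential TensorProduct in
/-- The differentials of a transcendence basis are linearly independent (in characteristic zero). -/
theorem linearIndependent_D_of_isAlgebraic {s : ℕ} {K : Type*} [Field K] [Algebra ℂ K]
    [Algebra (MvPolynomial (Fin s) ℂ) K] [IsScalarTower ℂ (MvPolynomial (Fin s) ℂ) K]
    [FaithfulSMul (MvPolynomial (Fin s) ℂ) K] [Algebra.IsAlgebraic (MvPolynomial (Fin s) ℂ) K] :
    LinearIndependent K fun i : Fin s =>
      D ℂ K (algebraMap (MvPolynomial (Fin s) ℂ) K (X i)) := by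
  let L := FractionRing (MvPolynomial (Fin s) ℂ)
  let _ : Algebra L K := FractionRing.liftAlgebra _ K
  have := FractionRing.isScalarTower_liftAlgebra (MvPolynomial (Fin s) ℂ) K
  have : Algebra.IsAlgebraic L K :=
    (IsFractionRing.comap_isAlgebraic_iff (A := MvPolynomial (Fin s) ℂ)).1 inferInstance
  have : CharZero L := charZero_of_injective_algebraMap
    (FaithfulSMul.algebraMap_injective (MvPolynomial (Fin s) ℂ) L)
  have : Algebra.FormallyEtale L K := Algebra.FormallyEtale.of_isSeparable L K
  have : Algebra.FormallyEtale (MvPolynomial (Fin s) ℂ) L :=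
    Algebra.FormallyEtale.of_isLocalization (nonZeroDivisors _)
  have : Algebra.FormallyEtale (MvPolynomial (Fin s) ℂ) K :=
    Algebra.FormallyEtale.comp (MvPolynomial (Fin s) ℂ) L K
  let B := ((mvPolynomialBasis ℂ (Fin s)).baseChange K).map
    (tensorKaehlerEquivOfFormallyEtale ℂ (MvPolynomial (Fin s) ℂ) K)
  have hB : ∀ i, B i = D ℂ K (algebraMap (MvPolynomial (Fin s) ℂ) K (X i)) := by
    intro i
    simp only [B, Module.Basis.map_apply, Module.Basis.baseChange_apply, mvPolynomialBasis_apply]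
    rw [← tensorKaehlerEquivOfFormallyEtale_symm_D_algebraMap, LinearEquiv.apply_symm_apply]
  have := B.linearIndependent
  rwa [show (B : Fin s → _) = _ from funext hB] at this

open MvPolynomial KaehlerDifferential in
/-- The chain rule for Kähler differentials. -/
theorem D_eq_sum_pderiv {n : ℕ} {K : Type*} [Field K] [Algebra ℂ K]
    (q : MvPolynomial (Fin n) ℂ →ₐ[ℂ] K) (g : MvPolynomial (Fin n) ℂ) :
    D ℂ K (q g) = ∑ j, q (pderiv j g) • D ℂ K (q (X j)) := by
  classical
  induction g using MvPolynomial.induction_on with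
  | C a => simp [← algebraMap_eq]
  | add f g hf hg => simp only [map_add, hf, hg, add_smul, Finset.sum_add_distrib]
  | mul_X f k hf =>
    rw [map_mul, Derivation.leibniz, hf, Finset.smul_sum]
    simp only [pderiv_mul, map_add, map_mul, add_smul, Finset.sum_add_distrib]
    rw [add_comm]
    congr 1
    · refine Finset.sum_congr rfl fun j _ => ?_
      rw [smul_smul, mul_comm]
    · rw [Finset.sum_eq_single k]
      · simp
      · intro j _ hj
        simp [pderiv_X_of_ne hj.symm]
      · simp

open MvPolynomial KaehlerDifferential in
/-- The rank of the differentials of the elements of a prime ideal is at most the codimension. -/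
theorem card_add_le_of_linearIndependent_pderiv {n s k : ℕ} {K : Type*} [Field K] [Algebra ℂ K]
    (q : MvPolynomial (Fin n) ℂ →ₐ[ℂ] K) (b : MvPolynomial (Fin s) ℂ →ₐ[ℂ] MvPolynomial (Fin n) ℂ)
    (hb : LinearIndependent K fun i : Fin s => D ℂ K (q (b (X i)))) {f : Fin k → MvPolynomial (Fin n) ℂ}
    (hf : ∀ i, q (f i) = 0) (hfl : LinearIndependent K fun i j => q (pderiv j (f i))) :
    k + s ≤ n := by
  let φ : (Fin n → K) →ₗ[K] Ω[K⁄ℂ] := Fintype.linearCombination K fun j => D ℂ K (q (X j))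
  have hφ : ∀ g, φ (fun j => q (pderiv j g)) = D ℂ K (q g) := fun g => by
    rw [D_eq_sum_pderiv, Fintype.linearCombination_apply]
  have h1 := φ.finrank_range_add_finrank_ker
  have h2 : s ≤ Module.finrank K (LinearMap.range φ) := by
    let y : Fin s → LinearMap.range φ := fun i => ⟨D ℂ K (q (b (X i))), _, hφ (b (X i))⟩
    have hy : LinearIndependent K y := LinearIndependent.of_comp (LinearMap.range φ).subtype hb
    simpa using hy.fintype_card_le_finrank
  have h3 : k ≤ Module.finrank K (LinearMap.ker φ) := by
    let y : Fin k → LinearMap.ker φ := fun i => ⟨fun j => q (pderiv j (f i)), by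
      rw [LinearMap.mem_ker, hφ, hf, map_zero]⟩
    have hy : LinearIndependent K y := LinearIndependent.of_comp (LinearMap.ker φ).subtype hfl
    simpa using hy.fintype_card_le_finrank
  rw [Module.finrank_fin_fun] at h1
  lia

/-- A maximal linearly independent family `v` in a set `R` of vectors, together with a matrix `N`
that computes the coordinates with respect to `v` of the vectors in `R`. -/
theorem exists_linearIndependent_frame {K : Type*} [Field K] {n : ℕ} (R : Set (Fin n → K)) :
    ∃ (k : ℕ) (v : Fin k → Fin n → K) (N : Fin n → Fin k → K), (∀ i, v i ∈ R) ∧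
      LinearIndependent K v ∧ (∀ i i', ∑ j, v i j * N j i' = if i = i' then 1 else 0) ∧
      ∀ u ∈ R, ∀ j, u j = ∑ i, (∑ l, u l * N l i) * v i j := by
  classical
  obtain ⟨v, hvR, hspan, hli⟩ := Submodule.exists_fun_fin_finrank_span_eq K R
  -- a left inverse of the injective map `c ↦ ∑ i, c i • v i`
  have hker : LinearMap.ker (Fintype.linearCombination K v) = ⊥ := by
    rw [LinearMap.ker_eq_bot]
    exact LinearIndependent.fintypeLinearCombination_injective hli
  obtain ⟨ρ, hρ⟩ := (Fintype.linearCombination K v).exists_leftInverse_of_injective hker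
  have hρv : ∀ c, ρ (∑ i, c i • v i) = c := fun c => by
    rw [← Fintype.linearCombination_apply]
    exact LinearMap.congr_fun hρ c
  have hρe : ∀ u i, ∑ j, u j * ρ (Pi.single j 1) i = ρ u i := by
    intro u i
    conv_rhs => rw [pi_eq_sum_univ' u]
    simp [Finset.sum_apply]
  refine ⟨_, v, fun j => ρ (Pi.single j 1), hvR, hli, fun i i' => ?_, fun u hu j => ?_⟩
  · have h1 := hρv (Pi.single i 1)
    rw [Finset.sum_eq_single i (fun l _ hl => by simp [hl]) (by simp), Pi.single_eq_same,
      one_smul] at h1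
    rw [hρe, h1, Pi.single_apply]
    simp only [eq_comm]
  · have h1 : u ∈ Submodule.span K (Set.range v) := by
      rw [hspan]
      exact Submodule.subset_span hu
    obtain ⟨c, hc⟩ := (Submodule.mem_span_range_iff_exists_fun K).1 h1
    have h2 : ρ u = c := by rw [← hc, hρv]
    simp only [hρe, h2]
    have h3 := congrFun hc j
    rw [Finset.sum_apply] at h3
    exact h3.symm

open MvPolynomial KaehlerDifferential in
/-- If a domain is integral over a polynomial ring, the differentials of the variables are linearly
independent over its fraction field. -/
theorem linearIndependent_D_of_isFractionRing {s : ℕ} {S K : Type*} [CommRing S] [IsDomain S]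
    [Algebra ℂ S] [Field K] [Algebra S K] [IsFractionRing S K] [Algebra ℂ K] [IsScalarTower ℂ S K]
    (b : MvPolynomial (Fin s) ℂ →ₐ[ℂ] S) (hinj : Function.Injective b) (hint : b.IsIntegral) :
    LinearIndependent K fun i => D ℂ K (algebraMap S K (b (X i))) := by
  let _ : Algebra (MvPolynomial (Fin s) ℂ) S := b.toRingHom.toAlgebra
  let _ : Algebra (MvPolynomial (Fin s) ℂ) K := ((algebraMap S K).comp b.toRingHom).toAlgebra
  have : IsScalarTower (MvPolynomial (Fin s) ℂ) S K := IsScalarTower.of_algebraMap_eq fun _ => rfl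
  have : IsScalarTower ℂ (MvPolynomial (Fin s) ℂ) K := IsScalarTower.of_algebraMap_eq fun c => by
    rw [IsScalarTower.algebraMap_apply ℂ S K, ← b.commutes c]
    rfl
  have : Algebra.IsIntegral (MvPolynomial (Fin s) ℂ) S := ⟨hint⟩
  have : Algebra.IsAlgebraic S K := (IsFractionRing.comap_isAlgebraic_iff (K := K)).2 inferInstance
  have : Algebra.IsAlgebraic (MvPolynomial (Fin s) ℂ) K := Algebra.IsAlgebraic.trans _ S K
  have : FaithfulSMul (MvPolynomial (Fin s) ℂ) K := by
    rw [faithfulSMul_iff_algebraMap_injective]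
    exact (FaithfulSMul.algebraMap_injective S K).comp hinj
  exact linearIndependent_D_of_isAlgebraic

open MvPolynomial in
/-- Generically on the zero set of a prime ideal, the differentials of the elements of the ideal
are combinations of linearly independent differentials of `k` elements. The denominators are cleared
by `δ`. -/
theorem exists_jacobian_frame {n s : ℕ} (P : Ideal (MvPolynomial (Fin n) ℂ)) [P.IsPrime]
    (b : MvPolynomial (Fin s) ℂ →ₐ[ℂ] MvPolynomial (Fin n) ℂ)
    (hinj : Function.Injective ((Ideal.Quotient.mkₐ ℂ P).comp b))
    (hint : ((Ideal.Quotient.mkₐ ℂ P).comp b).IsIntegral) :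
    ∃ (k : ℕ) (f : Fin k → MvPolynomial (Fin n) ℂ) (δ : MvPolynomial (Fin n) ℂ)
      (N : Fin n → Fin k → MvPolynomial (Fin n) ℂ), k + s ≤ n ∧ δ ∉ P ∧ (∀ i, f i ∈ P) ∧
      (∀ i i', ∑ j, pderiv j (f i) * N j i' - (if i = i' then δ else 0) ∈ P) ∧
      ∀ g ∈ P, ∀ j,
        δ * pderiv j g - ∑ i, (∑ l, pderiv l g * N l i) * pderiv j (f i) ∈ P := by
  classical
  obtain ⟨K, _, _, _, _, _⟩ : ∃ (K : Type) (_ : Field K) (_ : Algebra ℂ K)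
      (_ : Algebra (MvPolynomial (Fin n) ℂ ⧸ P) K)
      (_ : IsScalarTower ℂ (MvPolynomial (Fin n) ℂ ⧸ P) K),
      IsFractionRing (MvPolynomial (Fin n) ℂ ⧸ P) K :=
    ⟨FractionRing (MvPolynomial (Fin n) ℂ ⧸ P), inferInstance, inferInstance, inferInstance,
      inferInstance, inferInstance⟩
  let q : MvPolynomial (Fin n) ℂ →ₐ[ℂ] K :=
    (IsScalarTower.toAlgHom ℂ (MvPolynomial (Fin n) ℂ ⧸ P) K).comp (Ideal.Quotient.mkₐ ℂ P)
  have hq : ∀ x, q x = 0 ↔ x ∈ P := by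
    intro x
    refine (FaithfulSMul.algebraMap_eq_zero_iff (MvPolynomial (Fin n) ℂ ⧸ P) K).trans ?_
    exact Ideal.Quotient.eq_zero_iff_mem
  obtain ⟨k, v, ν, hvR, hli, hν, hR⟩ :=
    exists_linearIndependent_frame {v : Fin n → K | ∃ g ∈ P, (fun j => q (pderiv j g)) = v}
  choose f hfP hfv using hvR
  -- clearing denominators
  obtain ⟨d, hd⟩ := IsLocalization.exist_integer_multiples_of_finite
    (nonZeroDivisors (MvPolynomial (Fin n) ℂ ⧸ P)) fun x : Fin n × Fin k => ν x.1 x.2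
  choose m hm using hd
  obtain ⟨δ, hδ⟩ := Ideal.Quotient.mk_surjective (d : MvPolynomial (Fin n) ℂ ⧸ P)
  choose N hN using fun j i => Ideal.Quotient.mk_surjective (m (j, i))
  have hqN : ∀ j i, q (N j i) = q δ * ν j i := by
    intro j i
    change algebraMap _ K (Ideal.Quotient.mk P (N j i)) =
      algebraMap _ K (Ideal.Quotient.mk P δ) * _
    rw [hN, hm, hδ, Algebra.smul_def]
  have hqν : ∀ (u : Fin n → K) i, ∑ j, u j * q (N j i) = q δ * ∑ j, u j * ν j i := by
    intro u i
    rw [Finset.mul_sum]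
    refine Finset.sum_congr rfl fun j _ => ?_
    rw [hqN]
    ring
  refine ⟨k, f, δ, N, ?_, ?_, hfP, ?_, ?_⟩
  · have h1 := linearIndependent_D_of_isFractionRing (K := K) _ hinj hint
    have h2 : ∀ x, q (b x) = algebraMap (MvPolynomial (Fin n) ℂ ⧸ P) K
        (((Ideal.Quotient.mkₐ ℂ P).comp b) x) := fun x => rfl
    simp only [← h2] at h1
    refine card_add_le_of_linearIndependent_pderiv q b h1 (fun i => (hq _).2 (hfP i)) ?_
    rw [show (fun i j => q (pderiv j (f i))) = v from funext hfv]
    exact hli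
  · intro h
    refine nonZeroDivisors.coe_ne_zero d ?_
    rw [← hδ]
    exact Ideal.Quotient.eq_zero_iff_mem.2 h
  · intro i i'
    rw [← hq, map_sub, map_sum, sub_eq_zero]
    simp only [map_mul]
    rw [hqν (fun j => q (pderiv j (f i))) i']
    have h1 := hν i i'
    rw [← hfv i] at h1
    rw [h1]
    by_cases hi : i = i'
    · simp [hi]
    · simp [hi]
  · intro g hg j
    have h1 := hR _ ⟨g, hg, rfl⟩ j
    rw [← hq, map_sub, map_sum, sub_eq_zero]
    simp only [map_mul, map_sum]
    rw [h1, Finset.mul_sum]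
    refine Finset.sum_congr rfl fun i _ => ?_
    rw [hqν (fun j => q (pderiv j g)), ← hfv i]
    ring

/-! ### Smooth points of affine varieties -/

open Set in
/-- A solution of a homogeneous linear differential equation that starts at `0` vanishes, by
Gronwall's inequality. -/
theorem eq_zero_of_hasDerivAt_linear {r : ℕ} {u : ℝ → Fin r → ℂ} {A : Fin r → Fin r → ℝ → ℂ}
    (hA : ∀ l m, ContinuousOn (A l m) (Icc 0 1))
    (hu : ∀ t ∈ Icc (0 : ℝ) 1, ∀ l, HasDerivAt (fun t => u t l) (∑ m, A l m t * u t m) t)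
    (h0 : u 0 = 0) : u 1 = 0 := by
  choose c hc using fun l m => isCompact_Icc.exists_bound_of_continuousOn (hA l m)
  have hu' : ∀ t ∈ Icc (0 : ℝ) 1, HasDerivAt u (fun l => ∑ m, A l m t * u t m) t :=
    fun t ht => hasDerivAt_pi.2 (hu t ht)
  refine eq_zero_of_abs_deriv_le_mul_abs_self_of_eq_zero_right (K := ∑ l, ∑ m, |c l m|)
    (fun t ht => (hu' t ht).continuousAt.continuousWithinAt)
    (fun t ht => (hu' t (Ico_subset_Icc_self ht)).hasDerivWithinAt) h0 (fun t ht => ?_) 1 (by simp)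
  refine (pi_norm_le_iff_of_nonneg (by positivity)).2 fun l => ?_
  calc ‖∑ m, A l m t * u t m‖ ≤ ∑ m, |c l m| * ‖u t‖ := by
        refine norm_sum_le_of_le _ fun m _ => ?_
        rw [norm_mul]
        exact mul_le_mul ((hc l m t (Ico_subset_Icc_self ht)).trans (le_abs_self _))
          (norm_le_pi_norm (u t) m) (norm_nonneg _) (abs_nonneg _)
    _ = (∑ m, |c l m|) * ‖u t‖ := by rw [Finset.sum_mul]
    _ ≤ _ := by
        refine mul_le_mul_of_nonneg_right ?_ (norm_nonneg _)
        exact Finset.single_le_sum (f := fun l => ∑ m, |c l m|) (fun l _ => by positivity)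
          (Finset.mem_univ l)

open MvPolynomial in
theorem hasDerivAt_eval_comp {n : ℕ} (Q : MvPolynomial (Fin n) ℂ) {γ : ℝ → CSpace n} {γ' : CSpace n}
    {t : ℝ} (hγ : HasDerivAt γ γ' t) :
    HasDerivAt (fun t => eval (γ t) Q) (∑ j, eval (γ t) (pderiv j Q) * γ' j) t := by
  have h := ((hasStrictFDerivAt_eval Q (γ t)).restrictScalars ℝ).hasFDerivAt.comp_hasDerivAt t hγ
  rw [ContinuousLinearMap.coe_restrictScalars', dPoly_apply] at h
  exact h

open MvPolynomial Set in
/-- Along a path in the common zero set of `f₁, …, f_k` on which `δ ≠ 0`, generators of the ideal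
`P` satisfy a homogeneous linear differential equation. So they vanish along the path if they do so
at its start. -/
theorem eval_eq_zero_of_path {n k : ℕ} {P : Ideal (MvPolynomial (Fin n) ℂ)}
    {f : Fin k → MvPolynomial (Fin n) ℂ} {δ : MvPolynomial (Fin n) ℂ}
    {N : Fin n → Fin k → MvPolynomial (Fin n) ℂ}
    (hP : ∀ g ∈ P, ∀ j,
      δ * pderiv j g - ∑ i, (∑ l, pderiv l g * N l i) * pderiv j (f i) ∈ P) {γ γ' : ℝ → CSpace n}
    (hγ : ∀ t ∈ Icc (0 : ℝ) 1, HasDerivAt γ (γ' t) t) (hγ' : ContinuousOn γ' (Icc 0 1))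
    (hγδ : ∀ t ∈ Icc (0 : ℝ) 1, eval (γ t) δ ≠ 0)
    (hγf : ∀ t ∈ Icc (0 : ℝ) 1, ∀ i, eval (γ t) (f i) = 0) (h0 : ∀ g ∈ P, eval (γ 0) g = 0) :
    ∀ g ∈ P, eval (γ 1) g = 0 := by
  obtain ⟨r, g, hg⟩ := Submodule.fg_iff_exists_fin_generating_family.1
    ((isNoetherianRing_iff_ideal_fg _).1 inferInstance P)
  change Ideal.span (range g) = P at hg
  have hgP : ∀ l, g l ∈ P := fun l => by rw [← hg]; exact Ideal.subset_span ⟨l, rfl⟩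
  have hHex : ∀ l j, ∃ c : Fin r → MvPolynomial (Fin n) ℂ, ∑ m, c m * g m =
      δ * pderiv j (g l) - ∑ i, (∑ l', pderiv l' (g l) * N l' i) * pderiv j (f i) := by
    intro l j
    have := hP _ (hgP l) j
    rw [← hg] at this
    exact Ideal.mem_span_range_iff_exists_fun.1 this
  choose H hH using hHex
  have hγc : ContinuousOn γ (Icc 0 1) := fun t ht => (hγ t ht).continuousAt.continuousWithinAt
  have hQc : ∀ Q : MvPolynomial (Fin n) ℂ, ContinuousOn (fun t => eval (γ t) Q) (Icc 0 1) :=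
    fun Q => (contDiff_eval Q (m := 0)).continuous.comp_continuousOn hγc
  have hu : (fun l => eval (γ 1) (g l)) = 0 := by
    refine eq_zero_of_hasDerivAt_linear (u := fun t l => eval (γ t) (g l))
      (A := fun l m t => (∑ j, eval (γ t) (H l j m) * γ' t j) / eval (γ t) δ)
      (fun l m => ?_) (fun t ht l => ?_) ?_
    · refine ContinuousOn.div (continuousOn_finsetSum _ fun j _ => ?_) (hQc δ) hγδ
      exact (hQc _).mul ((continuous_apply j).comp_continuousOn hγ')
    · refine (hasDerivAt_eval_comp (g l) (hγ t ht)).congr_deriv ?_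
      have hf0 : ∀ i, ∑ j, eval (γ t) (pderiv j (f i)) * γ' t j = 0 := fun i =>
        eq_zero_of_hasDerivAt_of_eq_zero ht (hasDerivAt_eval_comp (f i) (hγ t ht))
          fun s hs => hγf s hs i
      have e1 : ∀ j, eval (γ t) δ * eval (γ t) (pderiv j (g l)) =
          ∑ m, eval (γ t) (H l j m) * eval (γ t) (g m) +
            ∑ i, (∑ l', eval (γ t) (pderiv l' (g l)) * eval (γ t) (N l' i)) *
              eval (γ t) (pderiv j (f i)) := by
        intro j
        have := congrArg (eval (γ t)) (hH l j)
        simp only [map_sum, map_mul, map_sub] at this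
        rw [this]
        ring
      have e2 : eval (γ t) δ * ∑ j, eval (γ t) (pderiv j (g l)) * γ' t j =
          ∑ m, (∑ j, eval (γ t) (H l j m) * γ' t j) * eval (γ t) (g m) +
            ∑ i, (∑ l', eval (γ t) (pderiv l' (g l)) * eval (γ t) (N l' i)) *
              ∑ j, eval (γ t) (pderiv j (f i)) * γ' t j := by
        calc eval (γ t) δ * ∑ j, eval (γ t) (pderiv j (g l)) * γ' t j
            = ∑ j, (∑ m, eval (γ t) (H l j m) * eval (γ t) (g m) +
            ∑ i, (∑ l', eval (γ t) (pderiv l' (g l)) * eval (γ t) (N l' i)) *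
              eval (γ t) (pderiv j (f i))) * γ' t j := by
              rw [Finset.mul_sum]
              refine Finset.sum_congr rfl fun j _ => ?_
              rw [← e1]
              ring
          _ = _ := by
              simp only [add_mul, Finset.sum_add_distrib]
              congr 1
              · simp only [Finset.sum_mul]
                rw [Finset.sum_comm]
                exact Finset.sum_congr rfl fun m _ => Finset.sum_congr rfl fun j _ => by ring
              · simp only [Finset.mul_sum]
                rw [Finset.sum_comm' (t' := Finset.univ) (s' := fun _ => Finset.univ) (by simp)]
                refine Finset.sum_congr rfl fun i _ => ?_
                rw [Finset.sum_mul]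
                exact Finset.sum_congr rfl fun j _ => by ring
      simp only [hf0, mul_zero, Finset.sum_const_zero, add_zero] at e2
      rw [eq_div_of_mul_eq (hγδ t ht) ((mul_comm _ _).trans e2), Finset.sum_div]
      exact Finset.sum_congr rfl fun m _ => by ring
    · funext l
      exact h0 _ (hgP l)
  intro q hq
  rw [← hg] at hq
  obtain ⟨c, rfl⟩ := Ideal.mem_span_range_iff_exists_fun.1 hq
  rw [map_sum]
  refine Finset.sum_eq_zero fun l _ => ?_
  rw [map_mul, show eval (γ 1) (g l) = 0 from congrFun hu l, mul_zero]

/-- A set defined by `k` independent complex equations is a submanifold of real codimension `2k`. -/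
theorem isSubmanifoldNear_of_contDiff_complex {n k : ℕ} (hk : k ≤ n) {h : CSpace n → Fin k → ℂ}
    (hC : ContDiff ℝ ∞ h) {S U : Set (CSpace n)} (hU : IsOpen U)
    (hsurj : ∀ x ∈ U ∩ S, Function.Surjective (fderiv ℝ h x)) (hS : ∀ x ∈ U, x ∈ S ↔ h x = 0)
    {w : CSpace n} (hwU : w ∈ U) (hw : w ∈ S) : IsSubmanifoldNear (2 * (n - k)) S w := by
  obtain ⟨e⟩ : Nonempty ((Fin k → ℂ) ≃L[ℝ] (Fin (2 * k) → ℝ)) :=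
    ⟨ContinuousLinearEquiv.ofFinrankEq (by
      rw [Module.finrank_fin_fun, Module.finrank_pi_fintype]
      simp [mul_comm])⟩
  refine ⟨hw, 2 * k, U, fun x => e (h x), by lia, hU, hwU, ?_, fun x hx => ?_, fun x hx => ?_⟩
  · exact (e.contDiff.comp hC).contDiffOn
  · have hd := (hC.differentiable (by simp) x).hasFDerivAt
    have h1 : fderiv ℝ (fun x => e (h x)) x = (e : (Fin k → ℂ) →L[ℝ] _).comp (fderiv ℝ h x) :=
      (e.hasFDerivAt.comp x hd).fderiv
    rw [h1]
    exact e.surjective.comp (hsurj x hx)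
  · rw [map_eq_zero_iff e e.injective]
    exact hS x hx

open MvPolynomial in
/-- The differential of `(f₁, …, f_k)` is surjective if the Jacobian matrix has a right inverse. -/
theorem surjective_pi_dPoly {n k : ℕ} {f : Fin k → MvPolynomial (Fin n) ℂ} {x : CSpace n} {c : ℂ}
    (hc : c ≠ 0) {N : Fin n → Fin k → ℂ}
    (hN : ∀ i i', ∑ j, eval x (pderiv j (f i)) * N j i' = if i = i' then c else 0) :
    Function.Surjective (ContinuousLinearMap.pi fun i => (dPoly (f i) x).restrictScalars ℝ) := by
  intro y
  refine ⟨fun j => ∑ i, N j i * y i / c, ?_⟩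
  ext i
  rw [ContinuousLinearMap.pi_apply, ContinuousLinearMap.coe_restrictScalars', dPoly_apply]
  calc ∑ j, eval x (pderiv j (f i)) * ∑ i', N j i' * y i' / c
      = ∑ i', (∑ j, eval x (pderiv j (f i)) * N j i') * y i' / c := by
        simp only [Finset.mul_sum, Finset.sum_mul, Finset.sum_div]
        rw [Finset.sum_comm]
        refine Finset.sum_congr rfl fun i' _ => Finset.sum_congr rfl fun j _ => ?_
        ring
    _ = y i := by
        simp only [hN]
        rw [Finset.sum_eq_single i (fun i' _ hi' => by simp [Ne.symm hi']) (by simp)]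
        rw [if_pos rfl, mul_div_cancel_left₀ _ hc]

open MvPolynomial Filter Topology Set in
/-- The Jacobian criterion: near each of its points where `δ ≠ 0`, the zero set of the ideal `P` is
the common zero set of the independent equations `f₁, …, f_k`. -/
theorem isSubmanifoldNear_of_jacobian_frame {n k : ℕ} (hk : k ≤ n)
    {P : Ideal (MvPolynomial (Fin n) ℂ)} {f : Fin k → MvPolynomial (Fin n) ℂ}
    {δ : MvPolynomial (Fin n) ℂ} {N : Fin n → Fin k → MvPolynomial (Fin n) ℂ} (hfP : ∀ i, f i ∈ P)
    (hN : ∀ i i', ∑ j, pderiv j (f i) * N j i' - (if i = i' then δ else 0) ∈ P)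
    (hP : ∀ g ∈ P, ∀ j,
      δ * pderiv j g - ∑ i, (∑ l, pderiv l g * N l i) * pderiv j (f i) ∈ P) {w : CSpace n}
    (hw : ∀ g ∈ P, eval w g = 0) (hδ : eval w δ ≠ 0) :
    IsSubmanifoldNear (2 * (n - k)) {x | (∀ g ∈ P, eval x g = 0) ∧ eval x δ ≠ 0} w := by
  obtain ⟨h, hh⟩ : ∃ h : CSpace n → Fin k → ℂ, h = fun x i => eval x (f i) := ⟨_, rfl⟩
  have hhi : ∀ x, h x = 0 ↔ ∀ i, eval x (f i) = 0 := fun x => by rw [funext_iff, hh]; rfl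
  have hC : ContDiff ℝ ∞ h := hh ▸
    contDiff_pi.2 fun i => (contDiff_eval (f i)).restrict_scalars ℝ
  have hsurj : ∀ x ∈ {x | (∀ g ∈ P, eval x g = 0) ∧ eval x δ ≠ 0},
      Function.Surjective (fderiv ℝ h x) := by
    rintro x ⟨hx, hδx⟩
    have hd : HasFDerivAt h (ContinuousLinearMap.pi fun i => (dPoly (f i) x).restrictScalars ℝ) x :=
      hh ▸ hasFDerivAt_pi.2 fun i => ((hasStrictFDerivAt_eval (f i) x).restrictScalars ℝ).hasFDerivAt
    rw [hd.fderiv]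
    refine surjective_pi_dPoly hδx (N := fun j i => eval x (N j i)) fun i i' => ?_
    have := hx _ (hN i i')
    rw [map_sub, map_sum, sub_eq_zero] at this
    simp only [map_mul] at this
    rw [this]
    split_ifs <;> simp
  have hδev : ∀ᶠ x in 𝓝 w, eval x δ ≠ 0 :=
    (contDiff_eval δ (m := 0)).continuous.continuousAt.eventually_ne hδ
  have hfw : h w = 0 := (hhi w).2 fun i => hw _ (hfP i)
  have hzero : ∀ᶠ y in 𝓝 w, h y = 0 → ∀ q ∈ P, eval y q = 0 := by
    filter_upwards [exists_path_in_level_set (hC.of_le (by exact_mod_cast le_top))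
      (hsurj w ⟨hw, hδ⟩) hδev] with y hy hy0
    obtain ⟨γ, γ', hγ, hγ', hγδ, hγh, hγ0, hγ1⟩ := hy (hy0.trans hfw.symm)
    rw [← hγ1]
    refine eval_eq_zero_of_path hP hγ hγ' hγδ (fun s hs => ?_) ?_
    · rw [← hhi, hγh s hs, hfw]
    · rw [hγ0]
      exact hw
  obtain ⟨U, hU, hUo, hwU⟩ := eventually_nhds_iff.1 (hzero.and hδev)
  refine isSubmanifoldNear_of_contDiff_complex hk hC hUo (fun x hx => hsurj x hx.2)
    (fun x hx => ?_) hwU ⟨hw, hδ⟩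
  rw [hhi]
  exact ⟨fun h1 i => h1.1 _ (hfP i), fun h1 => ⟨(hU x hx).1 ((hhi x).2 h1), (hU x hx).2⟩⟩

open MvPolynomial in
/-- A set that contains the common zeros of two polynomials in an affine chart has real codimension
at most `4`, if these polynomials have a common zero. -/
theorem exists_containsSubmanifold_of_common_zero {n : ℕ} {X : Set (CProj n)} (j : Fin (n + 1))
    (f : Fin 2 → MvPolynomial (Fin n) ℂ) {x : Fin n → ℂ} (hx : ∀ k, eval x (f k) = 0)
    (hX : ∀ w, (∀ k, eval w (f k) = 0) → affineChart j w ∈ X) :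
    ∃ d : ℕ, 2 * n ≤ d + 4 ∧ ContainsSubmanifold d X := by
  obtain ⟨P, s, b, hP, hfP, hs, hinj, hint⟩ := exists_prime_integral_over_polynomials f hx
  obtain ⟨k, F, δ, N, hk, hδ, hF, hN, hFP⟩ := exists_jacobian_frame P b hinj hint
  let T : Set (CSpace n) := {x | (∀ g ∈ P, eval x g = 0) ∧ eval x δ ≠ 0}
  obtain ⟨w, hwP, hwδ⟩ : T.Nonempty := by
    by_contra hT
    rw [Set.not_nonempty_iff_eq_empty, Set.eq_empty_iff_forall_notMem] at hT
    apply hδ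
    rw [← IsPrime.vanishingIdeal_zeroLocus (K := ℂ) P, mem_vanishingIdeal_iff]
    intro y hy
    by_contra hy0
    exact hT y ⟨fun g hg => by simpa using mem_zeroLocus_iff.1 hy g hg, by simpa using hy0⟩
  refine ⟨2 * (n - k), by lia, affineChart j '' T, ?_, ⟨_, w, ⟨hwP, hwδ⟩, rfl⟩, ?_⟩
  · rintro _ ⟨y, hy, rfl⟩
    exact hX y fun l => hy.1 _ (hfP l)
  · rintro _ ⟨y, hy, rfl⟩
    refine ⟨j, y, rfl, ?_⟩
    rw [Set.preimage_image_eq _ (affineChart_injective j)]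
    exact isSubmanifoldNear_of_jacobian_frame (by lia) hF hN hFP hy.1 hy.2

open MvPolynomial in
/-- Two homogeneous equations in at least three unknowns have a nonzero solution. -/
theorem exists_ne_zero_common_zero {n : ℕ} (hn : 2 ≤ n) (F : Fin 2 → MvPolynomial (Fin (n + 1)) ℂ)
    (h0 : ∀ k, eval 0 (F k) = 0) : ∃ z : CSpace (n + 1), z ≠ 0 ∧ ∀ k, eval z (F k) = 0 := by
  by_contra! hz
  let I : Ideal (MvPolynomial (Fin (n + 1)) ℂ) := Ideal.span (Set.range F)
  have hzl : zeroLocus ℂ I = {0} := by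
    ext z
    rw [zeroLocus_span]
    simp only [Set.forall_mem_range, Set.mem_ofPred_eq, Set.mem_singleton_iff, aeval_eq_eval]
    refine ⟨fun h => ?_, fun h k => by rw [h]; exact h0 k⟩
    by_contra hne
    obtain ⟨k, hk⟩ := hz z hne
    exact hk (h k)
  have hrad : I.radical = vanishingIdeal ℂ {(0 : Fin (n + 1) → ℂ)} := by
    rw [← hzl, vanishingIdeal_zeroLocus_eq_radical]
  have hmin : (vanishingIdeal ℂ {(0 : Fin (n + 1) → ℂ)} : Ideal (MvPolynomial (Fin (n + 1)) ℂ)) ∈ I.minimalPrimes := by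
    refine ⟨⟨inferInstance, hrad ▸ Ideal.le_radical⟩, fun q hq _ => ?_⟩
    rw [← hrad]
    exact hq.1.radical_le_iff.2 hq.2
  have h1 := Ideal.height_le_card_of_mem_minimalPrimes_span (Set.finite_range F) hmin
  have h2 : (Set.range F).ncard ≤ 2 := by
    rw [← Nat.card_coe_set_eq]
    exact (Finite.card_range_le F).trans (by simp)
  have h3 : ((n + 1 : ℕ) : ℕ∞) ≤ (2 : ℕ) :=
    (le_height_vanishingIdeal_singleton (0 : Fin (n + 1) → ℂ)).trans
      (h1.trans (by exact_mod_cast h2))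
  have : n + 1 ≤ 2 := by exact_mod_cast h3
  lia

/-! ### The dimension of the singular set -/

open MvPolynomial in
/-- Pseudoconvexity from both sides makes the Levi form, and with it the Levi minors, vanish on the
hypersurface `{g = 0}`. The irreducible polynomial `g` divides what vanishes there. -/
theorem IsLeviFlat.dvd_leviMinor {n : ℕ} {H : Set (CProj n)} (hflat : IsLeviFlat H)
    {j : Fin (n + 1)} {g : CPoly n} (hgi : Irreducible g) (hg : IsRealPoly g) {q : CSpace n}
    {a : Fin n} (hq : ev g q (star q) = 0) (ha : ev (pderiv (Sum.inl a) g) q (star q) ≠ 0)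
    (hH : ∀ᶠ w in nhds q, affineChart j w ∈ H ↔ ev g w (star w) = 0) (b d : Fin n) :
    g ∣ leviMinor g a b d := by
  obtain ⟨U, hU, hqU, hU1, hU2⟩ := hg.exists_isOpen (S := affineChart j ⁻¹' H) ha hH
  refine dvd_of_vanish_on_hypersurface hgi (hasStrictFDerivAt_ev_re g q) ?_ (by rw [hq]; rfl) ?_
  · rw [← (hasStrictFDerivAt_ev_re g q).hasFDerivAt.fderiv]
    exact hU1 q hqU
  · filter_upwards [hH, hU.mem_nhds hqU] with w hw hwU hw0
    have hwH : w ∈ affineChart j ⁻¹' H := (hU2 w hwU).2 hw0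
    obtain ⟨h1, h2⟩ := hflat j w _
      ⟨hwH, U, hU, hwU, (contDiff_ev_re g).contDiffOn, fun x hx => hU1 x hx.1, hU2⟩
    exact ⟨hw.1 hwH, hg.ev_leviMinor_eq_zero h1 h2 a b d⟩

open MvPolynomial in
/-- All points in which two fixed different leaves meet are singular, and they form a set of complex
codimension at most two. -/
theorem le_realDim_singularSet {n : ℕ} (hn : 2 ≤ n) {H : Set (CProj n)}
    (hH : IsAlgebraicHypervariety H) (hflat : IsLeviFlat H) :
    2 * (n : ℤ) - 4 ≤ realDim (singularSet H) := by
  obtain ⟨⟨V, hVa, hV, rfl⟩, hdim⟩ := hH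
  obtain ⟨J, hJ⟩ := hVa.exists_cpoly
  have hd := not_containsSubmanifold_of_realDim hdim
  obtain ⟨M, hM, hne, hsub⟩ := containsSubmanifold_of_realDim (k := 2 * n - 1)
    (by rw [hdim]; lia)
  obtain ⟨j, g, hgi, hg, hgJ, q, -, hq, ⟨a, ha⟩, hev⟩ :=
    exists_irreducible_defining_polynomial (by lia) hV hJ hd hM hne hsub
  have hdvd := hflat.dvd_leviMinor (j := j) hgi hg hq ha (by
    filter_upwards [hev] with x hx
    rw [affineChart_mem_projImage hV, hx])
  obtain ⟨F, hF, hFV, hFc, hFz, hndvd⟩ := exists_two_leaves hJ hgi hg hgJ hdvd hq ha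
  obtain ⟨z, hz, hFz⟩ := exists_ne_zero_common_zero hn F fun k => by
    obtain ⟨Z, -, hZ⟩ := hFz k
    simpa using hFc k Z hZ 0
  obtain ⟨l, hl⟩ : ∃ l, z l ≠ 0 := by
    by_contra! h
    exact hz (funext h)
  -- the common zeros of `F 0` and `F 1` in an affine chart
  let f : Fin 2 → MvPolynomial (Fin n) ℂ := fun k =>
    aeval (Fin.insertNth l 1 X : Fin (n + 1) → MvPolynomial (Fin n) ℂ) (F k)
  have hf : ∀ k w, eval w (f k) = eval (ins l w) (F k) := by
    intro k w
    refine (eval_aeval_mvPolynomial _ w (F k)).trans ?_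
    congr 2
    funext i
    refine Fin.succAboveCases l ?_ (fun b => ?_) i <;> simp
  obtain ⟨d, hd4, hdX⟩ := exists_containsSubmanifold_of_common_zero
    (X := singularSet (projImage V)) l f (x := fun b => z (l.succAbove b) / z l) (fun k => by
      rw [hf, ← (eq_inv_smul_iff₀ hl).2 (eq_smul_ins l hl).symm |>.symm]
      exact hFc k z (hFz k) _) (fun w hw =>
      mem_singularSet_of_common_zero hV hd (hF 1) hFV hndvd (insertNth_one_ne_zero l w) fun k => by
        rw [← hf]; exact hw k)
  have := le_realDim hdX
  lia

end LeviFlat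

end

theorem mainTheorem10 (n : ℕ) (hn : 1 ≤ n) (H : Set (LeviFlat.CProj n))
    (hH : LeviFlat.IsAlgebraicHypervariety H) (hflat : LeviFlat.IsLeviFlat H) :
    2 * (n : ℤ) - 4 ≤ LeviFlat.realDim (LeviFlat.singularSet H) ∧
      LeviFlat.realDim (LeviFlat.singularSet H) ≤ 2 * (n : ℤ) - 2 := by
  refine ⟨?_, LeviFlat.realDim_singularSet_le hn hH⟩
  rcases Nat.lt_or_ge n 2 with h | h
  · have := LeviFlat.neg_one_le_realDim (LeviFlat.singularSet H)
    lia
  · exact LeviFlat.le_realDim_singularSet h hH hflat
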